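/- **Setting.** Let $\mathbb A$ be an additive category and $X$ a locally finite simplicial complex of finite dimension $\dim X\le d$, with an order of its vertices (total on each simplex). Simplices $\sigma$ are closed and nonempty, $|\sigma|$ is the dimension, $\tau\le\sigma$ means that $\tau$ is a face of $\sigma$. *Categories.* For a set $S$, the category $\mathbb G_S(\mathbb A)$ has as objects the families $M=\{M(\sigma)\}_{\sigma\in S}$ of objects of $\mathbb A$, and as morphisms $M\to N$ the matrices $\{f_{\tau,\sigma}:M(\sigma)\to N(\tau)\}$ such that for each $\sigma$ only finitely many $f_{\tau,\sigma}$ are nonzero; composition is matrix multiplication. For a simplicial complex $Y$, $\mathbb G_Y(\mathbb A)$ is the case where $S$ is the set of simplices of $Y$; $\mathbb A^*(Y)$ (resp. $\mathbb A_*(Y)$) is the subcategory with the same objects and with the morphisms such that $f_{\tau,\sigma}=0$ unless $\tau\le\sigma$ (resp. $\tau\ge\sigma$). $\mathbb A(Y)$ denotes either one, the same one throughout. Let $C$ be a chain complex in $\mathbb A(X)$ with $C_n=0$ for all but finitely many $n\in\mathbb Z$. For a simplex $\sigma$ the chain complex $C(\sigma)$ in $\mathbb A$ consists of the objects $C_n(\sigma)$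 and the diagonal components $(d_C)_{\sigma,\sigma}$ of the differential. *Subdivision.* $Sd\,X$ is the barycentric subdivision; its simplices are the finite nonempty chains of simplices of $X$, and its vertices are ordered by inclusion. Let $r:Sd\,X\to X$ be a simplicial approximation of the identity, i.e. send each barycentre $\widehat s$ to a chosen vertex of $s$. For a chain complex $D$ in $\mathbb A(X)$, the algebraic subdivision $Sd_r D$ in $\mathbb A(Sd\,X)$ is given, for a simplex $\tilde\sigma$ of $Sd\,X$ with $\sigma=r\tilde\sigma$, by $$(Sd_rD)(\tilde\sigma)_n=D(\sigma)_{n+|\sigma|-|\tilde\sigma|}\quad\text{for }\mathbb A^*,\qquad (Sd_rD)(\tilde\sigma)_n=D(\sigma)_{n+|\tilde\sigma|-|\sigma|}\quad\text{for }\mathbb A_*,$$ and the component of its differential from $\tilde\sigma$ to $\tilde\tau$ in degree $n$ (with $\sigma=r\tilde\sigma$, $\tau=r\tilde\tau$) is $(d_D)_{\tau,\sigma}$ if $\tilde\tau\le\tilde\sigma$ (resp. $\tilde\tau\ge\tilde\sigma$) and $|\tilde\tau|-|\tau|=|\tilde\sigma|-|\sigma|$; it is $(-1)^n[\tilde\sigma:\tilde\tau]\,\mathrm{id}_{D(\sigma)}$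 if $\sigma=\tau$ and $\tilde\tau$ is a codimension one face of $\tilde\sigma$ (resp. $(-1)^n[\tilde\tau:\tilde\sigma]\,\mathrm{id}_{D(\sigma)}$ if $\sigma=\tau$ and $\tilde\sigma$ is a codimension one face of $\tilde\tau$); and it is $0$ otherwise. Here, if $\tilde\rho$ is a simplex of $Sd\,X$ and $x$ a vertex of $\tilde\rho$ such that $r(\tilde\rho\smallsetminus x)=r\tilde\rho$, then $[\tilde\rho:\tilde\rho\smallsetminus x]=(-1)^{a-b}$, where $a$ is the number of vertices of $\tilde\rho$ that come before $x$ when the vertices $y$ of $\tilde\rho$ are ordered lexicographically by $(r(y),y)$, and $b$ is the number of vertices of $r\tilde\rho$ that come before $r(x)$. Fix for every $j\ge 0$ a simplicial approximation $r_j:Sd^{j+1}X\to Sd^jX$ of the identity, and let $Sd^jC=Sd_{r_{j-1}}\cdots Sd_{r_0}C$ in $\mathbb A(Sd^jX)$. The $r_j$ may be chosen arbitrarily, subject only to the following condition: for some $i\ge0$ and every simplex $\sigma$ of $X$, the composite $r_0\circ\dots\circ r_{i-1}:Sd^iX\to X$ maps into $\sigma$ every simplex of $Sd^iX$ that has a vertex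 in $\sigma$. (Such choices exist for every $X$.) *The product with $\mathbb R$.* Let $v_i=i$ for $i\le0$ and $v_i=\sum_{k=0}^{i-1}\left(\frac{d+2}{d+1}\right)^k$ for $i\ge0$. Let $t^0(X\times\mathbb R)$ be the triangulation of $X\times\mathbb R$ that is $Sd^{\max(0,i)}X$ on $X\times\{v_i\}$, with the standard prism triangulations in between. Let "$C\otimes\mathbb Z$" be the chain complex in $\mathbb G_{t^0(X\times\mathbb R)}(\mathbb A)$ that is $Sd^{\max(0,i)}C$ on the simplices in $X\times\{v_i\}$ for each $i\in\mathbb Z$, is $0$ on all other simplices, and whose differential has no nonzero components between different slices. *The cone.* Give $X$ the path metric $d_X$ for which each $n$-simplex is isometric to the standard simplex in $\mathbb R^{n+1}$ (with $d_X=\infty$ between different components). Distances in the open cone $O(X^+)=X\times\mathbb R/\!\sim$, where $(x,t)\sim(x',t)$ for $t\le 0$, are measured by $$d\big((x,t),(y,s)\big)=\max\{\min\{t,s\},0\}\,d_X(x,y)+|t-s|\qquad(0\cdot\infty=0).$$ **Theorem.** The following are equivalent: 1. $C(\sigma)$ is chain contractible in $\mathbb A$ for every simplex $\sigma$ of $X$;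 2. $C$ is chain contractible in $\mathbb A(X)$; 3. "$C\otimes\mathbb Z$" is chain contractible in $\mathbb G_{t^0(X\times\mathbb R)}(\mathbb A)$ with finite bound measured in $O(X^+)$: there are a chain contraction $P$ of "$C\otimes\mathbb Z$" in $\mathbb G_{t^0(X\times\mathbb R)}(\mathbb A)$ and a real number $B$ such that $P_{\tau,\sigma}\neq0$ implies that the images in $O(X^+)$ of the barycentres of $\sigma$ and $\tau$ have distance at most $B$. -/

import Mathlib

open CategoryTheory CategoryTheory.Limits

universe u v w

noncomputable section

/-- Families of objects of `𝒜` indexed by `S`, thought of as the formal direct sums `∑ M(σ)`. The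
relation `R` does not enter the objects, only the morphisms: the component of a morphism from `σ` to
`τ` may be nonzero only if `R σ τ` holds. -/
structure Graded (S : Type w) (R : S → S → Prop) (𝒜 : Type u) where
  obj : S → 𝒜

namespace Graded

variable {S : Type w} {R : S → S → Prop} {𝒜 : Type u} [Category.{v} 𝒜] [Preadditive 𝒜]

/-- A morphism: a matrix of morphisms of `𝒜`, where `app σ τ` is the component from the summand at
`σ` to the summand at `τ`. For each `σ` only finitely many components starting at `σ` are nonzero. -/
structure Hom (M N : Graded S R 𝒜) where
  app : ∀ σ τ : S, M.obj σ ⟶ N.obj τ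
  finite : ∀ σ, {τ | app σ τ ≠ 0}.Finite
  support : ∀ σ τ, ¬ R σ τ → app σ τ = 0

theorem Hom.ext' {M N : Graded S R 𝒜} {f g : Hom M N} (h : ∀ σ τ, f.app σ τ = g.app σ τ) : f = g := by
  cases f; cases g; congr; funext σ τ; exact h σ τ

open scoped Classical in
/-- The identity matrix. -/
def Hom.id [Std.Refl R] (M : Graded S R 𝒜) : Hom M M where
  app σ τ := if h : σ = τ then eqToHom (congrArg M.obj h) else 0
  finite σ := (Set.finite_singleton σ).subset fun τ h => by
    by_contra h'
    exact h (dif_neg fun e => h' (by simp [e]))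
  support σ τ h := dif_neg fun e => h (by subst e; exact Std.Refl.refl σ)

theorem comp_finite {M N P : Graded S R 𝒜} (f : Hom M N) (g : Hom N P) (σ ρ : S) :
    (Function.support fun τ => f.app σ τ ≫ g.app τ ρ).Finite :=
  (f.finite σ).subset fun τ h h' => h (by simp [h'])

theorem comp_eq_sum {M N P : Graded S R 𝒜} (f : Hom M N) (g : Hom N P) (σ ρ : S) (s : Finset S)
    (hs : ∀ τ, f.app σ τ ≠ 0 → τ ∈ s) :
    ∑ᶠ τ, f.app σ τ ≫ g.app τ ρ = ∑ τ ∈ s, f.app σ τ ≫ g.app τ ρ :=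
  finsum_eq_sum_of_support_subset _ fun τ h => hs τ fun h' => h (by simp [h'])

/-- Composition is multiplication of matrices; all the sums are finite. -/
def Hom.comp [IsTrans S R] {M N P : Graded S R 𝒜} (f : Hom M N) (g : Hom N P) : Hom M P where
  app σ ρ := ∑ᶠ τ, f.app σ τ ≫ g.app τ ρ
  finite σ := by
    refine ((f.finite σ).biUnion fun τ _ => g.finite τ).subset fun ρ h => ?_
    obtain ⟨τ, hτ⟩ : ∃ τ, f.app σ τ ≫ g.app τ ρ ≠ 0 := by
      by_contra! h'
      exact h (finsum_eq_zero_of_forall_eq_zero h')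
    simp only [Set.mem_iUnion, Set.mem_ofPred_eq]
    exact ⟨τ, fun e => hτ (by simp [e]), fun e => hτ (by simp [e])⟩
  support σ ρ h := by
    refine finsum_eq_zero_of_forall_eq_zero fun τ => ?_
    by_cases h1 : R σ τ
    · rw [g.support τ ρ fun h2 => h (IsTrans.trans _ _ _ h1 h2), comp_zero]
    · rw [f.support σ τ h1, zero_comp]

instance [Std.Refl R] [IsTrans S R] : Category (Graded S R 𝒜) where
  Hom := Hom
  id := Hom.id
  comp := Hom.comp
  id_comp {M N} f := by
    classical
    refine Hom.ext' fun σ ρ => ?_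
    refine (comp_eq_sum (Hom.id M) f σ ρ {σ} fun τ h => ?_).trans ?_
    · by_contra h'
      exact h (dif_neg fun e => h' (by simp [e]))
    · simp [Hom.id]
  comp_id {M N} f := by
    classical
    refine Hom.ext' fun σ ρ => ?_
    refine (finsum_eq_single _ ρ fun τ h => ?_).trans ?_
    · simp [Hom.id, h]
    · simp [Hom.id]
  assoc {M N P Q} f g h := by
    classical
    refine Hom.ext' fun σ ρ => ?_
    let s := (f.finite σ).toFinset
    let t := s.biUnion fun τ => (g.finite τ).toFinset
    have h1 : ∀ τ', (Hom.comp f g).app σ τ' = ∑ τ ∈ s, f.app σ τ ≫ g.app τ τ' := fun τ' =>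
      comp_eq_sum f g σ τ' s fun τ h => by simpa [s] using h
    have h2 : ∀ τ ∈ s, (Hom.comp g h).app τ ρ = ∑ τ' ∈ t, g.app τ τ' ≫ h.app τ' ρ := fun τ hτ =>
      comp_eq_sum g h τ ρ t fun τ' h' => Finset.mem_biUnion.2 ⟨τ, hτ, by simpa using h'⟩
    have h3 : (Hom.comp (Hom.comp f g) h).app σ ρ = ∑ τ' ∈ t, (Hom.comp f g).app σ τ' ≫ h.app τ' ρ := by
      refine comp_eq_sum (Hom.comp f g) h σ ρ t fun τ' h' => ?_
      rw [h1] at h'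
      obtain ⟨τ, hτ, h''⟩ := Finset.exists_ne_zero_of_sum_ne_zero h'
      exact Finset.mem_biUnion.2 ⟨τ, hτ, by simpa using fun e => h'' (by simp [e])⟩
    have h4 : (Hom.comp f (Hom.comp g h)).app σ ρ = ∑ τ ∈ s, f.app σ τ ≫ (Hom.comp g h).app τ ρ :=
      comp_eq_sum f (Hom.comp g h) σ ρ s fun τ h => by simpa [s] using h
    have h5 : ∀ τ ∈ s, f.app σ τ ≫ (Hom.comp g h).app τ ρ =
        ∑ τ' ∈ t, f.app σ τ ≫ g.app τ τ' ≫ h.app τ' ρ := fun τ hτ => by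
      rw [h2 τ hτ, Preadditive.comp_sum]
    have h6 : ∀ τ' ∈ t, (Hom.comp f g).app σ τ' ≫ h.app τ' ρ =
        ∑ τ ∈ s, f.app σ τ ≫ g.app τ τ' ≫ h.app τ' ρ := fun τ' _ => by
      rw [h1, Preadditive.sum_comp]
      exact Finset.sum_congr rfl fun τ _ => Category.assoc _ _ _
    rw [h3, h4, Finset.sum_congr rfl h5, Finset.sum_congr rfl h6, Finset.sum_comm]

variable [Std.Refl R] [IsTrans S R]

/-- The component of a morphism from `σ` to `τ`. -/
def app {M N : Graded S R 𝒜} (f : M ⟶ N) (σ τ : S) : M.obj σ ⟶ N.obj τ := Hom.app f σ τ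

theorem hom_ext {M N : Graded S R 𝒜} {f g : M ⟶ N} (h : ∀ σ τ, app f σ τ = app g σ τ) : f = g :=
  Hom.ext' h

theorem comp_app {M N P : Graded S R 𝒜} (f : M ⟶ N) (g : N ⟶ P) (σ ρ : S) :
    app (f ≫ g) σ ρ = ∑ᶠ τ, app f σ τ ≫ app g τ ρ := rfl

theorem comp_app_eq_sum {M N P : Graded S R 𝒜} (f : M ⟶ N) (g : N ⟶ P) (σ ρ : S) (s : Finset S)
    (hs : ∀ τ, app f σ τ ≠ 0 → τ ∈ s) :
    app (f ≫ g) σ ρ = ∑ τ ∈ s, app f σ τ ≫ app g τ ρ := comp_eq_sum f g σ ρ s hs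

instance {M N : Graded S R 𝒜} : Zero (M ⟶ N) :=
  ⟨Hom.mk (fun _ _ => 0) (fun σ => by simp) (fun _ _ _ => rfl)⟩

instance {M N : Graded S R 𝒜} : Add (M ⟶ N) :=
  ⟨fun f g => Hom.mk (fun σ τ => app f σ τ + app g σ τ)
    (fun σ => ((f.finite σ).union (g.finite σ)).subset fun τ h => by
      by_contra h'
      simp only [Set.mem_union, Set.mem_ofPred_eq, not_or, not_not] at h'
      exact h (by simp [app, h'.1, h'.2]))
    (fun σ τ h => by simp [app, f.support σ τ h, g.support σ τ h])⟩

instance {M N : Graded S R 𝒜} : Neg (M ⟶ N) :=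
  ⟨fun f => Hom.mk (fun σ τ => - app f σ τ)
    (fun σ => (f.finite σ).subset fun τ h h' => h (by simp [app, h']))
    (fun σ τ h => by simp [app, f.support σ τ h])⟩

theorem add_app {M N : Graded S R 𝒜} (f g : M ⟶ N) (σ τ : S) :
    app (f + g) σ τ = app f σ τ + app g σ τ := rfl

theorem zero_app (M N : Graded S R 𝒜) (σ τ : S) : app (0 : M ⟶ N) σ τ = 0 := rfl

instance {M N : Graded S R 𝒜} : AddCommGroup (M ⟶ N) where
  add_assoc f g h := hom_ext fun σ τ => add_assoc _ _ _
  zero_add f := hom_ext fun σ τ => zero_add _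
  add_zero f := hom_ext fun σ τ => add_zero _
  add_comm f g := hom_ext fun σ τ => add_comm _ _
  neg_add_cancel f := hom_ext fun σ τ => neg_add_cancel (app f σ τ)
  nsmul := nsmulRec
  zsmul := zsmulRec

instance : Preadditive (Graded S R 𝒜) where
  add_comp M N P f f' g := hom_ext fun σ ρ => by
    classical
    let s := (f.finite σ).toFinset ∪ (f'.finite σ).toFinset
    rw [add_app, comp_app_eq_sum _ _ σ ρ s, comp_app_eq_sum _ _ σ ρ s, comp_app_eq_sum _ _ σ ρ s,
      ← Finset.sum_add_distrib]
    · exact Finset.sum_congr rfl fun τ _ => by rw [add_app, Preadditive.add_comp]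
    · intro τ h; simp only [s, Finset.mem_union, Set.Finite.mem_toFinset]; exact .inr h
    · intro τ h; simp only [s, Finset.mem_union, Set.Finite.mem_toFinset]; exact .inl h
    · intro τ h
      simp only [s, Finset.mem_union, Set.Finite.mem_toFinset]
      by_contra h'
      simp only [Set.mem_ofPred_eq, not_or, not_not] at h'
      exact h (by rw [add_app]; simp [app, h'.1, h'.2])
  comp_add M N P f g g' := hom_ext fun σ ρ => by
    let s := (f.finite σ).toFinset
    have hs : ∀ τ, app f σ τ ≠ 0 → τ ∈ s := fun τ h => by
      simp only [s, Set.Finite.mem_toFinset]; exact h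
    rw [add_app, comp_app_eq_sum _ _ σ ρ s hs, comp_app_eq_sum _ _ σ ρ s hs,
      comp_app_eq_sum _ _ σ ρ s hs, ← Finset.sum_add_distrib]
    exact Finset.sum_congr rfl fun τ _ => by rw [add_app, Preadditive.comp_add]

end Graded

/-! Combinatorics of a map `r` on vertices, where finite sets of vertices stand for simplices. -/

namespace Sd

open scoped Classical

variable {α β : Type w} (r : α → β)

/-- The difference of the dimensions of a simplex and of its image under `r`. -/
def excess (c : Finset α) : ℤ := (c.card : ℤ) - ((c.image r).card : ℤ)

theorem excess_mono {S L : Finset α} (h : S ⊆ L) : excess r S ≤ excess r L := by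
  have h1 : (L.image r).card ≤ (S.image r).card + (L \ S).card := by
    have : L.image r ⊆ S.image r ∪ (L \ S).image r := by
      rw [← Finset.image_union, Finset.union_sdiff_of_subset h]
    exact (Finset.card_le_card this).trans ((Finset.card_union_le _ _).trans
      (Nat.add_le_add_left Finset.card_image_le _))
  have h2 := Finset.card_sdiff_add_card_eq_card h
  unfold excess
  omega

theorem exists_unique_between {S L : Finset α} (h : S ⊆ L) (he : excess r S = excess r L)
    {t : Finset β} (h1 : S.image r ⊆ t) (h2 : t ⊆ L.image r) :
    ∃ b : Finset α, S ⊆ b ∧ b ⊆ L ∧ excess r b = excess r L ∧ b.image r = t ∧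
      ∀ b' : Finset α, b' ⊆ L → excess r b' = excess r L → b'.image r = t → b' = b := by
  have h3 : S ⊆ L.filter (r · ∈ t) := fun x hx =>
    Finset.mem_filter.2 ⟨h hx, h1 (Finset.mem_image_of_mem r hx)⟩
  have h4 : (L.filter (r · ∈ t)).image r = t := by
    ext u
    simp only [Finset.mem_image, Finset.mem_filter]
    refine ⟨?_, fun hu => ?_⟩
    · rintro ⟨x, ⟨_, hx⟩, rfl⟩; exact hx
    · obtain ⟨x, hx, rfl⟩ := Finset.mem_image.1 (h2 hu)
      exact ⟨x, ⟨hx, hu⟩, rfl⟩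
  have h5 : excess r (L.filter (r · ∈ t)) = excess r L :=
    le_antisymm (excess_mono r (Finset.filter_subset _ _)) (he ▸ excess_mono r h3)
  refine ⟨L.filter (r · ∈ t), h3, Finset.filter_subset _ _, h5, h4, fun b' h6 h7 h8 => ?_⟩
  refine Finset.eq_of_subset_of_card_le (fun x hx => Finset.mem_filter.2
    ⟨h6 hx, h8 ▸ Finset.mem_image_of_mem r hx⟩) ?_
  unfold excess at *
  rw [h4] at h5
  rw [h8] at h7
  omega

variable [PartialOrder α] [PartialOrder β]

/-- Order the vertices `y` of the simplex `c` lexicographically by `(r y, y)`. Then `place r c x` is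
the number of vertices of `c` before `x` plus the number of vertices of the image before `r x`. -/
def place (c : Finset α) (x : α) : ℕ :=
  (c.filter fun y => r y < r x ∨ (r y = r x ∧ y < x)).card + ((c.image r).filter (· < r x)).card

/-- The sign of the face opposite to `x` of a simplex `c` whose image does not change when `x` is left
out. The fibres of `r` on `c` over the vertices `u_0 < ... < u_k` of the image, with `f_0, ..., f_k`
elements, exhibit `c` as a simplex in the product of the image and of a space of dimension
`∑ (f_j - 1)`; the sign is `(-1) ^ (∑ (f_j - 1) + q)`, where the sum is over the fibres before the
one of `x`, and where `q` is the number of elements before `x` in its own fibre. -/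
def sign (c : Finset α) (x : α) : ℤ := (-1) ^ place r c x

/-- The incidence number of `c` and `c'`, i.e. the component from `c` to `c'` of the simplicial
boundary, desuspended by the dimension of the image, between simplices with the same image under
`r`. It is `0` unless `c'` is a face of `c` of codimension one with the same image, and then the sum
has a single term. -/
def incidence (c c' : Finset α) : ℤ :=
  if c' ⊆ c ∧ c.card = c'.card + 1 ∧ c.image r = c'.image r then ∑ x ∈ c \ c', sign r c x else 0

theorem incidence_insert {S : Finset α} {x : α} (hx : x ∉ S) (h : r x ∈ S.image r) :
    incidence r (insert x S) S = sign r (insert x S) x := by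
  have h1 : (insert x S).image r = S.image r := by
    rw [Finset.image_insert, Finset.insert_eq_of_mem h]
  rw [incidence, if_pos ⟨Finset.subset_insert _ _, Finset.card_insert_of_notMem hx, h1⟩]
  simp [hx]

theorem incidence_erase {L : Finset α} {x : α} (hx : x ∈ L) (h : r x ∈ (L.erase x).image r) :
    incidence r L (L.erase x) = sign r L x := by
  conv_lhs => rw [← Finset.insert_erase hx]
  simp only [Finset.erase_insert_eq_erase, Finset.erase_idem]
  rw [incidence_insert r (Finset.notMem_erase x L) h, Finset.insert_erase hx]

theorem exists_of_incidence_ne_zero {L S : Finset α} (h : incidence r L S ≠ 0) :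
    ∃ x ∈ L, x ∉ S ∧ S = L.erase x ∧ L = insert x S ∧ r x ∈ S.image r ∧ L.image r = S.image r := by
  unfold incidence at h
  split_ifs at h with h1
  · obtain ⟨h2, h3, h4⟩ := h1
    obtain ⟨x, hx⟩ : ∃ x, L \ S = {x} := Finset.card_eq_one.1 (by
      have := Finset.card_sdiff_add_card_eq_card h2
      omega)
    have hx' : x ∈ L ∧ x ∉ S := by
      rw [← Finset.mem_sdiff, hx]; exact Finset.mem_singleton_self x
    have h5 : L = insert x S := by
      rw [Finset.insert_eq, ← hx, Finset.sdiff_union_of_subset h2]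
    refine ⟨x, hx'.1, hx'.2, ?_, h5, ?_, h4⟩
    · rw [h5, Finset.erase_insert hx'.2]
    · rw [← h4]; exact Finset.mem_image_of_mem r hx'.1
  · exact absurd rfl h

theorem excess_of_incidence_ne_zero {L S : Finset α} (h : incidence r L S ≠ 0) :
    excess r L = excess r S + 1 := by
  obtain ⟨x, _, h2, _, h4, _, h6⟩ := exists_of_incidence_ne_zero r h
  have := Finset.card_insert_of_notMem h2
  rw [← h4] at this
  unfold excess
  rw [h6]
  omega

variable {r}

theorem sign_erase {L : Finset α} {x y : α} (hx : x ∈ L)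
    (hL : (L.image r).card = ((L.erase x).image r).card)
    (h : r x < r y ∨ (r x = r y ∧ x < y)) :
    sign r (L.erase x) y = - sign r L y := by
  have h1 : (L.erase x).image r = L.image r :=
    Finset.eq_of_subset_of_card_le (Finset.image_subset_image (Finset.erase_subset _ _)) hL.le
  unfold sign place
  rw [h1, Finset.filter_erase]
  have h2 : x ∈ L.filter fun z => r z < r y ∨ (r z = r y ∧ z < y) := Finset.mem_filter.2 ⟨hx, h⟩
  have h3 := Finset.card_erase_add_one h2
  rw [← h3]
  ring

theorem sign_erase_of_lt {L : Finset α} {x y : α}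
    (hL : (L.image r).card = ((L.erase y).image r).card)
    (h : r x < r y ∨ (r x = r y ∧ x < y)) :
    sign r (L.erase y) x = sign r L x := by
  have h1 : (L.erase y).image r = L.image r :=
    Finset.eq_of_subset_of_card_le (Finset.image_subset_image (Finset.erase_subset _ _)) hL.le
  unfold sign place
  rw [h1, Finset.filter_erase]
  have h2 : y ∉ L.filter fun z => r z < r x ∨ (r z = r x ∧ z < x) := fun h3 => by
    rcases (Finset.mem_filter.1 h3).2 with h4 | h4 <;> rcases h with h5 | h5
    · exact lt_asymm h4 h5
    · exact h4.ne h5.1.symm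
    · exact h5.ne h4.1.symm
    · exact lt_asymm h4.2 h5.2
  rw [Finset.erase_eq_of_notMem h2]

theorem sum_incidence_mul_incidence {L S : Finset α}
    (tα : ∀ a ∈ L, ∀ b ∈ L, a ≤ b ∨ b ≤ a) (tβ : ∀ a ∈ L.image r, ∀ b ∈ L.image r, a ≤ b ∨ b ≤ a) :
    ∑ b ∈ Finset.Icc S L, incidence r L b * incidence r b S = 0 := by
  by_cases hex : ∃ b, incidence r L b * incidence r b S ≠ 0
  swap
  · push Not at hex
    exact Finset.sum_eq_zero fun b _ => hex b
  obtain ⟨b, hb⟩ := hex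
  obtain ⟨x, hx, hxb, e1, e2, hr, him⟩ := exists_of_incidence_ne_zero r (left_ne_zero_of_mul hb)
  obtain ⟨y, hy, hyS, e3, e4, hr', him'⟩ := exists_of_incidence_ne_zero r (right_ne_zero_of_mul hb)
  have hxy : x ≠ y := fun h => hxb (h ▸ hy)
  have hyL : y ∈ L := by rw [e2]; exact Finset.mem_insert_of_mem hy
  have hS : S = (L.erase x).erase y := by rw [← e1, e3]
  have hS' : S = (L.erase y).erase x := by rw [hS, Finset.erase_right_comm]
  have hI : L.image r = S.image r := him.trans him'
  have im : ∀ b, S ⊆ b → b ⊆ L → b.image r = S.image r := fun b h1 h2 =>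
    ((Finset.image_subset_image h2).trans hI.subset).antisymm (Finset.image_subset_image h1)
  have sx : S ⊆ L.erase x := hS ▸ Finset.erase_subset _ _
  have sy : S ⊆ L.erase y := hS' ▸ Finset.erase_subset _ _
  have ix := im _ sx (Finset.erase_subset _ _)
  have iy := im _ sy (Finset.erase_subset _ _)
  have mx : r x ∈ S.image r := hI ▸ Finset.mem_image_of_mem r hx
  have my : r y ∈ S.image r := hI ▸ Finset.mem_image_of_mem r hyL
  have yx : y ∈ L.erase x := Finset.mem_erase.2 ⟨hxy.symm, hyL⟩
  have xy : x ∈ L.erase y := Finset.mem_erase.2 ⟨hxy, hx⟩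
  have key : ∑ b ∈ Finset.Icc S L, incidence r L b * incidence r b S =
      ∑ b ∈ {L.erase x, L.erase y}, incidence r L b * incidence r b S := by
    refine (Finset.sum_subset (fun b hb => ?_) fun b _ hb => ?_).symm
    · rw [Finset.mem_insert, Finset.mem_singleton] at hb
      rw [Finset.mem_Icc]
      rcases hb with rfl | rfl
      · exact ⟨sx, Finset.erase_subset _ _⟩
      · exact ⟨sy, Finset.erase_subset _ _⟩
    · by_contra h
      obtain ⟨z, hz, _, e5, -⟩ := exists_of_incidence_ne_zero r (left_ne_zero_of_mul h)
      obtain ⟨_, _, _, e6, -⟩ := exists_of_incidence_ne_zero r (right_ne_zero_of_mul h)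
      have hzS : z ∉ S := fun h => by
        rw [e6, e5] at h
        exact Finset.notMem_erase _ _ (Finset.mem_of_mem_erase h)
      have : z = x ∨ z = y := by
        by_contra! h
        exact hzS (hS ▸ Finset.mem_erase.2 ⟨h.2, Finset.mem_erase.2 ⟨h.1, hz⟩⟩)
      rw [Finset.mem_insert, Finset.mem_singleton] at hb
      rcases this with rfl | rfl
      · exact hb (.inl e5)
      · exact hb (.inr e5)
  have hne : L.erase x ≠ L.erase y := fun h => Finset.notMem_erase x L (h ▸ xy)
  have f1 : incidence r L (L.erase x) = sign r L x := incidence_erase r hx (by rw [ix]; exact mx)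
  have f2 : incidence r L (L.erase y) = sign r L y := incidence_erase r hyL (by rw [iy]; exact my)
  have f3 : incidence r (L.erase x) S = sign r (L.erase x) y := by
    rw [hS]; exact incidence_erase r yx (by rw [← hS]; exact my)
  have f4 : incidence r (L.erase y) S = sign r (L.erase y) x := by
    rw [hS']; exact incidence_erase r xy (by rw [← hS']; exact mx)
  rw [key, Finset.sum_pair hne, f1, f2, f3, f4]
  have cmp : (r x < r y ∨ (r x = r y ∧ x < y)) ∨ (r y < r x ∨ (r y = r x ∧ y < x)) := by
    by_cases h : r x = r y
    · rcases tα x hx y hyL with h' | h'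
      · exact .inl (.inr ⟨h, lt_of_le_of_ne h' hxy⟩)
      · exact .inr (.inr ⟨h.symm, lt_of_le_of_ne h' hxy.symm⟩)
    · rcases tβ _ (Finset.mem_image_of_mem r hx) _ (Finset.mem_image_of_mem r hyL) with h' | h'
      · exact .inl (.inl (lt_of_le_of_ne h' h))
      · exact .inr (.inl (lt_of_le_of_ne h' (Ne.symm h)))
  have cx : (L.image r).card = ((L.erase x).image r).card := by rw [ix, hI]
  have cy : (L.image r).card = ((L.erase y).image r).card := by rw [iy, hI]
  rcases cmp with h | h
  · rw [sign_erase hx cx h, sign_erase_of_lt cy h]; ring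
  · rw [sign_erase hyL cy h, sign_erase_of_lt cx h]; ring

theorem sign_insert_eq {L S : Finset α} {x : α} (hSL : insert x S ⊆ L)
    (hr : r x ∈ S.image r)
    (h1 : ∀ y ∈ L \ insert x S, r y ∉ S.image r)
    (h2 : ∀ y ∈ L \ insert x S, ∀ z ∈ L \ insert x S, r y = r z → y = z) :
    sign r (insert x S) x = sign r L x := by
  set D := L \ insert x S with hD
  have e : L = insert x S ∪ D := (Finset.union_sdiff_of_subset hSL).symm
  have hI : (insert x S).image r = S.image r := by
    rw [Finset.image_insert, Finset.insert_eq_of_mem hr]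
  have a1 : (L.filter fun y => r y < r x ∨ (r y = r x ∧ y < x)).card =
      ((insert x S).filter fun y => r y < r x ∨ (r y = r x ∧ y < x)).card +
        (D.filter fun y => r y < r x).card := by
    conv_lhs => rw [e]
    rw [Finset.filter_union, Finset.card_union_of_disjoint
      (Finset.disjoint_filter_filter Finset.disjoint_sdiff)]
    congr 2
    refine Finset.filter_congr fun y hy => ⟨fun h => ?_, Or.inl⟩
    rcases h with h | h
    · exact h
    · exact absurd (h.1 ▸ hr) (h1 y hy)
  have a2 : ((L.image r).filter (· < r x)).card =
      (((insert x S).image r).filter (· < r x)).card + (D.filter fun y => r y < r x).card := by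
    conv_lhs => rw [e]
    rw [Finset.image_union, Finset.filter_union, Finset.card_union_of_disjoint]
    · congr 1
      rw [Finset.filter_image, Finset.card_image_of_injOn]
      intro y hy z hz
      exact h2 y (Finset.mem_of_mem_filter _ hy) z (Finset.mem_of_mem_filter _ hz)
    · refine Finset.disjoint_filter_filter ?_
      rw [hI, Finset.disjoint_left]
      rintro _ hu hu'
      obtain ⟨y, hy, rfl⟩ := Finset.mem_image.1 hu'
      exact h1 y hy hu
  unfold sign place
  rw [a1, a2, show ∀ a b c : ℕ, a + c + (b + c) = a + b + 2 * c by intros; ring,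
    pow_add _ (_ + _), pow_mul]
  simp

theorem sum_excess_incidence {L S : Finset α} 
    (tα : ∀ a ∈ L, ∀ b ∈ L, a ≤ b ∨ b ≤ a) :
    ∑ b ∈ Finset.Icc S L, (if excess r b = excess r L then incidence r b S else 0) =
      ∑ b ∈ Finset.Icc S L, (if excess r b = excess r S then incidence r L b else 0) := by
  by_cases hSL : S ⊆ L
  swap
  · rw [Finset.Icc_eq_empty hSL]; simp
  by_cases he : excess r L = excess r S + 1
  swap
  · rw [Finset.sum_eq_zero, Finset.sum_eq_zero]
    · intro b _
      split_ifs with h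
      · by_contra h'
        exact he (h ▸ excess_of_incidence_ne_zero r h')
      · rfl
    · intro b _
      split_ifs with h
      · by_contra h'
        exact he (h ▸ excess_of_incidence_ne_zero r h')
      · rfl
  have lhs : ∑ b ∈ Finset.Icc S L, (if excess r b = excess r L then incidence r b S else 0) =
      ∑ x ∈ (L \ S).filter (r · ∈ S.image r), sign r (insert x S) x := by
    symm
    refine Finset.sum_bij_ne_zero (fun x _ _ => insert x S) ?_ ?_ ?_ ?_
    · intro x hx _
      simp only [Finset.mem_filter, Finset.mem_sdiff] at hx
      exact Finset.mem_Icc.2 ⟨Finset.subset_insert _ _, Finset.insert_subset hx.1.1 hSL⟩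
    · intro x hx _ y hy _ h
      simp only [Finset.mem_filter, Finset.mem_sdiff] at hx hy
      have : x ∈ insert y S := h ▸ Finset.mem_insert_self _ _
      exact (Finset.mem_insert.1 this).resolve_right hx.1.2
    · intro b hb h
      split_ifs at h with h1
      · obtain ⟨x, hx, hxS, -, e, hr, -⟩ := exists_of_incidence_ne_zero r h
        refine ⟨x, ?_, ?_, e.symm⟩
        · simp only [Finset.mem_filter, Finset.mem_sdiff]
          exact ⟨⟨(Finset.mem_Icc.1 hb).2 hx, hxS⟩, hr⟩
        · rw [← incidence_insert r hxS hr, ← e]; exact h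
      · exact absurd rfl h
    · intro x hx h
      simp only [Finset.mem_filter, Finset.mem_sdiff] at hx
      have h1 := incidence_insert r hx.1.2 hx.2
      have h2 := excess_of_incidence_ne_zero r (L := insert x S) (S := S) (by rw [h1]; exact h)
      rw [if_pos (h2.trans he.symm), h1]
  have rhs : ∑ b ∈ Finset.Icc S L, (if excess r b = excess r S then incidence r L b else 0) =
      ∑ x ∈ (L \ S).filter (fun x => r x ∈ (L.erase x).image r), sign r L x := by
    symm
    refine Finset.sum_bij_ne_zero (fun x _ _ => L.erase x) ?_ ?_ ?_ ?_
    · intro x hx _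
      simp only [Finset.mem_filter, Finset.mem_sdiff] at hx
      exact Finset.mem_Icc.2 ⟨Finset.subset_erase.2 ⟨hSL, hx.1.2⟩, Finset.erase_subset _ _⟩
    · intro x hx _ y hy _ h
      simp only [Finset.mem_filter, Finset.mem_sdiff] at hx hy
      by_contra hne
      have : x ∈ L.erase y := Finset.mem_erase.2 ⟨hne, hx.1.1⟩
      rw [← h] at this
      exact Finset.notMem_erase _ _ this
    · intro b hb h
      split_ifs at h with h1
      · obtain ⟨x, hx, hxS, e, -, hr, -⟩ := exists_of_incidence_ne_zero r h
        refine ⟨x, ?_, ?_, e.symm⟩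
        · simp only [Finset.mem_filter, Finset.mem_sdiff]
          exact ⟨⟨hx, fun h => hxS ((Finset.mem_Icc.1 hb).1 h)⟩, e ▸ hr⟩
        · rw [← incidence_erase r hx (e ▸ hr), ← e]; exact h
      · exact absurd rfl h
    · intro x hx h
      simp only [Finset.mem_filter, Finset.mem_sdiff] at hx
      have h1 := incidence_erase r hx.1.1 hx.2
      have h2 := excess_of_incidence_ne_zero r (L := L) (S := L.erase x) (by rw [h1]; exact h)
      rw [if_pos (by omega), h1]
  rw [lhs, rhs]
  set A := (L \ S).filter (r · ∈ S.image r) with hA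
  set B := (L \ S).filter (r · ∉ S.image r) with hB
  have cAB : A.card + B.card = (L \ S).card := Finset.card_filter_add_card_filter_not _
  have cB : (L.image r).card = (S.image r).card + (B.image r).card := by
    have : L.image r = S.image r ∪ B.image r := by
      ext u
      simp only [Finset.mem_union, Finset.mem_image]
      constructor
      · rintro ⟨x, hx, rfl⟩
        by_cases h : r x ∈ S.image r
        · exact .inl (Finset.mem_image.1 h)
        · exact .inr ⟨x, Finset.mem_filter.2 ⟨Finset.mem_sdiff.2 ⟨hx, fun h' =>
            h (Finset.mem_image_of_mem r h')⟩, h⟩, rfl⟩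
      · rintro (⟨x, hx, rfl⟩ | ⟨x, hx, rfl⟩)
        · exact ⟨x, hSL hx, rfl⟩
        · exact ⟨x, (Finset.mem_sdiff.1 (Finset.mem_of_mem_filter _ hx)).1, rfl⟩
    rw [this, Finset.card_union_of_disjoint]
    rw [Finset.disjoint_left]
    rintro _ hu hu'
    obtain ⟨y, hy, rfl⟩ := Finset.mem_image.1 hu'
    exact (Finset.mem_filter.1 hy).2 hu
  have cLS := Finset.card_sdiff_add_card_eq_card hSL
  have cBle : (B.image r).card ≤ B.card := Finset.card_image_le
  have cnt : A.card + B.card = (B.image r).card + 1 := by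
    unfold excess at he
    omega
  have hAsub : A ⊆ (L \ S).filter (fun x => r x ∈ (L.erase x).image r) := fun x hx => by
    have hx1 := Finset.mem_filter.1 hx
    have hx2 := Finset.mem_sdiff.1 hx1.1
    obtain ⟨y, hy, e⟩ := Finset.mem_image.1 hx1.2
    refine Finset.mem_filter.2 ⟨hx1.1, Finset.mem_image.2 ⟨y, Finset.mem_erase.2 ⟨?_, hSL hy⟩, e⟩⟩
    rintro rfl
    exact hx2.2 hy
  rcases Nat.eq_zero_or_pos A.card with h0 | h0
  · have hA0 : A = ∅ := Finset.card_eq_zero.1 h0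
    obtain ⟨x, hx, y, hy, hne, hxy⟩ : ∃ x ∈ B, ∃ y ∈ B, x ≠ y ∧ r x = r y :=
      Finset.exists_ne_map_eq_of_card_lt_of_maps_to (t := B.image r) (by omega)
        (fun z hz => Finset.mem_image_of_mem r hz)
    have inj : Set.InjOn r (B.erase x) := by
      rw [← Finset.card_image_iff]
      have : (B.erase x).image r = B.image r := by
        refine (Finset.image_subset_image (Finset.erase_subset _ _)).antisymm fun u hu => ?_
        obtain ⟨z, hz, rfl⟩ := Finset.mem_image.1 hu
        by_cases h : z = x
        · rw [h, hxy]; exact Finset.mem_image_of_mem r (Finset.mem_erase.2 ⟨hne.symm, hy⟩)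
        · exact Finset.mem_image_of_mem r (Finset.mem_erase.2 ⟨h, hz⟩)
      rw [this, Finset.card_erase_of_mem hx]
      omega
    have hx1 := Finset.mem_filter.1 hx
    have hy1 := Finset.mem_filter.1 hy
    have hxL := (Finset.mem_sdiff.1 hx1.1).1
    have hyL := (Finset.mem_sdiff.1 hy1.1).1
    have fil : (L \ S).filter (fun x => r x ∈ (L.erase x).image r) = {x, y} := by
      ext z
      simp only [Finset.mem_filter, Finset.mem_insert, Finset.mem_singleton]
      constructor
      · rintro ⟨hz, hz'⟩
        obtain ⟨t, ht, e⟩ := Finset.mem_image.1 hz'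
        obtain ⟨htz, htL⟩ := Finset.mem_erase.1 ht
        have hzB : z ∈ B := Finset.mem_filter.2 ⟨hz, fun h => by
          have : z ∈ A := Finset.mem_filter.2 ⟨hz, h⟩
          rw [hA0] at this; simp at this⟩
        have hzB' := (Finset.mem_filter.1 hzB).2
        have htS : t ∉ S := fun h => hzB' (e ▸ Finset.mem_image_of_mem r h)
        have htB : t ∈ B := Finset.mem_filter.2 ⟨Finset.mem_sdiff.2 ⟨htL, htS⟩, e ▸ hzB'⟩
        by_contra! h
        by_cases htx : t = x
        · subst htx
          exact h.2 (inj (Finset.mem_erase.2 ⟨h.1, hzB⟩) (Finset.mem_erase.2 ⟨hne.symm, hy⟩)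
            (e.symm.trans hxy))
        · exact htz (inj (Finset.mem_erase.2 ⟨htx, htB⟩) (Finset.mem_erase.2 ⟨h.1, hzB⟩) e)
      · rintro (rfl | rfl)
        · exact ⟨hx1.1, Finset.mem_image.2 ⟨y, Finset.mem_erase.2 ⟨hne.symm, hyL⟩, hxy.symm⟩⟩
        · exact ⟨hy1.1, Finset.mem_image.2 ⟨x, Finset.mem_erase.2 ⟨hne, hxL⟩, hxy⟩⟩
    have fib : ∀ z ∈ L, r z = r x → z = x ∨ z = y := fun z hz e => by
      have hzS : z ∉ S := fun h => hx1.2 (e ▸ Finset.mem_image_of_mem r h)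
      have hzB : z ∈ B := Finset.mem_filter.2 ⟨Finset.mem_sdiff.2 ⟨hz, hzS⟩, e ▸ hx1.2⟩
      by_contra! h
      exact h.2 (inj (Finset.mem_erase.2 ⟨h.1, hzB⟩) (Finset.mem_erase.2 ⟨hne.symm, hy⟩)
        (e.trans hxy))
    have step : ∀ a b : α, a ∈ L → (∀ z ∈ L, r z = r a → z = a ∨ z = b) → r a = r b → a < b →
        sign r L b = - sign r L a := by
      intro a b ha hf hab hlt
      have : (L.filter fun z => r z < r b ∨ (r z = r b ∧ z < b)) =
          insert a (L.filter fun z => r z < r a ∨ (r z = r a ∧ z < a)) := by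
        ext z
        simp only [Finset.mem_filter, Finset.mem_insert, ← hab]
        constructor
        · rintro ⟨hz, h | h⟩
          · exact .inr ⟨hz, .inl h⟩
          · rcases hf z hz h.1 with rfl | rfl
            · exact .inl rfl
            · exact absurd h.2 (lt_irrefl _)
        · rintro (rfl | ⟨hz, h | h⟩)
          · exact ⟨ha, .inr ⟨rfl, hlt⟩⟩
          · exact ⟨hz, .inl h⟩
          · exact ⟨hz, .inr ⟨h.1, h.2.trans hlt⟩⟩
      unfold sign place
      rw [this, Finset.card_insert_of_notMem (by simp), ← hab]
      ring
    rw [hA0, fil, Finset.sum_empty, Finset.sum_pair hne]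
    rcases tα x hxL y hyL with h | h
    · rw [step x y hxL fib hxy (lt_of_le_of_ne h hne)]; ring
    · rw [step y x hyL (fun z hz e => (fib z hz (e.trans hxy.symm)).symm) hxy.symm
        (lt_of_le_of_ne h hne.symm)]; ring
  · have hA1 : A.card = 1 := by omega
    obtain ⟨x, hAx⟩ := Finset.card_eq_one.1 hA1
    have inj : Set.InjOn r B := by
      rw [← Finset.card_image_iff]; omega
    have hx : x ∈ A := by rw [hAx]; exact Finset.mem_singleton_self x
    have hx1 := Finset.mem_filter.1 hx
    have hx2 := Finset.mem_sdiff.1 hx1.1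
    have fil : (L \ S).filter (fun x => r x ∈ (L.erase x).image r) = {x} := by
      refine Finset.Subset.antisymm (fun z hz => ?_) (hAx ▸ hAsub)
      obtain ⟨hz1, hz2⟩ := Finset.mem_filter.1 hz
      rw [← hAx]
      refine Finset.mem_filter.2 ⟨hz1, ?_⟩
      by_contra hzS
      obtain ⟨t, ht, e⟩ := Finset.mem_image.1 hz2
      obtain ⟨htz, htL⟩ := Finset.mem_erase.1 ht
      have htS : t ∉ S := fun h => hzS (e ▸ Finset.mem_image_of_mem r h)
      exact htz (inj (Finset.mem_filter.2 ⟨Finset.mem_sdiff.2 ⟨htL, htS⟩, e ▸ hzS⟩)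
        (Finset.mem_filter.2 ⟨hz1, hzS⟩) e)
    have hD : ∀ y ∈ L \ insert x S, y ∈ B := fun y hy => by
      simp only [Finset.mem_sdiff, Finset.mem_insert, not_or] at hy
      refine Finset.mem_filter.2 ⟨Finset.mem_sdiff.2 ⟨hy.1, hy.2.2⟩, fun h => hy.2.1 ?_⟩
      have : y ∈ A := Finset.mem_filter.2 ⟨Finset.mem_sdiff.2 ⟨hy.1, hy.2.2⟩, h⟩
      rw [hAx] at this
      exact Finset.mem_singleton.1 this
    rw [hAx, fil, Finset.sum_singleton, Finset.sum_singleton]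
    exact sign_insert_eq (Finset.insert_subset hx2.1 hSL) hx1.2
      (fun y hy => (Finset.mem_filter.1 (hD y hy)).2)
      (fun y hy z hz e => inj (hD y hy) (hD z hz) e)

end Sd

/-- A locally finite simplicial complex whose vertices are partially ordered in such a way that the
vertices of every simplex are totally ordered. Any locally finite simplicial complex becomes one
after a choice of total order of its vertices. -/
structure OrderedComplex where
  V : Type w
  order : PartialOrder V
  K : AbstractSimplicialComplex V
  total : ∀ s ∈ K.faces, ∀ a ∈ s, ∀ b ∈ s, a ≤ b ∨ b ≤ a
  locallyFinite : ∀ v : V, {s | s ∈ K.faces ∧ v ∈ s}.Finite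

namespace OrderedComplex

instance (X : OrderedComplex.{w}) : PartialOrder X.V := X.order

/-- The simplices, as nonempty finite sets of vertices; they are (partially) ordered by inclusion. -/
abbrev Simplex (X : OrderedComplex.{w}) : Type w := {s : Finset X.V // s ∈ X.K.faces}

variable (X : OrderedComplex.{w})

theorem nonempty_of_mem {s : Finset X.V} (h : s ∈ X.K.faces) : s.Nonempty :=
  (X.K.isRelLowerSet_faces h).1

theorem mem_of_subset {s t : Finset X.V} (h : s ∈ X.K.faces) (hts : t ⊆ s) (ht : t.Nonempty) :
    t ∈ X.K.faces :=
  (X.K.isRelLowerSet_faces h).2 hts ht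

theorem finite_comparable (s : X.Simplex) : {t : X.Simplex | t ≤ s ∨ s ≤ t}.Finite := by
  obtain ⟨v, hv⟩ := X.nonempty_of_mem s.2
  have h1 : {t : Finset X.V | t ⊆ s.1 ∨ (t ∈ X.K.faces ∧ v ∈ t)}.Finite := by
    refine Set.Finite.union ?_ (X.locallyFinite v)
    exact s.1.powerset.finite_toSet.subset fun t ht => Finset.mem_coe.2 (Finset.mem_powerset.2 ht)
  refine (h1.preimage (f := Subtype.val) Subtype.val_injective.injOn).subset ?_
  rintro t (ht | ht)
  · exact Or.inl ht
  · exact Or.inr ⟨t.2, ht hv⟩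

/-- The barycentric subdivision: its vertices are the simplices of `X`, to be thought of as their
barycentres, and its simplices are the nonempty finite chains of simplices of `X`. -/
def sd : OrderedComplex.{w} where
  V := X.Simplex
  order := inferInstance
  K :=
    { faces := {c | c.Nonempty ∧ ∀ a ∈ c, ∀ b ∈ c, a ≤ b ∨ b ≤ a}
      isRelLowerSet_faces := fun _ hc => ⟨hc.1, fun _ hb hne =>
        ⟨hne, fun x hx y hy => hc.2 x (hb hx) y (hb hy)⟩⟩
      singleton_mem := fun v => ⟨Finset.singleton_nonempty v, fun a ha b hb => by
        rw [Finset.mem_singleton.1 ha, Finset.mem_singleton.1 hb]; exact Or.inl le_rfl⟩ }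
  total := fun _ hs => hs.2
  locallyFinite := fun v => by
    refine (X.finite_comparable v).toFinset.powerset.finite_toSet.subset ?_
    rintro c ⟨hc, hv⟩
    refine Finset.mem_coe.2 (Finset.mem_powerset.2 fun t ht => ?_)
    exact (Set.Finite.mem_toFinset _).2 (hc.2 t ht v hv)

/-- The iterated barycentric subdivision. -/
def sdIter : ℕ → OrderedComplex.{w}
  | 0 => X
  | j + 1 => (sdIter j).sd

end OrderedComplex

open OrderedComplex

/-- A simplicial approximation `Sd X → X` of the identity map, i.e. the choice of a vertex of every
simplex `s` of `X`: the vertex of `X` to which the barycentre of `s` is sent. -/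
structure Approx (X : OrderedComplex.{w}) where
  toFun : X.Simplex → X.V
  mem : ∀ s, toFun s ∈ s.1

namespace Approx

open scoped Classical

variable {X : OrderedComplex.{w}} (r : Approx X)

/-- The map of `Sd X` to `X` on vertices. -/
def vert : X.sd.V → X.V := r.toFun

theorem image_mem (c : X.sd.Simplex) : c.1.image r.vert ∈ X.K.faces := by
  obtain ⟨⟨m, hm⟩, hle⟩ : ∃ m : c.1, ∀ a : c.1, a.1 ≤ m.1 := by
    obtain ⟨m, hm, hmax⟩ := c.1.exists_maximal c.2.1
    refine ⟨⟨m, hm⟩, fun a => ?_⟩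
    rcases c.2.2 a.1 a.2 m hm with h | h
    · exact h
    · exact hmax a.2 h
  refine X.mem_of_subset (s := Subtype.val (show X.Simplex from m))
    (Subtype.property (show X.Simplex from m)) ?_ (c.2.1.image _)
  intro u hu
  obtain ⟨a, ha, rfl⟩ := Finset.mem_image.1 hu
  have : (show X.Simplex from a) ≤ (show X.Simplex from m) := hle ⟨a, ha⟩
  exact this (r.mem a)

/-- The map of `Sd X` to `X` on simplices. -/
def map (c : X.sd.Simplex) : X.Simplex := ⟨c.1.image r.vert, r.image_mem c⟩

end Approx

/-- The two versions of the simplicial category: in `A^*(X)` (`upper`) morphisms go from a simplex to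
its faces, in `A_*(X)` (`lower`) they go from a simplex to the simplices of which it is a face. -/
inductive Variance
  | upper
  | lower

/-- The relation which says that a morphism may be nonzero from `σ` to `τ`. -/
def Variance.rel (v : Variance) {α : Type w} [Preorder α] (σ τ : α) : Prop :=
  match v with
  | .upper => τ ≤ σ
  | .lower => σ ≤ τ

instance (v : Variance) (α : Type w) [Preorder α] : Std.Refl (v.rel (α := α)) :=
  ⟨fun a => by cases v <;> exact le_refl a⟩

instance (v : Variance) (α : Type w) [Preorder α] : IsTrans α (v.rel (α := α)) :=
  ⟨fun a b c h1 h2 => by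
    cases v
    · exact le_trans h2 h1
    · exact le_trans h1 h2⟩

/-- The simplicial category `A^*(X)` or `A_*(X)` (for `𝒜 = A`). -/
abbrev SimplicialCat (X : OrderedComplex.{w}) (var : Variance) (𝒜 : Type u) :=
  Graded X.Simplex var.rel 𝒜

namespace Graded

variable {𝒜 : Type u} [Category.{v} 𝒜] [Preadditive 𝒜]

open scoped Classical in
/-- The identity of the object at place `σ` and degree `p`, as a component of a matrix. -/
def idEntry {S ι : Type*} {R : S → S → Prop} (M : ι → Graded S R 𝒜) (p q : ι) (σ τ : S) :
    (M p).obj σ ⟶ (M q).obj τ :=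
  if h : p = q ∧ σ = τ then eqToHom (by rw [h.1, h.2]) else 0

theorem idEntry_self {S ι : Type*} {R : S → S → Prop} (M : ι → Graded S R 𝒜) (p : ι) (σ : S) :
    idEntry M p p σ σ = 𝟙 _ := by simp [idEntry]

theorem idEntry_ne_zero {S ι : Type*} {R : S → S → Prop} {M : ι → Graded S R 𝒜} {p q : ι} {σ τ : S}
    (h : idEntry M p q σ τ ≠ 0) : p = q ∧ σ = τ := by
  by_contra h'
  exact h (dif_neg h')

theorem app_comp_idEntry {S : Type w} {R : S → S → Prop} [Std.Refl R] [IsTrans S R] 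
    (C : ChainComplex (Graded S R 𝒜) ℤ) {p q s : ℤ} {σ τ ρ : S} (h : q = s) (h' : τ = ρ) :
    (app (C.d p q) σ τ) ≫ idEntry C.X q s τ ρ = app (C.d p s) σ ρ := by
  subst h h'
  rw [idEntry_self, Category.comp_id]

theorem idEntry_comp_app {S : Type w} {R : S → S → Prop} [Std.Refl R] [IsTrans S R] 
    (C : ChainComplex (Graded S R 𝒜) ℤ) {p q s : ℤ} {σ τ ρ : S} (h : p = q) (h' : σ = τ) :
    idEntry C.X p q σ τ ≫ (app (C.d q s) τ ρ) = app (C.d p s) σ ρ := by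
  subst h h'
  rw [idEntry_self, Category.id_comp]

theorem idEntry_comp_idEntry {S ι : Type*} {R : S → S → Prop} (M : ι → Graded S R 𝒜)
    {p q s : ι} {σ τ ρ : S} (h : p = q) (h' : σ = τ) :
    idEntry M p q σ τ ≫ idEntry M q s τ ρ = idEntry M p s σ ρ := by
  subst h h'
  rw [idEntry_self, Category.id_comp]

end Graded

namespace Subdivision

open Graded

variable {X : OrderedComplex.{w}} (r : Approx X) (var : Variance)

open scoped Classical

/-- The excess of dimension `|c| - |r c|` of a simplex `c` of `Sd X` over its image. -/
def exc (c : X.sd.Simplex) : ℤ := (c.1.card : ℤ) - (r.map c).1.card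

/-- The part of `Sd_r C` in degree `n` over `c` is the part of `C` in degree `deg r var n c` over
the image of `c`. -/
def deg (n : ℤ) (c : X.sd.Simplex) : ℤ :=
  match var with
  | .upper => n - exc r c
  | .lower => n + exc r c

/-- The incidence number of `a` and `b`, for chains (`upper`) or for cochains (`lower`). -/
def inc (a b : X.sd.Simplex) : ℤ :=
  match var with
  | .upper => Sd.incidence r.vert a.1 b.1
  | .lower => Sd.incidence r.vert b.1 a.1

variable {𝒜 : Type u} [Category.{v} 𝒜] [Preadditive 𝒜] (C : ChainComplex (SimplicialCat X var 𝒜) ℤ)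

/-- The component from `a` to `b` of the differential of `Sd_r C`, from degree `n` to degree `m`. It is
the component of the differential of `C` from `r a` to `r b` if `b` is a face of `a` (`upper`) resp.
`a` is a face of `b` (`lower`) and both have the same excess over their images, and it is `(-1) ^ n`
times the incidence number of `a` and `b`, times the identity, if `r a = r b`. The two cases exclude
each other. -/
def entry (n m : ℤ) (a b : X.sd.Simplex) :
    (C.X (deg r var n a)).obj (r.map a) ⟶ (C.X (deg r var m b)).obj (r.map b) :=
  (if var.rel a b ∧ exc r a = exc r b then
    app (C.d (deg r var n a) (deg r var m b)) (r.map a) (r.map b) else 0) +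
  ((n.negOnePow : ℤ) * inc r var a b) • idEntry C.X _ _ _ _

theorem exc_eq (c : X.sd.Simplex) : exc r c = Sd.excess r.vert c.1 := by
  unfold exc Sd.excess Approx.map
  congr!

theorem rel_finite (a : X.sd.Simplex) : {b : X.sd.Simplex | var.rel a b}.Finite :=
  (X.sd.finite_comparable a).subset fun b h => by cases var; exacts [Or.inl h, Or.inr h]

theorem inc_rel {a b : X.sd.Simplex} (h : inc r var a b ≠ 0) : var.rel a b := by
  cases var
  · obtain ⟨x, -, -, e, -⟩ := Sd.exists_of_incidence_ne_zero _ h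
    exact (e.subset.trans (Finset.erase_subset _ _) : b.1 ⊆ a.1)
  · obtain ⟨x, -, -, e, -⟩ := Sd.exists_of_incidence_ne_zero _ h
    exact (e.subset.trans (Finset.erase_subset _ _) : a.1 ⊆ b.1)

theorem entry_support {n m : ℤ} {a b : X.sd.Simplex} (h : entry r var C n m a b ≠ 0) :
    var.rel a b := by
  by_contra h'
  refine h ?_
  have : inc r var a b = 0 := by by_contra h2; exact h' (inc_rel r var h2)
  simp [entry, h', this]

/-- The differential of `Sd_r C` as a matrix. -/
def diff (n m : ℤ) :
    (Graded.mk (fun a => (C.X (deg r var n a)).obj (r.map a)) : SimplicialCat X.sd var 𝒜) ⟶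
      Graded.mk (fun a => (C.X (deg r var m a)).obj (r.map a)) :=
  Graded.Hom.mk (entry r var C n m)
    (fun a => (rel_finite var a).subset fun _ h => entry_support r var C h)
    (fun a b h => by by_contra h'; exact h (entry_support r var C h'))

end Subdivision

namespace Subdivision

open Graded
open scoped Classical

variable {X : OrderedComplex.{w}} (r : Approx X) (var : Variance)

/-- The simplices that lie between two given ones. -/
def btw (a c : X.sd.Simplex) : Finset X.sd.Simplex :=
  match var with
  | .upper => (Finset.Icc c.1 a.1).subtype (· ∈ X.sd.K.faces)
  | .lower => (Finset.Icc a.1 c.1).subtype (· ∈ X.sd.K.faces)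

theorem mem_btw {a b c : X.sd.Simplex} : b ∈ btw var a c ↔ var.rel a b ∧ var.rel b c := by
  cases var
  · simp only [btw, Finset.mem_subtype, Finset.mem_Icc]
    exact and_comm
  · simp only [btw, Finset.mem_subtype, Finset.mem_Icc]
    exact Iff.rfl

theorem sum_Icc (S L : X.sd.Simplex) (f : Finset X.sd.V → ℤ) :
    ∑ b ∈ (Finset.Icc S.1 L.1).subtype (· ∈ X.sd.K.faces), f b.1 = ∑ b ∈ Finset.Icc S.1 L.1, f b :=
  Finset.sum_subtype_of_mem f fun b hb => by
    rw [Finset.mem_Icc] at hb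
    exact X.sd.mem_of_subset L.2 hb.2 ((X.sd.nonempty_of_mem S.2).mono hb.1)

theorem total_image (c : X.sd.Simplex) :
    ∀ a ∈ c.1.image r.vert, ∀ b ∈ c.1.image r.vert, a ≤ b ∨ b ≤ a := by
  have := X.total _ (r.image_mem c)
  exact this

theorem sum_inc (a c : X.sd.Simplex) : ∑ b ∈ btw var a c, inc r var a b * inc r var b c = 0 := by
  cases var
  · refine (sum_Icc c a fun b => Sd.incidence r.vert a.1 b * Sd.incidence r.vert b c.1).trans ?_
    exact Sd.sum_incidence_mul_incidence (X.sd.total _ a.2) (total_image r a)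
  · refine (sum_Icc a c fun b => Sd.incidence r.vert b a.1 * Sd.incidence r.vert c.1 b).trans ?_
    refine (Finset.sum_congr rfl fun b _ => mul_comm _ _).trans ?_
    exact Sd.sum_incidence_mul_incidence (X.sd.total _ c.2) (total_image r c)

theorem sum_exc_inc (a c : X.sd.Simplex) :
    ∑ b ∈ btw var a c, (if exc r a = exc r b then inc r var b c else 0) =
      ∑ b ∈ btw var a c, (if exc r b = exc r c then inc r var a b else 0) := by
  simp only [exc_eq]
  cases var
  · refine (sum_Icc c a fun b => if Sd.excess r.vert a.1 = Sd.excess r.vert b then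
      Sd.incidence r.vert b c.1 else 0).trans (Eq.trans ?_ (sum_Icc c a fun b =>
      if Sd.excess r.vert b = Sd.excess r.vert c.1 then Sd.incidence r.vert a.1 b else 0).symm)
    rw [← Sd.sum_excess_incidence (X.sd.total _ a.2)]
    simp only [eq_comm]
  · refine (sum_Icc a c fun b => if Sd.excess r.vert a.1 = Sd.excess r.vert b then
      Sd.incidence r.vert c.1 b else 0).trans (Eq.trans ?_ (sum_Icc a c fun b =>
      if Sd.excess r.vert b = Sd.excess r.vert c.1 then Sd.incidence r.vert b a.1 else 0).symm)
    rw [Sd.sum_excess_incidence (X.sd.total _ c.2)]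
    simp only [eq_comm]

theorem map_rel {a b : X.sd.Simplex} (h : var.rel a b) : var.rel (r.map a) (r.map b) := by
  cases var
  · exact Finset.image_subset_image h
  · exact Finset.image_subset_image h

theorem exists_unique_btw {a c : X.sd.Simplex} (h : var.rel a c) (he : exc r a = exc r c)
    {t : X.Simplex} (h1 : var.rel (r.map a) t) (h2 : var.rel t (r.map c)) :
    ∃ b, var.rel a b ∧ var.rel b c ∧ exc r b = exc r a ∧ r.map b = t ∧
      ∀ b', var.rel a b' → var.rel b' c → exc r b' = exc r a → r.map b' = t → b' = b := by
  simp only [exc_eq] at *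
  cases var
  · obtain ⟨b, h3, h4, h5, h6, h7⟩ := Sd.exists_unique_between r.vert (S := c.1) (L := a.1)
      h he.symm h2 h1
    refine ⟨⟨b, X.sd.mem_of_subset a.2 h4 ((X.sd.nonempty_of_mem c.2).mono h3)⟩, h4, h3, h5,
      Subtype.ext h6, fun b' h8 _ h10 h11 => Subtype.ext (h7 b'.1 h8 h10 (congrArg Subtype.val h11))⟩
  · obtain ⟨b, h3, h4, h5, h6, h7⟩ := Sd.exists_unique_between r.vert (S := a.1) (L := c.1)
      h he h1 h2
    refine ⟨⟨b, X.sd.mem_of_subset c.2 h4 ((X.sd.nonempty_of_mem a.2).mono h3)⟩, h3, h4,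
      h5.trans he.symm,
      Subtype.ext h6, fun b' _ h8 h10 h11 => Subtype.ext
        (h7 b'.1 h8 (h10.trans he) (congrArg Subtype.val h11))⟩

theorem exc_of_inc {a b : X.sd.Simplex} (h : inc r var a b ≠ 0) (n : ℤ) :
    deg r var n a = deg r var (n - 1) b := by
  cases var
  · have := Sd.excess_of_incidence_ne_zero _ h
    simp only [deg, exc_eq]; omega
  · have := Sd.excess_of_incidence_ne_zero _ h
    simp only [deg, exc_eq]; omega

theorem map_of_inc {a b : X.sd.Simplex} (h : inc r var a b ≠ 0) : r.map a = r.map b := by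
  refine Subtype.ext ?_
  cases var
  · obtain ⟨x, -, -, -, -, -, e⟩ := Sd.exists_of_incidence_ne_zero _ h
    exact e
  · obtain ⟨x, -, -, -, -, -, e⟩ := Sd.exists_of_incidence_ne_zero _ h
    exact e.symm

theorem deg_congr {a b : X.sd.Simplex} (h : exc r a = exc r b) (n : ℤ) :
    deg r var n a = deg r var n b := by
  cases var <;> simp [deg, h]

variable {𝒜 : Type u} [Category.{v} 𝒜] [Preadditive 𝒜] (C : ChainComplex (SimplicialCat X var 𝒜) ℤ)

theorem sum_d_d {n m p : ℤ} (a c : X.sd.Simplex) (h : exc r a = exc r c) (hac : var.rel a c) :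
    ∑ b ∈ btw var a c, (if exc r b = exc r a then
      app (C.d (deg r var n a) (deg r var m b)) (r.map a) (r.map b) ≫
        app (C.d (deg r var m b) (deg r var p c)) (r.map b) (r.map c) else 0) = 0 := by
  set F : X.Simplex → ((C.X (deg r var n a)).obj (r.map a) ⟶ (C.X (deg r var p c)).obj (r.map c)) :=
    fun τ => app (C.d (deg r var n a) (deg r var m a)) (r.map a) τ ≫
        app (C.d (deg r var m a) (deg r var p c)) τ (r.map c) with hF
  have h0 : ∑ᶠ τ, F τ = 0 := by
    rw [hF, ← comp_app, C.d_comp_d, Graded.zero_app]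
  have hsupp : ∀ τ, F τ ≠ 0 → var.rel (r.map a) τ ∧ var.rel τ (r.map c) := by
    intro τ hτ
    refine ⟨?_, ?_⟩
    · by_contra h'
      refine hτ ?_
      have : app (C.d (deg r var n a) (deg r var m a)) (r.map a) τ = 0 := Hom.support _ _ _ h'
      simp only [hF]
      rw [this, zero_comp]
    · by_contra h'
      refine hτ ?_
      have : app (C.d (deg r var m a) (deg r var p c)) τ (r.map c) = 0 := Hom.support _ _ _ h'
      simp only [hF]
      rw [this, comp_zero]
  have h1 : ∑ᶠ τ, F τ = ∑ b ∈ (btw var a c).filter fun b => exc r b = exc r a, F (r.map b) := by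
    rw [← Finset.sum_image (s := (btw var a c).filter fun b => exc r b = exc r a) (g := r.map)]
    · refine finsum_eq_sum_of_support_subset _ fun τ hτ => ?_
      obtain ⟨h2, h3⟩ := hsupp τ hτ
      obtain ⟨b, hb⟩ := exists_unique_btw r var hac h h2 h3
      rw [Finset.mem_coe, Finset.mem_image]
      exact ⟨b, Finset.mem_filter.2 ⟨(mem_btw var).2 ⟨hb.1, hb.2.1⟩, hb.2.2.1⟩, hb.2.2.2.1⟩
    · intro b hb b' hb' e
      rw [Finset.mem_coe, Finset.mem_filter, mem_btw] at hb hb'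
      obtain ⟨b0, h0⟩ := exists_unique_btw r var hac h (map_rel r var hb.1.1) (map_rel r var hb.1.2)
      rw [h0.2.2.2.2 b hb.1.1 hb.1.2 hb.2 rfl, h0.2.2.2.2 b' hb'.1.1 hb'.1.2 hb'.2 e.symm]
  refine Eq.trans ?_ (h1.symm.trans h0)
  rw [Finset.sum_filter]
  refine Finset.sum_congr rfl fun b _ => ?_
  split_ifs with hb
  · rw [deg_congr r var hb]
  · rfl

theorem diff_comp_diff {n m p : ℤ} (hm : m + 1 = n) (hp : p + 1 = m) :
    diff r var C n m ≫ diff r var C m p = 0 := by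
  refine hom_ext fun a c => ?_
  rw [Graded.zero_app, comp_app]
  change ∑ᶠ b, entry r var C n m a b ≫ entry r var C m p b c = 0
  rw [finsum_eq_sum_of_support_subset (s := btw var a c)]
  swap
  · intro b hb
    rw [Finset.mem_coe, mem_btw]
    refine ⟨?_, ?_⟩
    · exact entry_support r var C (n := n) (m := m) fun h => hb (by dsimp only; rw [h, zero_comp])
    · exact entry_support r var C (n := m) (m := p) fun h => hb (by dsimp only; rw [h, comp_zero])
  by_cases hac : var.rel a c
  swap
  · refine Finset.sum_eq_zero fun b hb => absurd ?_ hac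
    rw [mem_btw] at hb
    exact IsTrans.trans (r := var.rel) _ _ _ hb.1 hb.2
  set D : (C.X (deg r var n a)).obj (r.map a) ⟶ (C.X (deg r var p c)).obj (r.map c) :=
    app (C.d (deg r var n a) (deg r var p c)) (r.map a) (r.map c) with hD
  set I : (C.X (deg r var n a)).obj (r.map a) ⟶ (C.X (deg r var p c)).obj (r.map c) :=
    idEntry C.X _ _ _ _ with hI
  have key : ∀ b ∈ btw var a c, entry r var C n m a b ≫ entry r var C m p b c =
      (if exc r a = exc r c then (if exc r b = exc r a then
        app (C.d (deg r var n a) (deg r var m b)) (r.map a) (r.map b) ≫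
        app (C.d (deg r var m b) (deg r var p c)) (r.map b) (r.map c) else 0) else 0) +
      ((n.negOnePow : ℤ) * (m.negOnePow : ℤ) * (inc r var a b * inc r var b c)) • I +
      ((m.negOnePow : ℤ) * (if exc r a = exc r b then inc r var b c else 0)) • D +
      ((n.negOnePow : ℤ) * (if exc r b = exc r c then inc r var a b else 0)) • D := by
    intro b hb
    rw [mem_btw] at hb
    have i1 : inc r var a b ≠ 0 → deg r var n a = deg r var m b := fun h => by
      rw [exc_of_inc r var h, ← hm, add_sub_cancel_right]
    have t11 : (if var.rel a b ∧ exc r a = exc r b then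
        app (C.d (deg r var n a) (deg r var m b)) (r.map a) (r.map b) else 0) ≫
        (if var.rel b c ∧ exc r b = exc r c then
        app (C.d (deg r var m b) (deg r var p c)) (r.map b) (r.map c) else 0) =
        (if exc r a = exc r c then (if exc r b = exc r a then
        app (C.d (deg r var n a) (deg r var m b)) (r.map a) (r.map b) ≫
        app (C.d (deg r var m b) (deg r var p c)) (r.map b) (r.map c) else 0) else 0) := by
      simp only [hb.1, hb.2, true_and]
      by_cases e1 : exc r a = exc r b
      · by_cases e2 : exc r b = exc r c
        · rw [if_pos e1, if_pos e2, if_pos (e1.trans e2), if_pos e1.symm]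
        · rw [if_neg e2, comp_zero, if_neg (fun h => e2 (e1.symm.trans h))]
      · rw [if_neg e1, zero_comp, if_neg (Ne.symm e1), ite_self]
    have t22 : (((n.negOnePow : ℤ) * inc r var a b) •
          idEntry C.X (deg r var n a) (deg r var m b) (r.map a) (r.map b)) ≫
        (((m.negOnePow : ℤ) * inc r var b c) •
          idEntry C.X (deg r var m b) (deg r var p c) (r.map b) (r.map c)) =
        ((n.negOnePow : ℤ) * (m.negOnePow : ℤ) * (inc r var a b * inc r var b c)) • I := by
      by_cases h : inc r var a b = 0
      · simp [h]
      · rw [Preadditive.zsmul_comp, Preadditive.comp_zsmul, smul_smul,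
          idEntry_comp_idEntry C.X (i1 h) (map_of_inc r var h)]
        congr 1
        ring
    have t12 : (if var.rel a b ∧ exc r a = exc r b then
        app (C.d (deg r var n a) (deg r var m b)) (r.map a) (r.map b) else 0) ≫
        (((m.negOnePow : ℤ) * inc r var b c) •
          idEntry C.X (deg r var m b) (deg r var p c) (r.map b) (r.map c)) =
        ((m.negOnePow : ℤ) * (if exc r a = exc r b then inc r var b c else 0)) • D := by
      simp only [hb.1, true_and]
      by_cases e1 : exc r a = exc r b
      · rw [if_pos e1, if_pos e1]
        by_cases h : inc r var b c = 0
        · simp [h]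
        · have i2 : deg r var m b = deg r var p c := by
            rw [exc_of_inc r var h, ← hp, add_sub_cancel_right]
          rw [Preadditive.comp_zsmul, app_comp_idEntry C i2 (map_of_inc r var h)]
      · rw [if_neg e1, if_neg e1, zero_comp, mul_zero, zero_smul]
    have t21 : (((n.negOnePow : ℤ) * inc r var a b) •
          idEntry C.X (deg r var n a) (deg r var m b) (r.map a) (r.map b)) ≫
        (if var.rel b c ∧ exc r b = exc r c then
        app (C.d (deg r var m b) (deg r var p c)) (r.map b) (r.map c) else 0) =
        ((n.negOnePow : ℤ) * (if exc r b = exc r c then inc r var a b else 0)) • D := by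
      simp only [hb.2, true_and]
      by_cases e1 : exc r b = exc r c
      · rw [if_pos e1, if_pos e1]
        by_cases h : inc r var a b = 0
        · simp [h]
        · rw [Preadditive.zsmul_comp, idEntry_comp_app C (i1 h) (map_of_inc r var h)]
      · rw [if_neg e1, if_neg e1, comp_zero, mul_zero, zero_smul]
    unfold entry
    rw [Preadditive.add_comp, Preadditive.comp_add, Preadditive.comp_add, t11, t12, t21, t22]
    abel
  have hs : n.negOnePow = - m.negOnePow := by rw [← hm, Int.negOnePow_succ]
  rw [Finset.sum_congr rfl key, Finset.sum_add_distrib, Finset.sum_add_distrib,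
    Finset.sum_add_distrib, ← Finset.sum_smul, ← Finset.sum_smul, ← Finset.sum_smul,
    ← Finset.mul_sum, ← Finset.mul_sum, ← Finset.mul_sum, sum_inc, sum_exc_inc, hs, mul_zero,
    zero_smul, add_zero, add_assoc, ← add_smul]
  have : ∀ x : ℤ, (m.negOnePow : ℤ) * x + ((-m.negOnePow : ℤˣ) : ℤ) * x = 0 := fun x => by
    push_cast; ring
  rw [this, zero_smul, add_zero]
  split_ifs with h
  · exact sum_d_d r var C a c h hac
  · exact Finset.sum_const_zero

/-- The algebraic subdivision `Sd_r C` over the barycentric subdivision of `X`. -/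
def complex : ChainComplex (SimplicialCat X.sd var 𝒜) ℤ where
  X n := Graded.mk fun a => (C.X (deg r var n a)).obj (r.map a)
  d n m := if m + 1 = n then diff r var C n m else 0
  shape n m h := if_neg h
  d_comp_d' n m p h _ := by
    change m + 1 = n at h
    rw [if_pos h]
    split_ifs with h'
    · exact diff_comp_diff r var C h h'
    · exact comp_zero

end Subdivision

/-- The relation that puts no restriction on the components. -/
def allRel (S : Type w) : S → S → Prop := fun _ _ => True

instance (S : Type w) : Std.Refl (allRel S) := ⟨fun _ => trivial⟩

instance (S : Type w) : IsTrans S (allRel S) := ⟨fun _ _ _ _ _ => trivial⟩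

/-- The category `G_S(𝒜)` of families of objects indexed by `S` and column finite matrices. -/
abbrev GradedCat (S : Type w) (𝒜 : Type u) := Graded S (allRel S) 𝒜

/-- The complex `C(σ)` in `𝒜`: the part of `C` over `σ`, with the diagonal component of the
differential. -/
def Graded.localComplex {S : Type w} {R : S → S → Prop} [Std.Refl R] [IsTrans S R] [Std.Antisymm R]
    {𝒜 : Type u} [Category.{v} 𝒜] [Preadditive 𝒜] (C : ChainComplex (Graded S R 𝒜) ℤ) (σ : S) :
    ChainComplex 𝒜 ℤ where
  X n := (C.X n).obj σ
  d n m := Graded.app (C.d n m) σ σ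
  shape n m h := by rw [C.shape n m h, Graded.zero_app]
  d_comp_d' n m p _ _ := by
    have h : Graded.app (C.d n m ≫ C.d m p) σ σ = 0 := by rw [C.d_comp_d, Graded.zero_app]
    rw [Graded.comp_app, finsum_eq_single _ σ] at h
    · exact h
    · intro τ hτ
      by_cases h1 : R σ τ
      · by_cases h2 : R τ σ
        · exact absurd (Std.Antisymm.antisymm _ _ h2 h1) hτ
        · have : Graded.app (C.d m p) τ σ = 0 := Graded.Hom.support _ _ _ h2
          rw [this, comp_zero]
      · have : Graded.app (C.d n m) σ τ = 0 := Graded.Hom.support _ _ _ h1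
        rw [this, zero_comp]

instance (v : Variance) (α : Type w) [PartialOrder α] : Std.Antisymm (v.rel (α := α)) :=
  ⟨fun _ _ h1 h2 => by
    cases v
    · exact le_antisymm h2 h1
    · exact le_antisymm h1 h2⟩

/-- The iterated algebraic subdivision `Sd^j C` over `Sd^j X`, where the subdivision that leads from
stage `j` to stage `j + 1` is made with `r j`. -/
def sdComplex {X : OrderedComplex.{w}} (r : ∀ j, Approx (X.sdIter j)) {var : Variance}
    {𝒜 : Type u} [Category.{v} 𝒜] [Preadditive 𝒜] (C : ChainComplex (SimplicialCat X var 𝒜) ℤ) :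
    (j : ℕ) → ChainComplex (SimplicialCat (X.sdIter j) var 𝒜) ℤ
  | 0 => C
  | j + 1 => Subdivision.complex (r j) var (sdComplex r C j)

namespace OrderedComplex

variable (X : OrderedComplex.{w})

open scoped Classical in
/-- The position of a vertex of `Sd^j X` in the geometric realisation of `X`, in barycentric
coordinates: a vertex of `Sd^(j+1) X` is the barycentre of a simplex of `Sd^j X`. -/
def pos : (j : ℕ) → (X.sdIter j).V → X.V → ℝ
  | 0 => fun v => Pi.single (M := fun _ : X.V => ℝ) v 1
  | j + 1 => fun s : (X.sdIter j).Simplex => (s.1.card : ℝ)⁻¹ • ∑ v ∈ s.1, pos j v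

/-- The closed geometric simplex with vertex set `s`, in barycentric coordinates. -/
def cell (s : Finset X.V) : Set (X.V → ℝ) :=
  {x | (∀ v, 0 ≤ x v) ∧ (∀ v, v ∉ s → x v = 0) ∧ ∑ v ∈ s, x v = 1}

/-- There is a polygonal path of length `ℓ` from `x` to `y`, i.e. a concatenation of finitely many
segments, each of which lies in a simplex and has the Euclidean length. -/
inductive PolygonalPath : (X.V → ℝ) → (X.V → ℝ) → ℝ → Prop
  | nil (x : X.V → ℝ) : PolygonalPath x x 0
  | cons {x y z : X.V → ℝ} {ℓ : ℝ} (s : Finset X.V) : s ∈ X.K.faces → x ∈ X.cell s → y ∈ X.cell s →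
      PolygonalPath y z ℓ →
      PolygonalPath x z (√(∑ v ∈ s, (x v - y v) ^ 2) + ℓ)

open scoped ENNReal NNReal

/-- The standard metric of the geometric realisation: the path metric for which every simplex
has the Euclidean metric of the standard simplex. Points in different components are at infinite
distance. -/
def stdDist (x y : X.V → ℝ) : ℝ≥0∞ := ⨅ (ℓ : ℝ) (_ : X.PolygonalPath x y ℓ), ENNReal.ofReal ℓ

/-- The distance in the open cone `O(X^+)` of the images of two points of `|X| × ℝ`. -/
def coneDist (p q : (X.V → ℝ) × ℝ) : ℝ≥0∞ :=
  ENNReal.ofReal (max (min p.2 q.2) 0) * X.stdDist p.1 q.1 + ENNReal.ofReal |p.2 - q.2|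

end OrderedComplex

/-- The heights `v_i` of the slices: `v_i = i` for `i ≤ 0`, `v_1 = 1`, and
`v_(i+2) - v_(i+1) = (d + 2) / (d + 1) * (v_(i+1) - v_i)` for `i ≥ 0`. -/
def height (d : ℕ) (i : ℤ) : ℝ :=
  if i ≤ 0 then (i : ℝ) else ∑ k ∈ Finset.range i.toNat, (((d : ℝ) + 2) / (d + 1)) ^ k

open scoped Classical in
/-- The simplices of the triangulation `t^0(X × ℝ)`: it is `Sd^j X`, `j = max (0, i)`, on the slice at
height `v_i`, with prisms in between.
* `slice i s`: a simplex in the slice at height `v_i`.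
* `prismUp n s c`: the join of a simplex `s` of `Sd^n X` at height `v_n` and a simplex `c` of
  `Sd^(n+1) X` at height `v_(n+1)`, all of whose vertices are barycentres of simplices that
  contain `s`.
* `prismDown n s t`: the join of a simplex `s` of `X` at height `-(n+1)` and a simplex `t` of `X` at
  height `-n`, where the vertices of `s` come before those of `t` in a common simplex. -/
inductive T0Simplex (X : OrderedComplex.{w}) : Type w
  | slice (i : ℤ) (s : (X.sdIter i.toNat).Simplex)
  | prismUp (n : ℕ) (s : (X.sdIter n).Simplex) (c : (X.sdIter n).sd.Simplex) (h : ∀ t ∈ c.1, s ≤ t)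
  | prismDown (n : ℕ) (s t : X.Simplex) (hst : s.1 ∪ t.1 ∈ X.K.faces)
      (h : ∀ a ∈ s.1, ∀ b ∈ t.1, a ≤ b)

namespace T0Simplex

variable {X : OrderedComplex.{w}}

/-- The barycentre, in `|X| × ℝ`. -/
def barycentre (d : ℕ) : T0Simplex X → (X.V → ℝ) × ℝ
  | slice i s => (s.1.card : ℝ)⁻¹ • ∑ v ∈ s.1, (X.pos i.toNat v, height d i)
  | prismUp n s c _ => ((s.1.card : ℝ) + c.1.card)⁻¹ •
      (∑ v ∈ s.1, (X.pos n v, height d n) + ∑ v ∈ c.1, (X.pos (n + 1) v, height d (n + 1)))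
  | prismDown n s t _ _ => ((s.1.card : ℝ) + t.1.card)⁻¹ •
      (∑ v ∈ s.1, (X.pos 0 v, height d (-(n + 1))) + ∑ v ∈ t.1, (X.pos 0 v, height d (-n)))

end T0Simplex

open ZeroObject

section

variable {X : OrderedComplex.{w}} (r : ∀ j, Approx (X.sdIter j)) {var : Variance}
    {𝒜 : Type u} [Category.{v} 𝒜] [Preadditive 𝒜] [HasFiniteBiproducts 𝒜]
    (C : ChainComplex (SimplicialCat X var 𝒜) ℤ)

/-- The objects of `C ⊗ ℤ`: those of `Sd^j C`, `j = max (0, i)`, over the slice at height `v_i`, and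
zero over the simplices in between. -/
def tensorObj (n : ℤ) : T0Simplex X → 𝒜
  | .slice i s => ((sdComplex r C i.toNat).X n).obj s
  | .prismUp _ _ _ _ => 0
  | .prismDown _ _ _ _ _ => 0

/-- The component of the differential from `(s, v_i)` to `(s', v_i)`. -/
def sliceEntry (n m : ℤ) : {i i' : ℤ} → i = i' → (s : (X.sdIter i.toNat).Simplex) →
    (s' : (X.sdIter i'.toNat).Simplex) →
    (tensorObj r C n (.slice i s) ⟶ tensorObj r C m (.slice i' s'))
  | i, _, rfl, s, s' => Graded.app ((sdComplex r C i.toNat).d n m) s s'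

open scoped Classical in
/-- The components of the differential of `C ⊗ ℤ`; there are none between different slices. -/
def tensorEntry (n m : ℤ) (F G : T0Simplex X) : tensorObj r C n F ⟶ tensorObj r C m G :=
  match F, G with
  | .slice i s, .slice i' s' => if h : i = i' then sliceEntry r C n m h s s' else 0
  | _, _ => 0

theorem tensorEntry_self (n m : ℤ) (i : ℤ) (s s' : (X.sdIter i.toNat).Simplex) :
    tensorEntry r C n m (.slice i s) (.slice i s') = Graded.app ((sdComplex r C i.toNat).d n m) s s' :=
  dif_pos rfl

theorem tensorEntry_ne (n m : ℤ) {i i' : ℤ} (h : i ≠ i') (s : (X.sdIter i.toNat).Simplex)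
    (s' : (X.sdIter i'.toNat).Simplex) :
    tensorEntry r C n m (.slice i s) (.slice i' s') = 0 :=
  dif_neg h

theorem exists_of_tensorEntry_ne_zero {n m : ℤ} {F G : T0Simplex X}
    (h : tensorEntry r C n m F G ≠ 0) : ∃ i s s', F = .slice i s ∧ G = .slice i s' := by
  cases F <;> cases G <;> try exact absurd rfl h
  rename_i i s i' s'
  by_cases e : i = i'
  · subst e; exact ⟨i, s, s', rfl, rfl⟩
  · exact absurd (tensorEntry_ne r C n m e s s') h

theorem slice_injective (i : ℤ) :
    Function.Injective (T0Simplex.slice (X := X) i) := fun _ _ h => by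
  injection h

/-- The complex `C ⊗ ℤ` in `G_(t^0(X × ℝ))(𝒜)`. -/
def tensorZ : ChainComplex (GradedCat (T0Simplex X) 𝒜) ℤ where
  X n := Graded.mk (tensorObj r C n)
  d n m := Graded.Hom.mk (tensorEntry r C n m)
    (fun F => by
      by_cases hF : ∃ i s, F = .slice i s
      · obtain ⟨i, s, rfl⟩ := hF
        refine ((((sdComplex r C i.toNat).d n m).finite s).image (T0Simplex.slice i)).subset ?_
        intro G hG
        obtain ⟨i', s', t, e, rfl⟩ := exists_of_tensorEntry_ne_zero r C hG
        injection e with e1 e2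
        subst e1
        cases eq_of_heq e2
        refine ⟨t, ?_, rfl⟩
        have := hG
        rwa [Set.mem_ofPred_eq, tensorEntry_self] at this
      · refine Set.finite_empty.subset fun G hG => hF ?_
        obtain ⟨i, s, t, e, -⟩ := exists_of_tensorEntry_ne_zero r C hG
        exact ⟨i, s, e⟩)
    (fun _ _ h => absurd trivial h)
  shape n m h := Graded.hom_ext fun F G => by
    by_contra h'
    obtain ⟨i, s, t, rfl, rfl⟩ := exists_of_tensorEntry_ne_zero r C h'
    refine h' ((tensorEntry_self r C n m i s t).trans ?_)
    rw [HomologicalComplex.shape _ _ _ h, Graded.zero_app]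
    rfl
  d_comp_d' n m p _ _ := Graded.hom_ext fun F H => by
    rw [Graded.comp_app, Graded.zero_app]
    change ∑ᶠ G, tensorEntry r C n m F G ≫ tensorEntry r C m p G H = 0
    by_contra h
    obtain ⟨G, hG⟩ : ∃ G, tensorEntry r C n m F G ≫ tensorEntry r C m p G H ≠ 0 := by
      by_contra! h'
      exact h (finsum_eq_zero_of_forall_eq_zero h')
    obtain ⟨i, s, t, rfl, rfl⟩ := exists_of_tensorEntry_ne_zero r C
      (show tensorEntry r C n m F G ≠ 0 from fun h => hG (by rw [h, zero_comp]))
    obtain ⟨i', t', q, e, rfl⟩ := exists_of_tensorEntry_ne_zero r C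
      (show tensorEntry r C m p (.slice i t) H ≠ 0 from fun h => hG (by rw [h, comp_zero]))
    injection e with e1 e2
    subst e1
    apply h
    rw [← finsum_mem_univ, finsum_mem_inter_support_eq _ Set.univ (Set.range (T0Simplex.slice i)),
      finsum_mem_range (slice_injective i)]
    · simp only [tensorEntry_self]
      exact (Graded.comp_app _ _ _ _).symm.trans (by rw [HomologicalComplex.d_comp_d]; rfl)
    · ext G
      simp only [Set.univ_inter, Set.mem_inter_iff, iff_and_self]
      intro hG
      obtain ⟨i', s', t', e, rfl⟩ := exists_of_tensorEntry_ne_zero r C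
        (show tensorEntry r C n m (.slice i s) G ≠ 0 from fun h => hG (by dsimp only; rw [h, zero_comp]))
      injection e with e1 e2
      subst e1
      exact ⟨t', rfl⟩

end

/-- The composite `r_0 ∘ ... ∘ r_(i-1)` of the maps `Sd^(j+1) X → Sd^j X`, on vertices. -/
def rIter {X : OrderedComplex.{w}} (r : ∀ j, Approx (X.sdIter j)) : (i : ℕ) → (X.sdIter i).V → X.V
  | 0 => id
  | i + 1 => fun v => rIter r i ((r i).vert v)

/-- For some `i` the composite map `Sd^i X → X` retracts, for every simplex `σ` of `X`, the simplicial
neighbourhood of `σ` in `Sd^i X` to `σ`: every simplex `T` of `Sd^i X` that has a vertex in the closed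
simplex `σ` is mapped into `σ`. -/
def Retracts {X : OrderedComplex.{w}} (r : ∀ j, Approx (X.sdIter j)) : Prop :=
  ∃ i : ℕ, ∀ σ : X.Simplex, ∀ T : (X.sdIter i).Simplex, (∃ v ∈ T.1, X.pos i v ∈ X.cell σ.1) →
    ∀ v ∈ T.1, rIter r i v ∈ σ.1

end

open OrderedComplex ZeroObject

/-! Conditions 1 and 2 are compared by triangularity. Matrices in the simplicial category are
triangular for the face relation, so taking diagonal components is multiplicative and a contraction
of `C` restricts to every `C(σ)`. Conversely, put the local contractions on the diagonal of a matrix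
`Γ`. Then `dΓ + Γd` has identity diagonal, and as the dimension is finite it is the identity plus a
nilpotent matrix. It is thus an invertible chain map that is null homotopic, and `C` is
contractible.

From 1 to 3: over a simplex `a` of `Sd X` the diagonal part of the subdivision is `C(r a)` with
shifted degrees, so local contractibility passes to all `Sd^j C`. The contractions obtained from it
are triangular, i.e. they connect only comparable simplices, whose barycentres are at distance at
most `(d / (d + 1)) ^ j * √2` in `X`. The height of the slice grows like `((d + 2) / (d + 1)) ^ j`,
and `d (d + 2) ≤ (d + 1) ^ 2`, so the bound in the cone is uniform (`height_le`).

From 3 to 1 there is a squeezing argument. The differential does not mix slices, so `P` restricts to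
a contraction of one slice `Sd^l C`. As column finite matrices, `C` is a retract of `Sd^l C` by
chain maps `F` and `G`, so `F P G` contracts `C`. For `A^*` the map `F` goes from `τ` to simplices
that lie geometrically in `τ`, and `G` follows the simplicial map `Sd^l X → X`; for `A_*` the roles
are exchanged. On a high slice `P` moves only a tiny distance in `X`, and by `Retracts` the
simplicial map takes whatever comes that close to `τ` into `τ`. Hence `F P G` is triangular and its
diagonal contracts the `C(σ)`. Closeness is measured by the sum of the barycentric coordinates at
the vertices of `τ`: a Lipschitz function which at the vertices of `Sd^i X` outside `τ` stays away
from `1`, being rational with bounded denominator.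

The retraction is the algebraic core. A simplex `τ` is the isomorphic image of exactly one simplex
of its own subdivision, its flag (`exists_flag`). The simplices of `Sd X` with image `τ` are acyclic
up to an augmentation (`Cyc.bdry`), and acyclic carriers give a homotopy that contracts each fibre
to the flag and never leaves a simplex. Over different fibres the homotopy equation fails by an
error that strictly changes the dimension of the image. The error is nilpotent, so finitely many
corrections of the inclusion of the flags make it a chain map (`iterate_correct`; dually
`iterate_cocorrect`). -/

/-- A poset `α` that looks like the poset of simplices of a simplicial complex with ordered vertices,
with a choice of a vertex of every simplex. -/
structure Labelling (α β : Type w) [PartialOrder α] [PartialOrder β] where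
  vs : α → Finset β
  le_iff : ∀ {s t : α}, s ≤ t ↔ vs s ⊆ vs t
  face : ∀ s t, t ⊆ vs s → t.Nonempty → ∃ s', vs s' = t
  r : α → β
  mem : ∀ s, r s ∈ vs s
  total : ∀ s, ∀ a ∈ vs s, ∀ b ∈ vs s, a ≤ b ∨ b ≤ a

/-! ### Chains of simplices and the flag of a simplex. -/

namespace Labelling

open scoped Classical

variable {α β : Type w} [PartialOrder α] [PartialOrder β] (L : Labelling α β)

/-- Finite chains of a poset. -/
abbrev Chain (c : Finset α) : Prop := IsChain (· ≤ ·) (c : Set α)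

theorem Chain.mono {c c' : Finset α} (h : Chain c) (h' : c' ⊆ c) : Chain c' :=
  IsChain.mono (Finset.coe_subset.2 h') h

theorem Chain.total {c : Finset α} (h : Chain c) {x y : α} (hx : x ∈ c) (hy : y ∈ c) :
    x ≤ y ∨ y ≤ x := IsChain.total h hx hy

theorem Chain.lt_or_lt {c : Finset α} (h : Chain c) {x y : α} (hx : x ∈ c) (hy : y ∈ c) (hxy : x ≠ y) :
    x < y ∨ y < x :=
  (h.total hx hy).imp (fun h => lt_of_le_of_ne h hxy) fun h => lt_of_le_of_ne h hxy.symm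

theorem Chain.exists_max {c : Finset α} (h : Chain c) (hc : c.Nonempty) : ∃ m ∈ c, ∀ x ∈ c, x ≤ m := by
  obtain ⟨m, hm, hmax⟩ := c.exists_maximal hc
  exact ⟨m, hm, fun x hx => (h.total hx hm).elim id fun h' => hmax hx h'⟩

theorem vs_injective : Function.Injective L.vs := fun s t h =>
  le_antisymm (L.le_iff.2 h.subset) (L.le_iff.2 h.symm.subset)

theorem image_subset {c : Finset α} {m : α} (h : ∀ x ∈ c, x ≤ m) : c.image L.r ⊆ L.vs m := fun u hu => by
  obtain ⟨x, hx, rfl⟩ := Finset.mem_image.1 hu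
  exact L.le_iff.1 (h x hx) (L.mem x)

/-- The labels of a chain are vertices of its largest element, which therefore has all the vertices
of `s`. -/
theorem mem_of_image_eq {c : Finset α} {s : α} (hc : Chain c) (h : ∀ x ∈ c, x ≤ s)
    (hi : c.image L.r = L.vs s) : s ∈ c := by
  have hne : c.Nonempty := by
    rw [← Finset.image_nonempty (f := L.r), hi]; exact ⟨_, L.mem s⟩
  obtain ⟨m, hm, hmax⟩ := hc.exists_max hne
  have : s ≤ m := L.le_iff.2 (hi ▸ L.image_subset hmax)
  rwa [le_antisymm this (h m hm)]

/-- Such a chain contains `s`, and what is left after removing `s` still hits every vertex except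
perhaps `L.r s`. Its largest element is thus a proper face containing all the other vertices, so it
is the facet opposite to `L.r s`. Everything is forced, and the induction is on the number of
vertices. -/
theorem exists_flag (s : α) : ∃ f : Finset α, (Chain f ∧ (∀ x ∈ f, x ≤ s) ∧ f.image L.r = L.vs s ∧
    f.card = (L.vs s).card) ∧
    ∀ c : Finset α, Chain c → (∀ x ∈ c, x ≤ s) → c.image L.r = L.vs s → c = f := by
  induction hn : (L.vs s).card using Nat.strong_induction_on generalizing s with
  | _ n ih =>
  subst hn
  have key : ∀ c : Finset α, Chain c → (∀ x ∈ c, x ≤ s) → c.image L.r = L.vs s →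
      s ∈ c ∧ ∀ x ∈ c.erase s, L.vs x = (L.vs s).erase (L.r s) ∨ L.vs x ⊂ (L.vs s).erase (L.r s) := by
    intro c h1 h2 h3
    have hs := L.mem_of_image_eq h1 h2 h3
    refine ⟨hs, fun x hx => ?_⟩
    have hc' : Chain (c.erase s) := h1.mono (Finset.erase_subset _ _)
    obtain ⟨m, hm, hmax⟩ := hc'.exists_max ⟨x, hx⟩
    -- Removing `s` from `c` loses at most the label `L.r s`.
    have a1 : (L.vs s).erase (L.r s) ⊆ L.vs m := by
      refine Finset.Subset.trans (fun u hu => ?_) (L.image_subset hmax)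
      rw [Finset.mem_erase, ← h3] at hu
      obtain ⟨y, hy, rfl⟩ := Finset.mem_image.1 hu.2
      exact Finset.mem_image_of_mem _ (Finset.mem_erase.2 ⟨fun e => hu.1 (e ▸ rfl), hy⟩)
    have a2 : L.vs m ⊂ L.vs s := by
      refine Finset.ssubset_iff_subset_ne.2 ⟨L.le_iff.1 (h2 m (Finset.mem_of_mem_erase hm)), fun e => ?_⟩
      exact (Finset.mem_erase.1 hm).1 (L.vs_injective e)
    have a3 : L.vs m = (L.vs s).erase (L.r s) := by
      refine (Finset.eq_of_subset_of_card_le a1 ?_).symm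
      rw [Finset.card_erase_of_mem (L.mem s)]
      have := Finset.card_lt_card a2
      omega
    rcases (L.le_iff.1 (hmax x hx)).eq_or_ssubset with h | h
    · exact .inl (h.trans a3)
    · exact .inr (a3 ▸ h)
  by_cases hv : ((L.vs s).erase (L.r s)).Nonempty
  · obtain ⟨t, ht⟩ := L.face s _ (Finset.erase_subset _ _) hv
    have hts : t < s := lt_of_le_of_ne (L.le_iff.2 (ht ▸ Finset.erase_subset _ _)) fun e =>
      Finset.notMem_erase (L.r s) (L.vs s) (by rw [← ht, e]; exact L.mem s)
    have hcard : (L.vs t).card + 1 = (L.vs s).card := by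
      rw [ht, Finset.card_erase_add_one (L.mem s)]
    obtain ⟨f, ⟨f1, f2, f3, f4⟩, f5⟩ := ih _ (by omega) t rfl
    have hsf : s ∉ f := fun h => absurd (f2 s h) hts.not_ge
    refine ⟨insert s f, ⟨?_, ?_, ?_, ?_⟩, ?_⟩
    · rw [Chain, Finset.coe_insert]
      exact f1.insert fun b hb _ => .inr ((f2 b hb).trans hts.le)
    · intro x hx
      rcases Finset.mem_insert.1 hx with rfl | hx
      · exact le_rfl
      · exact (f2 x hx).trans hts.le
    · rw [Finset.image_insert, f3, ht, Finset.insert_erase (L.mem s)]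
    · rw [Finset.card_insert_of_notMem hsf, f4, hcard]
    · intro c h1 h2 h3
      obtain ⟨h4, h5⟩ := key c h1 h2 h3
      have h6 : ∀ x ∈ c.erase s, x ≤ t := fun x hx => L.le_iff.2 <| by
        rw [ht]; exact (h5 x hx).elim (fun h => h.subset) fun h => h.subset
      rw [← Finset.insert_erase h4, f5 (c.erase s) (h1.mono (Finset.erase_subset _ _)) h6]
      refine (L.image_subset h6).antisymm ?_
      rw [ht, ← h3]
      intro u hu
      obtain ⟨y, hy, rfl⟩ := Finset.mem_image.1 (Finset.mem_of_mem_erase hu)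
      exact Finset.mem_image_of_mem _ (Finset.mem_erase.2
        ⟨fun e => (Finset.mem_erase.1 hu).1 (e ▸ rfl), hy⟩)
  · rw [Finset.not_nonempty_iff_eq_empty] at hv
    have hvs : L.vs s = {L.r s} := by
      rw [← Finset.insert_erase (L.mem s), hv, Finset.insert_empty]
    refine ⟨{s}, ⟨?_, ?_, ?_, ?_⟩, ?_⟩
    · simp [Chain]
    · simp
    · simp [hvs]
    · simp [hvs]
    · intro c h1 h2 h3
      obtain ⟨h4, h5⟩ := key c h1 h2 h3
      have : c.erase s = ∅ := by
        by_contra hne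
        obtain ⟨x, hx⟩ := Finset.nonempty_iff_ne_empty.2 hne
        have := h5 x hx
        rw [hv] at this
        have hx' := L.mem x
        rcases this with h | h
        · simp [h] at hx'
        · simpa using h.subset hx'
      rw [← Finset.insert_erase h4, this, Finset.insert_empty]

/-- The unique chain of faces of `s` whose image is `s`. -/
noncomputable def flag (s : α) : Finset α := (L.exists_flag s).choose

theorem flag_chain (s : α) : Chain (L.flag s) := (L.exists_flag s).choose_spec.1.1

theorem flag_le {s x : α} (h : x ∈ L.flag s) : x ≤ s := (L.exists_flag s).choose_spec.1.2.1 x h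

theorem image_flag (s : α) : (L.flag s).image L.r = L.vs s := (L.exists_flag s).choose_spec.1.2.2.1

theorem card_flag (s : α) : (L.flag s).card = (L.vs s).card := (L.exists_flag s).choose_spec.1.2.2.2

theorem eq_flag {s : α} {c : Finset α} (h : Chain c) (h' : ∀ x ∈ c, x ≤ s)
    (hi : c.image L.r = L.vs s) : c = L.flag s := (L.exists_flag s).choose_spec.2 c h h' hi

/-! Signs. -/

/-- `-1` if the proposition holds, and `1` otherwise. -/
noncomputable def sgn (p : Prop) : ℤ := if p then -1 else 1

theorem sgn_mul_self (p : Prop) : sgn p * sgn p = 1 := by unfold sgn; split_ifs <;> rfl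

theorem prod_sgn {ι : Type*} (s : Finset ι) (p : ι → Prop) : ∏ x ∈ s, sgn (p x) = (-1) ^ (s.filter p).card := by
  unfold sgn
  rw [Finset.prod_ite, Finset.prod_const_one, mul_one, Finset.prod_const]

theorem prod_sgn_mul_self {ι : Type*} (s : Finset ι) (p : ι → Prop) :
    (∏ x ∈ s, sgn (p x)) * (∏ x ∈ s, sgn (p x)) = 1 := by
  rw [← Finset.prod_mul_distrib]; exact Finset.prod_eq_one fun _ _ => sgn_mul_self _

/-- The sign of the position of `x` in `b`. -/
noncomputable def ps (b : Finset α) (x : α) : ℤ := ∏ y ∈ b, sgn (y < x)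

/-- The sign of the position of `x` in `b` in the lexicographical order. -/
noncomputable def lx (b : Finset α) (x : α) : ℤ := ∏ y ∈ b, sgn (L.r y < L.r x ∨ (L.r y = L.r x ∧ y < x))

/-- The sign of the permutation that turns the order of `b` into the lexicographical one. -/
noncomputable def sg (b : Finset α) : ℤ := ∏ y ∈ b, ∏ z ∈ b, sgn (y < z ∧ L.r z < L.r y)

theorem ps_mul_self (b : Finset α) (x : α) : ps b x * ps b x = 1 := prod_sgn_mul_self _ _

theorem sg_mul_self (b : Finset α) : L.sg b * L.sg b = 1 := by
  unfold sg
  rw [← Finset.prod_mul_distrib]; exact Finset.prod_eq_one fun _ _ => prod_sgn_mul_self _ _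

theorem ps_insert {b : Finset α} {x : α} (y : α) (h : x ∉ b) : ps (insert x b) y = sgn (x < y) * ps b y :=
  Finset.prod_insert h

theorem total_labels {c : Finset α} (hc : Chain c) {x y : α} (hx : x ∈ c) (hy : y ∈ c) :
    L.r x ≤ L.r y ∨ L.r y ≤ L.r x := by
  rcases hc.total hx hy with h | h
  · exact L.total y _ (L.le_iff.1 h (L.mem x)) _ (L.mem y)
  · exact L.total x _ (L.mem x) _ (L.le_iff.1 h (L.mem y))

/-- Compare `x` with one `y` of `c` at a time: `y` comes before `x` in the chain if and only if it
does so lexicographically, except when `x` and `y` form an inversion, and these inversions are the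
factors that `sg` gains. -/
theorem ps_mul_sg {c : Finset α} {x : α} (hx : x ∉ c) (hc : Chain (insert x c)) :
    ps c x * L.sg c = L.sg (insert x c) * L.lx (insert x c) x := by
  have e1 : L.sg (insert x c) = (∏ z ∈ c, sgn (x < z ∧ L.r z < L.r x)) *
      ((∏ y ∈ c, sgn (y < x ∧ L.r x < L.r y)) * L.sg c) := by
    unfold sg
    rw [Finset.prod_insert hx, Finset.prod_insert hx]
    simp only [Finset.prod_insert hx, Finset.prod_mul_distrib]
    simp [sgn]
  have e2 : L.lx (insert x c) x = ∏ y ∈ c, sgn (L.r y < L.r x ∨ (L.r y = L.r x ∧ y < x)) := by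
    unfold lx
    rw [Finset.prod_insert hx]
    simp [sgn]
  have e3 : ps c x = (∏ z ∈ c, sgn (x < z ∧ L.r z < L.r x)) *
      (∏ y ∈ c, sgn (y < x ∧ L.r x < L.r y)) *
      ∏ y ∈ c, sgn (L.r y < L.r x ∨ (L.r y = L.r x ∧ y < x)) := by
    unfold ps
    rw [← Finset.prod_mul_distrib, ← Finset.prod_mul_distrib]
    refine Finset.prod_congr rfl fun y hy => ?_
    have hy' : y ∈ insert x c := Finset.mem_insert_of_mem hy
    have hx' : x ∈ insert x c := Finset.mem_insert_self _ _
    have hne : x ≠ y := fun e => hx (e ▸ hy)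
    have hr : L.r x < L.r y ∨ L.r x = L.r y ∨ L.r y < L.r x := by
      rcases L.total_labels hc hx' hy' with h | h
      · exact h.lt_or_eq.imp_right .inl
      · exact h.lt_or_eq.elim (fun h => .inr (.inr h)) fun h => .inr (.inl h.symm)
    rcases hc.lt_or_lt hx' hy' hne with h | h <;> rcases hr with h' | h' | h'
    all_goals first
      | simp [sgn, h, h', h.not_gt, h'.not_gt, h'.ne, h'.ne']
      | simp [sgn, h, h', h.not_gt]
  rw [e1, e2, e3]; ring

/-- The sign behind the vanishing of the squared boundary: exactly one of `x` and `y` precedes the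
other, so exactly one of the two insertions changes a position. -/
theorem ps_swap {b : Finset α} {x y : α} (hx : x ∉ b) (hy : y ∉ b) (h : x < y ∨ y < x) :
    ps b x * ps (insert x b) y = - (ps b y * ps (insert y b) x) := by
  rw [ps_insert y hx, ps_insert x hy]
  rcases h with h | h <;> simp [sgn, h, h.not_gt] <;> ring

end Labelling

/-! ### The simplicial boundary between simplices with prescribed images, and the augmentation. -/

namespace Labelling

open scoped Classical

variable {α β : Type w} [PartialOrder α] [PartialOrder β] (L : Labelling α β)

/-- The value at `b` of the simplicial boundary of `z`, where only vertices of `W` over `τ` are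
considered. -/
noncomputable def bdAt (W : Finset α) (τ : Finset β) (z : Finset α → ℤ) (b : Finset α) : ℤ :=
  ∑ x ∈ W with x ∉ b ∧ L.r x ∈ τ, ps b x * z (insert x b)

/-- The simplicial boundary from simplices over `τ` to simplices over `τ'`. -/
noncomputable def bd (W : Finset α) (τ τ' : Finset β) : (Finset α → ℤ) →ₗ[ℤ] (Finset α → ℤ) where
  toFun z b := if b.image L.r = τ' then L.bdAt W τ z b else 0
  map_add' z z' := by
    funext b
    simp only [Pi.add_apply, bdAt, mul_add, Finset.sum_add_distrib]
    split_ifs <;> simp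
  map_smul' k z := by
    funext b
    simp only [Pi.smul_apply, bdAt, smul_eq_mul, RingHom.id_apply, mul_left_comm _ k, ← Finset.mul_sum]
    split_ifs <;> simp

theorem bd_apply (W : Finset α) (τ τ' : Finset β) (z : Finset α → ℤ) (b : Finset α) :
    L.bd W τ τ' z b = if b.image L.r = τ' then L.bdAt W τ z b else 0 := rfl

/-- The augmentation: the signed sum over the simplices of the same dimension as `τ`. -/
noncomputable def aug (W : Finset α) (τ : Finset β) : (Finset α → ℤ) →ₗ[ℤ] ℤ where
  toFun z := ∑ c ∈ W.powerset with c.card = τ.card, L.sg c * z c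
  map_add' z z' := by simp only [Pi.add_apply, mul_add, Finset.sum_add_distrib]
  map_smul' k z := by
    simp only [Pi.smul_apply, smul_eq_mul, RingHom.id_apply, Finset.mul_sum]
    exact Finset.sum_congr rfl fun _ _ => by ring

/-- `z` is a combination of chains in `U` with image `τ`. -/
def Supp (U : Finset α) (τ : Finset β) (z : Finset α → ℤ) : Prop :=
  ∀ c, z c ≠ 0 → c ⊆ U ∧ Chain c ∧ c.image L.r = τ

variable {L}

theorem Supp.mono {U U' : Finset α} {τ : Finset β} {z : Finset α → ℤ} (h : L.Supp U τ z) (hU : U ⊆ U') :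
    L.Supp U' τ z := fun c hc => ⟨(h c hc).1.trans hU, (h c hc).2⟩

theorem Supp.sub {U : Finset α} {τ : Finset β} {z z' : Finset α → ℤ} (h : L.Supp U τ z)
    (h' : L.Supp U τ z') : L.Supp U τ (z - z') := fun c hc => by
  by_cases h0 : z c = 0
  · exact h' c fun h1 => hc (by simp [h0, h1])
  · exact h c h0

theorem Supp.add {U : Finset α} {τ : Finset β} {z z' : Finset α → ℤ} (h : L.Supp U τ z)
    (h' : L.Supp U τ z') : L.Supp U τ (z + z') := fun c hc => by
  by_cases h0 : z c = 0
  · exact h' c fun h1 => hc (by simp [h0, h1])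
  · exact h c h0

theorem Supp.smul {U : Finset α} {τ : Finset β} {z : Finset α → ℤ} (h : L.Supp U τ z) (k : ℤ) :
    L.Supp U τ (k • z) := fun c hc => h c fun h0 => hc (by simp [h0])

theorem Supp.zero (U : Finset α) (τ : Finset β) : L.Supp U τ 0 := fun _ h => absurd rfl h

theorem Supp.sum {ι : Type*} {U : Finset α} {τ : Finset β} {s : Finset ι} {z : ι → Finset α → ℤ}
    (h : ∀ i ∈ s, L.Supp U τ (z i)) : L.Supp U τ (∑ i ∈ s, z i) := fun c hc => by
  rw [Finset.sum_apply] at hc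
  obtain ⟨i, hi, h'⟩ := Finset.exists_ne_zero_of_sum_ne_zero hc
  exact h i hi c h'

theorem Supp.single {U : Finset α} {a : Finset α} (h1 : a ⊆ U) (h2 : Chain a) :
    L.Supp U (a.image L.r) (Pi.single a 1) := fun c hc => by
  have : c = a := by
    by_contra h
    exact hc (Pi.single_eq_of_ne h 1)
  subst this
  exact ⟨h1, h2, rfl⟩

theorem Supp.bd {U W : Finset α} {τ : Finset β} {z : Finset α → ℤ} (h : L.Supp U τ z) (τ' : Finset β) :
    L.Supp U τ' (L.bd W τ τ' z) := fun b hb => by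
  rw [bd_apply] at hb
  split_ifs at hb with h1
  · obtain ⟨x, hx, h'⟩ := Finset.exists_ne_zero_of_sum_ne_zero hb
    obtain ⟨h2, h3, -⟩ := h _ (right_ne_zero_of_mul h')
    exact ⟨(Finset.subset_insert _ _).trans h2, h3.mono (Finset.subset_insert _ _), h1⟩
  · exact absurd rfl hb

variable (L)

theorem bdAt_congr {W : Finset α} {τ : Finset β} {z z' : Finset α → ℤ} {b : Finset α}
    (h : ∀ x ∈ W, x ∉ b → L.r x ∈ τ → z (insert x b) = z' (insert x b)) :
    L.bdAt W τ z b = L.bdAt W τ z' b :=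
  Finset.sum_congr rfl fun x hx => by
    rw [Finset.mem_filter] at hx
    rw [h x hx.1 hx.2.1 hx.2.2]

theorem bdAt_eq_zero {W : Finset α} {τ : Finset β} {z : Finset α → ℤ} {b : Finset α}
    (h : ∀ x ∈ W, x ∉ b → L.r x ∈ τ → z (insert x b) = 0) :
    L.bdAt W τ z b = 0 :=
  Finset.sum_eq_zero fun x hx => by
    rw [Finset.mem_filter] at hx
    rw [h x hx.1 hx.2.1 hx.2.2, mul_zero]

theorem bdAt_add (W : Finset α) (τ : Finset β) (z z' : Finset α → ℤ) (b : Finset α) :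
    L.bdAt W τ (z + z') b = L.bdAt W τ z b + L.bdAt W τ z' b := by
  simp only [bdAt, Pi.add_apply, mul_add, Finset.sum_add_distrib]

theorem bdAt_mono {W W' : Finset α} {τ : Finset β} {z : Finset α → ℤ} {b : Finset α} (h : W ⊆ W')
    (hz : L.Supp W τ z) : L.bdAt W τ z b = L.bdAt W' τ z b := by
  refine Finset.sum_subset (Finset.filter_subset_filter _ h) fun x hx hx' => ?_
  by_contra h0
  refine hx' ?_
  rw [Finset.mem_filter] at hx ⊢
  exact ⟨(hz _ (right_ne_zero_of_mul h0)).1 (Finset.mem_insert_self _ _), hx.2⟩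

theorem bd_mono {W W' : Finset α} {τ : Finset β} {z : Finset α → ℤ} (h : W ⊆ W') (τ' : Finset β)
    (hz : L.Supp W τ z) : L.bd W τ τ' z = L.bd W' τ τ' z := by
  funext b
  rw [bd_apply, bd_apply, L.bdAt_mono h hz]

theorem bd_single {W a : Finset α} (h : a ⊆ W) (τ' : Finset β) :
    L.bd W (a.image L.r) τ' (Pi.single a 1) =
      ∑ x ∈ a with (a.erase x).image L.r = τ', ps (a.erase x) x • Pi.single (a.erase x) 1 := by
  funext b
  rw [bd_apply, Finset.sum_apply, Finset.sum_filter]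
  split_ifs with hb
  · rw [bdAt, Finset.sum_filter, ← Finset.sum_subset h]
    · refine Finset.sum_congr rfl fun x hx => ?_
      by_cases e : b = a.erase x
      · subst e
        rw [if_pos ⟨Finset.notMem_erase _ _, Finset.mem_image_of_mem _ hx⟩, if_pos hb,
          Finset.insert_erase hx]
        simp
      · have h1 : (if (a.erase x).image L.r = τ' then
            (ps (a.erase x) x • (Pi.single (a.erase x) 1 : Finset α → ℤ)) b else 0) = 0 := by
          split_ifs
          · rw [Pi.smul_apply, Pi.single_eq_of_ne e, smul_zero]
          · rfl
        rw [h1]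
        split_ifs with h2
        · rw [Pi.single_eq_of_ne, mul_zero]
          rintro rfl
          exact e (Finset.erase_insert h2.1).symm
        · rfl
    · intro x _ hx
      split_ifs with h2
      · rw [Pi.single_eq_of_ne, mul_zero]
        rintro rfl
        exact hx (Finset.mem_insert_self _ _)
      · rfl
  · refine (Finset.sum_eq_zero fun x _ => ?_).symm
    split_ifs with h1
    · rw [Pi.smul_apply, Pi.single_eq_of_ne (by rintro rfl; exact hb h1), smul_zero]
    · rfl

theorem eq_sum_single {W : Finset α} {τ : Finset β} {z : Finset α → ℤ} (h : L.Supp W τ z) :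
    z = ∑ a ∈ W.powerset with Chain a ∧ a.image L.r = τ, z a • Pi.single a 1 := by
  funext b
  rw [Finset.sum_apply]
  by_cases hb : z b = 0
  · rw [hb, Finset.sum_eq_zero]
    intro a _
    rw [Pi.smul_apply]
    by_cases e : b = a
    · rw [← e, hb, zero_smul]
    · rw [Pi.single_eq_of_ne e, smul_zero]
  · rw [Finset.sum_eq_single b]
    · simp
    · intro a _ hab
      rw [Pi.smul_apply, Pi.single_eq_of_ne hab.symm, smul_zero]
    · intro hb'
      exact absurd (Finset.mem_filter.2 ⟨Finset.mem_powerset.2 (h b hb).1, (h b hb).2⟩) hb'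

theorem aug_single {W a : Finset α} (h : a ⊆ W) (τ : Finset β) :
    L.aug W τ (Pi.single a 1) = if a.card = τ.card then L.sg a else 0 := by
  change ∑ c ∈ W.powerset with c.card = τ.card, L.sg c * (Pi.single a 1 : Finset α → ℤ) c = _
  rw [Finset.sum_filter, Finset.sum_eq_single a]
  · simp
  · intro c _ hc
    rw [Pi.single_eq_of_ne hc, mul_zero, ite_self]
  · exact fun h' => absurd (Finset.mem_powerset.2 h) h'

/-- By `ps_mul_sg`, the weight `sg` of a face times its position sign is `sg a` times the
lexicographical position sign of the omitted vertex; only the latter depends on the face. -/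
theorem aug_bd_single {W a : Finset α} (h : a ⊆ W) (hc : Chain a) (τ' : Finset β) :
    L.aug W τ' (L.bd W (a.image L.r) τ' (Pi.single a 1)) =
      if a.card = τ'.card + 1 then
        L.sg a * ∑ x ∈ a with (a.erase x).image L.r = τ', L.lx a x else 0 := by
  rw [L.bd_single h, map_sum]
  have : ∀ x ∈ a.filter (fun x => (a.erase x).image L.r = τ'),
      L.aug W τ' (ps (a.erase x) x • Pi.single (a.erase x) 1) =
        if a.card = τ'.card + 1 then L.sg a * L.lx a x else 0 := by
    intro x hx
    have hx' := Finset.mem_of_mem_filter _ hx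
    rw [map_smul, L.aug_single ((Finset.erase_subset _ _).trans h)]
    have h1 := Finset.card_erase_add_one hx'
    have h2 := L.ps_mul_sg (Finset.notMem_erase x a) (by rwa [Finset.insert_erase hx'])
    rw [Finset.insert_erase hx'] at h2
    by_cases h3 : a.card = τ'.card + 1
    · rw [if_pos h3, if_pos (by omega), smul_eq_mul, h2]
    · rw [if_neg h3, if_neg (by omega), smul_zero]
  rw [Finset.sum_congr rfl this]
  split_ifs
  · rw [Finset.mul_sum]
  · exact Finset.sum_const_zero

/-- Exactly one label occurs twice, at `p < q`. Only `p` and `q` can be omitted without changing the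
image, and they are neighbours in the lexicographical order. -/
theorem sum_lx {a : Finset α} (hc : Chain a) (h : a.card = (a.image L.r).card + 1) :
    ∑ x ∈ a with (a.erase x).image L.r = a.image L.r, L.lx a x = 0 := by
  obtain ⟨p, hp, q, hq, hpq, hlt⟩ : ∃ p ∈ a, ∃ q ∈ a, L.r p = L.r q ∧ p < q := by
    obtain ⟨x, hx, y, hy, hne, hxy⟩ : ∃ x ∈ a, ∃ y ∈ a, x ≠ y ∧ L.r x = L.r y :=
      Finset.exists_ne_map_eq_of_card_lt_of_maps_to (t := a.image L.r) (by omega)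
        (fun z hz => Finset.mem_image_of_mem _ hz)
    rcases hc.lt_or_lt hx hy hne with h' | h'
    · exact ⟨x, hx, y, hy, hxy, h'⟩
    · exact ⟨y, hy, x, hx, hxy.symm, h'⟩
  have im : ∀ x y, y ∈ a → x ≠ y → L.r x = L.r y → (a.erase x).image L.r = a.image L.r := by
    intro x y hy hne hxy
    refine (Finset.image_subset_image (Finset.erase_subset _ _)).antisymm fun u hu => ?_
    obtain ⟨z, hz, rfl⟩ := Finset.mem_image.1 hu
    by_cases e : z = x
    · rw [e, hxy]; exact Finset.mem_image_of_mem _ (Finset.mem_erase.2 ⟨hne.symm, hy⟩)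
    · exact Finset.mem_image_of_mem _ (Finset.mem_erase.2 ⟨e, hz⟩)
  have inj : Set.InjOn L.r (a.erase p) := by
    rw [← Finset.card_image_iff, im p q hq hlt.ne hpq, Finset.card_erase_of_mem hp]
    omega
  have fib : ∀ y ∈ a, L.r y = L.r q → y ≠ p → y = q := fun y hy hyq hyp =>
    inj (Finset.mem_coe.2 (Finset.mem_erase.2 ⟨hyp, hy⟩))
      (Finset.mem_coe.2 (Finset.mem_erase.2 ⟨hlt.ne', hq⟩)) hyq
  have fil : (a.filter fun x => (a.erase x).image L.r = a.image L.r) = {p, q} := by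
    ext x
    simp only [Finset.mem_filter, Finset.mem_insert, Finset.mem_singleton]
    constructor
    · rintro ⟨hx, hx'⟩
      by_contra! hne
      obtain ⟨y, hy, hyx⟩ := Finset.mem_image.1 (hx' ▸ Finset.mem_image_of_mem L.r hx)
      obtain ⟨hy1, hy2⟩ := Finset.mem_erase.1 hy
      by_cases hyp : y = p
      · subst hyp
        exact hne.2 (fib x hx (hyx.symm.trans hpq) hne.1)
      · exact hy1 (inj (Finset.mem_coe.2 (Finset.mem_erase.2 ⟨hyp, hy2⟩))
          (Finset.mem_coe.2 (Finset.mem_erase.2 ⟨hne.1, hx⟩)) hyx)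
    · rintro (rfl | rfl)
      · exact ⟨hp, im _ q hq hlt.ne hpq⟩
      · exact ⟨hq, im _ p hp hlt.ne' hpq.symm⟩
  -- No vertex lies lexicographically between `p` and `q`, so passing from `p` to `q` only adds `p`
  -- to the vertices that come before.
  have key : L.lx a q = - L.lx a p := by
    unfold lx
    rw [← Finset.mul_prod_erase a _ hp, ← Finset.mul_prod_erase a _ hp, hpq]
    have : ∀ y ∈ a.erase p, sgn (L.r y < L.r q ∨ (L.r y = L.r q ∧ y < q)) =
        sgn (L.r y < L.r q ∨ (L.r y = L.r q ∧ y < p)) := fun y hy => by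
      obtain ⟨h1, h2⟩ := Finset.mem_erase.1 hy
      by_cases e : L.r y = L.r q
      · rw [fib y h2 e h1]; simp [sgn, hlt.not_gt]
      · simp [e]
    rw [Finset.prod_congr rfl this]
    simp [sgn, hlt]
  rw [fil, Finset.sum_pair hlt.ne, key]
  ring

theorem aug_bd {U W : Finset α} {τ : Finset β} {z : Finset α → ℤ} (h : L.Supp U τ z) (hU : U ⊆ W) :
    L.aug W τ (L.bd W τ τ z) = 0 := by
  rw [L.eq_sum_single (h.mono hU), map_sum, map_sum]
  refine Finset.sum_eq_zero fun a ha => ?_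
  obtain ⟨h1, h2, h3⟩ := Finset.mem_filter.1 ha
  subst h3
  rw [map_smul, map_smul, L.aug_bd_single (Finset.mem_powerset.1 h1) h2]
  split_ifs with h4
  · rw [L.sum_lx h2 h4, mul_zero, smul_zero]
  · exact smul_zero _

/-- A simplex mapped isomorphically to `τ` has exactly one face over `τ.erase v`. The augmentations
over `τ` and over `τ.erase v` therefore agree up to the sign of the position of `v` in `τ`. -/
theorem aug_bd_erase {U W : Finset α} {τ : Finset β} {z : Finset α → ℤ} (h : L.Supp U τ z) (hU : U ⊆ W)
    {v : β} (hv : v ∈ τ) :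
    L.aug W (τ.erase v) (L.bd W τ (τ.erase v) z) = (∏ u ∈ τ, sgn (u < v)) * L.aug W τ z := by
  conv_lhs => rw [L.eq_sum_single (h.mono hU), map_sum, map_sum]
  conv_rhs => rw [L.eq_sum_single (h.mono hU), map_sum, Finset.mul_sum]
  refine Finset.sum_congr rfl fun a ha => ?_
  obtain ⟨h1, h2, h3⟩ := Finset.mem_filter.1 ha
  rw [Finset.mem_powerset] at h1
  subst h3
  rw [map_smul, map_smul, L.aug_bd_single h1 h2, map_smul, L.aug_single h1]
  have h4 := Finset.card_erase_add_one hv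
  rw [h4]
  split_ifs with h5
  swap
  · simp
  have inj : Set.InjOn L.r a := by rw [← Finset.card_image_iff, h5]
  obtain ⟨x, hx, rfl⟩ := Finset.mem_image.1 hv
  have fil : (a.filter fun y => (a.erase y).image L.r = (a.image L.r).erase (L.r x)) = {x} := by
    ext y
    simp only [Finset.mem_filter, Finset.mem_singleton]
    constructor
    · rintro ⟨hy, hy'⟩
      by_contra hne
      have : L.r x ∈ (a.erase y).image L.r :=
        Finset.mem_image_of_mem _ (Finset.mem_erase.2 ⟨Ne.symm hne, hx⟩)
      rw [hy'] at this
      exact Finset.notMem_erase _ _ this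
    · rintro rfl
      refine ⟨hx, ?_⟩
      ext u
      simp only [Finset.mem_image, Finset.mem_erase]
      constructor
      · rintro ⟨z, ⟨hz1, hz2⟩, rfl⟩
        exact ⟨fun e => hz1 (inj hz2 hx e), z, hz2, rfl⟩
      · rintro ⟨hu, z, hz, rfl⟩
        exact ⟨z, ⟨fun e => hu (e ▸ rfl), hz⟩, rfl⟩
  have key : L.lx a x = ∏ u ∈ a.image L.r, sgn (u < L.r x) := by
    rw [Finset.prod_image inj]
    refine Finset.prod_congr rfl fun y hy => ?_
    by_cases e : L.r y = L.r x
    · rw [inj hy hx e]; simp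
    · simp [e]
  rw [fil, Finset.sum_singleton, key]
  simp only [smul_eq_mul]
  ring

/-- The two orders of inserting `x` and `y` cancel by `ps_swap`. Restricting to simplices over `τ`
loses no term: inserting vertices with labels in `τ` into a simplex over `τ` leaves the image
unchanged. -/
theorem bd_bd {U W : Finset α} {τ : Finset β} {z : Finset α → ℤ} (h : L.Supp U τ z) :
    L.bd W τ τ (L.bd W τ τ z) = 0 := by
  funext b
  rw [bd_apply]
  split_ifs with hb
  swap
  · rfl
  let g : α → α → ℤ := fun x y => if (x ∉ b ∧ L.r x ∈ τ) ∧ (y ∉ b ∧ L.r y ∈ τ) ∧ x ≠ y then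
    ps b x * (ps (insert x b) y * z (insert y (insert x b))) else 0
  have e : L.bdAt W τ (L.bd W τ τ z) b = ∑ x ∈ W, ∑ y ∈ W, g x y := by
    rw [bdAt, Finset.sum_filter]
    refine Finset.sum_congr rfl fun x _ => ?_
    split_ifs with hx
    swap
    · exact (Finset.sum_eq_zero fun y _ => if_neg fun h => hx h.1).symm
    have hi : (insert x b).image L.r = τ := by
      rw [Finset.image_insert, hb, Finset.insert_eq_of_mem hx.2]
    rw [bd_apply, if_pos hi, bdAt, Finset.mul_sum, Finset.sum_filter]
    refine Finset.sum_congr rfl fun y _ => ?_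
    simp only [g, Finset.mem_insert, not_or, hx, not_false_eq_true, and_self, true_and, ne_comm (a := y)]
    split_ifs with h1 h2 h2
    · rfl
    · exact absurd ⟨⟨h1.1.2, h1.2⟩, h1.1.1⟩ h2
    · exact absurd ⟨⟨h2.2, h2.1.1⟩, h2.1.2⟩ h1
    · rfl
  have anti : ∀ x y, g x y = - g y x := fun x y => by
    simp only [g]
    by_cases hc : (x ∉ b ∧ L.r x ∈ τ) ∧ (y ∉ b ∧ L.r y ∈ τ) ∧ x ≠ y
    swap
    · rw [if_neg hc, if_neg fun h => hc ⟨h.2.1, h.1, h.2.2.symm⟩, neg_zero]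
    rw [if_pos hc, if_pos ⟨hc.2.1, hc.1, hc.2.2.symm⟩, Finset.insert_comm x y]
    by_cases hz : z (insert y (insert x b)) = 0
    · simp [hz]
    have := (h _ hz).2.1.lt_or_lt (x := x) (y := y) (by simp) (by simp) hc.2.2
    have := ps_swap hc.1.1 hc.2.1.1 this
    linear_combination z (insert y (insert x b)) * this
  rw [e, Pi.zero_apply]
  have : ∑ x ∈ W, ∑ y ∈ W, g x y = - ∑ x ∈ W, ∑ y ∈ W, g x y := by
    conv_lhs => rw [Finset.sum_comm]
    rw [← Finset.sum_neg_distrib]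
    refine Finset.sum_congr rfl fun x _ => ?_
    rw [← Finset.sum_neg_distrib]
    exact Finset.sum_congr rfl fun y _ => anti _ _
  linarith

end Labelling

/-! ### Acyclicity of the chains with a given image. -/

namespace Labelling

open scoped Classical

variable {α β : Type w} [PartialOrder α] [PartialOrder β] (L : Labelling α β)

/-- The part at `m` of `z`, as a combination of simplices of the link of `m`. -/
noncomputable def link (m : α) (z : Finset α → ℤ) (c : Finset α) : ℤ := if m ∈ c then 0 else z (insert m c)

/-- The cone over `w` with apex `m`. -/
noncomputable def cone (m : α) (w : Finset α → ℤ) (c : Finset α) : ℤ := if m ∈ c then w (c.erase m) else 0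

/-- The part of `w` over `τ`. -/
noncomputable def part (τ : Finset β) (w : Finset α → ℤ) (c : Finset α) : ℤ :=
  if c.image L.r = τ then w c else 0

theorem cone_insert {m : α} (w : Finset α → ℤ) {c : Finset α} (h : m ∉ c) : cone m w (insert m c) = w c := by
  rw [cone, if_pos (Finset.mem_insert_self _ _), Finset.erase_insert h]

/-- The elements of `U` that lie below `m`. -/
noncomputable def below (U : Finset α) (m : α) : Finset α := U.filter (· < m)

variable {L}

theorem Supp.cone {U : Finset α} {m : α} (hm : m ∈ U) {τ τ' : Finset β} {w : Finset α → ℤ}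
    (h : L.Supp (below U m) τ w) (hτ : insert (L.r m) τ = τ') : L.Supp U τ' (cone m w) := fun c hc => by
  unfold Labelling.cone at hc
  split_ifs at hc with hmc
  · obtain ⟨h1, h2, h3⟩ := h _ hc
    rw [← Finset.insert_erase hmc]
    refine ⟨Finset.insert_subset hm (h1.trans (Finset.filter_subset _ _)), ?_, ?_⟩
    · rw [Chain, Finset.coe_insert]
      exact h2.insert fun b hb _ => .inr (Finset.mem_filter.1 (h1 hb)).2.le
    · rw [Finset.image_insert, h3, hτ]
  · exact absurd rfl hc

theorem Supp.link {U : Finset α} {m : α} (hmax : ∀ x ∈ U, ¬ m < x) {τ : Finset β} {z : Finset α → ℤ}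
    (h : L.Supp U τ z) (c : Finset α) (hc : link m z c ≠ 0) :
    m ∉ c ∧ c ⊆ below U m ∧ Chain c ∧ insert (L.r m) (c.image L.r) = τ := by
  unfold Labelling.link at hc
  split_ifs at hc with hmc
  · exact absurd rfl hc
  · obtain ⟨h1, h2, h3⟩ := h _ hc
    refine ⟨hmc, fun x hx => Finset.mem_filter.2 ⟨h1 (Finset.mem_insert_of_mem hx), ?_⟩,
      h2.mono (Finset.subset_insert _ _), by rw [← h3, Finset.image_insert]⟩
    exact (h2.lt_or_lt (Finset.mem_insert_of_mem hx) (Finset.mem_insert_self _ _)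
      fun e => hmc (e ▸ hx)).resolve_right (hmax x (h1 (Finset.mem_insert_of_mem hx)))

theorem Supp.part {U : Finset α} {m : α} (hmax : ∀ x ∈ U, ¬ m < x) {τ : Finset β} {z : Finset α → ℤ}
    (h : L.Supp U τ z) (τ' : Finset β) : L.Supp (below U m) τ' (L.part τ' (Labelling.link m z)) :=
  fun c hc => by
    unfold Labelling.part at hc
    split_ifs at hc with h'
    · obtain ⟨-, h1, h2, -⟩ := h.link hmax c hc
      exact ⟨h1, h2, h'⟩
    · exact absurd rfl hc

/-- As `m` is maximal it comes last in every chain through it, so adding it changes no position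
sign. The same reason gives `bdAt_cone`. -/
theorem bdAt_link {U W : Finset α} {m : α} (hmax : ∀ x ∈ U, ¬ m < x) {τ : Finset β} {z : Finset α → ℤ}
    (h : L.Supp U τ z) {c : Finset α} (hc : m ∉ c) :
    L.bdAt W τ (link m z) c = L.bdAt W τ z (insert m c) := by
  unfold bdAt
  rw [Finset.sum_filter, Finset.sum_filter]
  refine Finset.sum_congr rfl fun x _ => ?_
  by_cases hx : x = m
  · subst hx
    simp [link]
  by_cases hz : z (insert m (insert x c)) = 0
  · simp [link, hc, Finset.insert_comm x m, hz]
  · have hmx : ¬ m < x := hmax x ((h _ hz).1 (by simp))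
    simp [link, hc, Finset.insert_comm x m, hx, Ne.symm hx, ps_insert x hc, sgn, hmx]

theorem bdAt_cone {U W : Finset α} {m : α} {τ τ' : Finset β} {w : Finset α → ℤ}
    (h : L.Supp (below U m) τ w) (hτ : τ ⊆ τ') {c : Finset α} (hc : m ∉ c) :
    L.bdAt W τ' (cone m w) (insert m c) = L.bdAt W τ w c := by
  unfold bdAt
  rw [Finset.sum_filter, Finset.sum_filter]
  refine Finset.sum_congr rfl fun x _ => ?_
  by_cases hx : x = m
  · subst hx
    have : w (insert x c) = 0 := by
      by_contra h0
      exact lt_irrefl _ (Finset.mem_filter.1 ((h _ h0).1 (Finset.mem_insert_self _ _))).2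
    simp [this]
  have hmi : m ∉ insert x c := by simp [Ne.symm hx, hc]
  rw [Finset.insert_comm, cone_insert _ hmi, ps_insert x hc]
  by_cases hw : w (insert x c) = 0
  · simp [hw]
  obtain ⟨h1, h2, h3⟩ := h _ hw
  have hxm : x < m := (Finset.mem_filter.1 (h1 (Finset.mem_insert_self _ _))).2
  have hxτ : L.r x ∈ τ := by rw [← h3]; exact Finset.mem_image_of_mem _ (Finset.mem_insert_self _ _)
  simp [hx, hxτ, hτ hxτ, sgn, hxm.not_gt]

/-- Combinations of chains in `U` over `τ` that are cycles of augmentation zero. -/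
structure Cyc (L : Labelling α β) (W U : Finset α) (τ : Finset β) (z : Finset α → ℤ) : Prop where
  supp : L.Supp U τ z
  bd : L.bd W τ τ z = 0
  aug : L.aug W τ z = 0

theorem Cyc.sub {W U : Finset α} (hU : U ⊆ W) {τ : Finset β} {z y : Finset α → ℤ} (h : L.Cyc W U τ z)
    (hy : L.Supp U τ y) : L.Cyc W U τ (z - L.bd W τ τ y) where
  supp := h.supp.sub (hy.bd τ)
  bd := by rw [map_sub, h.bd, L.bd_bd hy, sub_zero]
  aug := by rw [map_sub, h.aug, L.aug_bd hy hU, sub_zero]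

/-- Boundaries of combinations of chains in `U` over `τ`. -/
def Bdry (L : Labelling α β) (W U : Finset α) (τ : Finset β) (z : Finset α → ℤ) : Prop :=
  ∃ y, L.Supp U τ y ∧ L.bd W τ τ y = z

theorem Bdry.of_sub {W U : Finset α} {τ : Finset β} {z y : Finset α → ℤ} (hy : L.Supp U τ y)
    (h : L.Bdry W U τ (z - L.bd W τ τ y)) : L.Bdry W U τ z := by
  obtain ⟨y', h1, h2⟩ := h
  exact ⟨y' + y, h1.add hy, by rw [map_add, h2, sub_add_cancel]⟩

theorem link_sub (m : α) (z z' : Finset α → ℤ) : link m (z - z') = link m z - link m z' := by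
  funext c
  simp only [link, Pi.sub_apply]
  split_ifs <;> simp

/-- Induction on `U`, by removing a maximal element `m` with label `v`. A chain over `τ` can pass
through `m` only if `v ∈ τ ⊆ L.vs m`. If `τ = L.vs m`, all of `z` is a multiple of the flag of `m`,
and the augmentation detects the multiple. Otherwise the link of `m` in `z` consists of chains
strictly below `m`, over `τ` or over `τ.erase v`; by induction these can be filled there, and
subtracting the boundary of the cone over a filling changes `z` until it no longer meets `m`. -/
theorem Cyc.bdry (L : Labelling α β) {W U : Finset α} (hU : U ⊆ W)
    (hlow : ∀ s ∈ U, ∀ t ≤ s, t ∈ U) {τ : Finset β} {z : Finset α → ℤ} (h : L.Cyc W U τ z) :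
    L.Bdry W U τ z := by
  induction hn : U.card using Nat.strong_induction_on generalizing U τ z with
  | _ n ih =>
  subst hn
  have hz0 : z = 0 → L.Bdry W U τ z := fun e => ⟨0, Supp.zero _ _, by rw [map_zero, e]⟩
  -- The induction can reach the empty image by erasing labels. Only the empty chain lies over it,
  -- and the augmentation is its coefficient.
  rcases τ.eq_empty_or_nonempty with rfl | hτ
  · have hs : ∀ c, z c ≠ 0 → c = ∅ := fun c hc => Finset.image_eq_empty.1 (h.supp c hc).2.2
    refine hz0 (funext fun c => ?_)
    by_contra hc
    have e := hs c hc
    subst e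
    have := h.aug
    change ∑ c ∈ W.powerset with c.card = (∅ : Finset β).card, L.sg c * z c = 0 at this
    rw [Finset.sum_eq_single ∅] at this
    · exact hc (by simpa [sg] using this)
    · intro c _ hc'
      by_contra h0
      exact hc' (hs c (right_ne_zero_of_mul h0))
    · simp
  rcases U.eq_empty_or_nonempty with rfl | hne
  · refine hz0 (funext fun c => ?_)
    by_contra hc
    obtain ⟨h1, -, h3⟩ := h.supp c hc
    rw [Finset.subset_empty.1 h1, Finset.image_empty] at h3
    exact hτ.ne_empty h3.symm
  obtain ⟨m, hm, hmax'⟩ := U.exists_maximal hne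
  have hmax : ∀ x ∈ U, ¬ m < x := fun x hx hlt => hlt.not_ge (hmax' hx hlt.le)
  clear hmax'
  set v := L.r m with hv
  have hbU : below U m ⊆ U := Finset.filter_subset _ _
  have hmb : m ∉ below U m := fun h => lt_irrefl _ (Finset.mem_filter.1 h).2
  have hbcard : (below U m).card < U.card :=
    Finset.card_lt_card (Finset.ssubset_iff_subset_ne.2 ⟨hbU, fun e => hmb (by rw [e]; exact hm)⟩)
  have hblow : ∀ s ∈ below U m, ∀ t ≤ s, t ∈ below U m := fun s hs t hts => by
    obtain ⟨h1, h2⟩ := Finset.mem_filter.1 hs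
    exact Finset.mem_filter.2 ⟨hlow s h1 t hts, hts.trans_lt h2⟩
  -- A cycle that avoids `m` lives in `U.erase m`, which is closed under faces because `m` is
  -- maximal.
  have final : ∀ z, L.Cyc W U τ z → link m z = 0 → L.Bdry W U τ z := by
    intro z hz hl
    have hs : L.Supp (U.erase m) τ z := fun c hc => by
      refine ⟨Finset.subset_erase.2 ⟨(hz.supp c hc).1, fun hmc => hc ?_⟩, (hz.supp c hc).2⟩
      have := congrFun hl (c.erase m)
      rwa [link, if_neg (Finset.notMem_erase _ _), Finset.insert_erase hmc] at this
    have he : ∀ s ∈ U.erase m, ∀ t ≤ s, t ∈ U.erase m := fun s hs t hts => by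
      obtain ⟨h1, h2⟩ := Finset.mem_erase.1 hs
      refine Finset.mem_erase.2 ⟨?_, hlow s h2 t hts⟩
      rintro rfl
      exact hmax s h2 (lt_of_le_of_ne hts (Ne.symm h1))
    obtain ⟨y, h1, h2⟩ := ih _ (Finset.card_erase_lt_of_mem hm) ((Finset.erase_subset _ _).trans hU) he
      (⟨hs, hz.bd, hz.aug⟩ : L.Cyc W (U.erase m) τ z) rfl
    exact ⟨y, h1.mono (Finset.erase_subset _ _), h2⟩
  by_cases hlz : link m z = 0
  · exact final z h hlz
  obtain ⟨hvτ, hτm⟩ : v ∈ τ ∧ τ ⊆ L.vs m := by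
    obtain ⟨c, hc⟩ := Function.ne_iff.1 hlz
    obtain ⟨h1, h2, -, h4⟩ := h.supp.link hmax c hc
    rw [← h4]
    refine ⟨Finset.mem_insert_self _ _, Finset.insert_subset (L.mem m) (L.image_subset fun x hx => ?_)⟩
    exact (Finset.mem_filter.1 (h2 hx)).2.le
  -- If `τ` is all of `L.vs m`, the top of a chain over `τ` contains `m`, hence equals `m`, and the
  -- chain is the flag of `m`.
  rcases hτm.eq_or_ssubset with hτe | hτm'
  · have hs : ∀ c, z c ≠ 0 → c = L.flag m := fun c hc => by
      obtain ⟨h1, h2, h3⟩ := h.supp c hc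
      have hcne : c.Nonempty := by rw [← Finset.image_nonempty (f := L.r), h3]; exact hτ
      obtain ⟨t, ht, htmax⟩ := h2.exists_max hcne
      have hmt : m ≤ t := L.le_iff.2 (by rw [← hτe, ← h3]; exact L.image_subset htmax)
      have : m = t := hmt.eq_of_not_lt (hmax t (h1 ht))
      subst this
      exact L.eq_flag h2 htmax (h3.trans hτe)
    refine hz0 (funext fun c => ?_)
    by_contra hc
    have e := hs c hc
    have := h.aug
    change ∑ c ∈ W.powerset with c.card = τ.card, L.sg c * z c = 0 at this
    rw [Finset.sum_eq_single c] at this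
    · rcases mul_eq_zero.1 this with h0 | h0
      · have := L.sg_mul_self c
        rw [h0] at this
        simp at this
      · exact hc h0
    · intro c' _ hc'
      by_contra h0
      exact hc' ((hs c' (right_ne_zero_of_mul h0)).trans e.symm)
    · intro h'
      refine absurd (Finset.mem_filter.2 ⟨Finset.mem_powerset.2 ((h.supp c hc).1.trans hU), ?_⟩) h'
      rw [e, L.card_flag, hτe]
  set τ' := τ.erase v with hτ'
  have hiτ' : insert v τ' = τ := Finset.insert_erase hvτ
  have hvτ' : v ∉ τ' := Finset.notMem_erase _ _
  have hττ' : τ ≠ τ' := fun e => hvτ' (e ▸ hvτ)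
  have image_insert : ∀ c : Finset α, (c.image L.r = τ ∨ c.image L.r = τ') → (insert m c).image L.r = τ := by
    rintro c (e | e)
    · rw [Finset.image_insert, e, Finset.insert_eq_of_mem hvτ]
    · rw [Finset.image_insert, e, hiτ']
  -- Over `τ` the label `v` occurs again below `m`; over `τ'` the vertex `m` is the only one with
  -- label `v`.
  have split : ∀ z, L.Supp U τ z → link m z = L.part τ (link m z) + L.part τ' (link m z) := by
    intro z hz
    funext c
    by_cases hc : link m z c = 0
    · simp [part, hc]
    obtain ⟨-, -, -, h4⟩ := hz.link hmax c hc
    rw [← hv] at h4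
    simp only [Pi.add_apply, part]
    by_cases hvc : v ∈ c.image L.r
    · rw [Finset.insert_eq_of_mem hvc] at h4
      rw [h4, if_pos rfl, if_neg hττ', add_zero]
    · have : c.image L.r = τ' := by rw [hτ', ← h4, Finset.erase_insert hvc]
      rw [this, if_pos rfl, if_neg hττ'.symm, zero_add]
  have not_mem : ∀ {τ₀ : Finset β} {w : Finset α → ℤ}, L.Supp (below U m) τ₀ w → ∀ c, m ∈ c → w c = 0 :=
    fun hw c hmc => by
      by_contra h0
      exact hmb ((hw c h0).1 hmc)
  have bdAt_of_mem : ∀ {τ₀ τ₁ : Finset β} {w : Finset α → ℤ}, L.Supp (below U m) τ₀ w → ∀ c, m ∈ c →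
      L.bdAt W τ₁ w c = 0 := fun hw c hmc =>
    L.bdAt_eq_zero fun x _ _ _ => not_mem hw _ (Finset.mem_insert_of_mem hmc)
  have link_bd : ∀ {τ₀ : Finset β} {w : Finset α → ℤ}, τ₀ = τ ∨ τ₀ = τ' → L.Supp (below U m) τ₀ w →
      ∀ c : Finset α, (c.image L.r = τ ∨ c.image L.r = τ') →
        link m (L.bd W τ τ (cone m w)) c = L.bdAt W τ₀ w c := by
    intro τ₀ w h0 hw c hc
    by_cases hmc : m ∈ c
    · rw [link, if_pos hmc, bdAt_of_mem hw c hmc]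
    · rw [link, if_neg hmc, bd_apply, if_pos (image_insert c hc), bdAt_cone hw _ hmc]
      rcases h0 with rfl | rfl
      · exact subset_rfl
      · exact Finset.erase_subset _ _
  have bdAt_link_zero : ∀ z, L.Cyc W U τ z → ∀ c : Finset α, (c.image L.r = τ ∨ c.image L.r = τ') →
      L.bdAt W τ (link m z) c = 0 := by
    intro z hz c hc
    by_cases hmc : m ∈ c
    · exact L.bdAt_eq_zero fun x _ _ _ => if_pos (Finset.mem_insert_of_mem hmc)
    · have := congrFun hz.bd (insert m c)
      rwa [bd_apply, if_pos (image_insert c hc), ← bdAt_link hmax hz.supp hmc] at this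
  have bdAt_erase : ∀ {w : Finset α → ℤ}, L.Supp (below U m) τ' w → ∀ c,
      L.bdAt W τ w c = L.bdAt W τ' w c := by
    intro w hw c
    unfold bdAt
    rw [Finset.sum_filter, Finset.sum_filter]
    refine Finset.sum_congr rfl fun x _ => ?_
    by_cases h0 : w (insert x c) = 0
    · simp [h0]
    · have : L.r x ∈ τ' := by
        rw [← (hw _ h0).2.2]; exact Finset.mem_image_of_mem _ (Finset.mem_insert_self _ _)
      simp [this, Finset.mem_of_mem_erase this]
  -- Boundaries lead from images `τ` to `τ'` but never back, since faces do not gain labels. So the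
  -- part of the link over `τ` is a cycle on its own, and its boundary over `τ'` is opposite to that
  -- of the other part.
  have bdAt_over : ∀ {w : Finset α → ℤ}, L.Supp (below U m) τ' w → ∀ (τ₁ : Finset β) (c : Finset α),
      c.image L.r = τ → L.bdAt W τ₁ w c = 0 := by
    intro w hw τ₁ c hc
    refine L.bdAt_eq_zero fun x _ _ _ => ?_
    by_contra h0
    refine hvτ' ?_
    rw [← (hw _ h0).2.2, Finset.image_insert, hc]
    exact Finset.mem_insert_of_mem hvτ
  have bdAt_split : ∀ z, L.Cyc W U τ z → ∀ c : Finset α, (c.image L.r = τ ∨ c.image L.r = τ') →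
      L.bdAt W τ (L.part τ (link m z)) c + L.bdAt W τ' (L.part τ' (link m z)) c = 0 := by
    intro z hz c hc
    rw [← bdAt_erase (hz.supp.part hmax τ'), ← bdAt_add, ← split z hz.supp, bdAt_link_zero z hz c hc]
  have bd_part : ∀ z, L.Cyc W U τ z → L.bd W τ τ (L.part τ (link m z)) = 0 := by
    intro z hz
    funext c
    rw [bd_apply]
    split_ifs with hc
    · have := bdAt_split z hz c (.inl hc)
      rwa [bdAt_over (hz.supp.part hmax τ') _ c hc, add_zero] at this
    · rfl
  have bd_part' : ∀ z, L.Cyc W U τ z → L.bd W τ τ' (L.part τ (link m z)) =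
      - L.bd W τ' τ' (L.part τ' (link m z)) := by
    intro z hz
    funext c
    rw [Pi.neg_apply, bd_apply, bd_apply]
    split_ifs with hc
    · have := bdAt_split z hz c (.inr hc)
      linarith
    · simp
  set κ : ℤ := ∏ u ∈ τ, sgn (u < v) with hκ
  have hκκ : κ * κ = 1 := prod_sgn_mul_self _ _
  have hκ0 : κ ≠ 0 := fun h => by rw [h] at hκκ; simp at hκκ
  have hbW : below U m ⊆ W := hbU.trans hU
  -- By `aug_bd_erase` this augmentation is, up to sign, that of the boundary over `τ'`, which is
  -- also a boundary inside the fibre over `τ'`.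
  have aug_part : ∀ z, L.Cyc W U τ z → L.aug W τ (L.part τ (link m z)) = 0 := by
    intro z hz
    have h1 := L.aug_bd_erase (hz.supp.part hmax τ) hbW hvτ
    rw [← hτ', bd_part' z hz, map_neg, L.aug_bd (hz.supp.part hmax τ') hbW, neg_zero] at h1
    exact (mul_eq_zero.1 h1.symm).resolve_left hκ0
  -- Once the part over `τ` is gone, the part over `τ'` is a cycle. If its augmentation vanishes
  -- too, coning off a filling removes the whole link.
  have step3 : ∀ z, L.Cyc W U τ z → L.part τ (link m z) = 0 → L.aug W τ' (L.part τ' (link m z)) = 0 →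
      L.Bdry W U τ z := by
    intro z hz h1 h2
    have h3 : L.bd W τ' τ' (L.part τ' (link m z)) = 0 := by
      have := bd_part' z hz
      rwa [h1, map_zero, zero_eq_neg] at this
    obtain ⟨y, hy, hy'⟩ := ih _ hbcard hbW hblow ⟨hz.supp.part hmax τ', h3, h2⟩ rfl
    have hcone := hy.cone hm hiτ'
    refine Bdry.of_sub hcone (final _ (hz.sub hU hcone) ?_)
    rw [split _ (hz.sub hU hcone).supp, link_sub]
    funext c
    simp only [Pi.add_apply, part, Pi.sub_apply, Pi.zero_apply]
    by_cases hc : c.image L.r = τ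
    · have := congrFun h1 c
      rw [part, if_pos hc] at this
      rw [if_pos hc, if_neg (fun e => hττ' (hc.symm.trans e)), this, link_bd (.inr rfl) hy c (.inl hc),
        bdAt_over hy _ c hc]
      simp
    · by_cases hc' : c.image L.r = τ'
      · have := congrFun hy' c
        rw [bd_apply, if_pos hc', part, if_pos hc'] at this
        rw [if_neg hc, if_pos hc', link_bd (.inr rfl) hy c (.inr hc'), this]
        simp
      · rw [if_neg hc, if_neg hc', add_zero]
  -- The augmentation `k` over `τ'` may still be nonzero. As `τ` is a proper part of `L.vs m`, there
  -- is a proper face `s` of `m` with vertex set `τ`. The cone over a multiple of its flag corrects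
  -- `k`, and the part over `τ` stays zero because the flag has no vertex to spare.
  have step2 : ∀ z, L.Cyc W U τ z → L.part τ (link m z) = 0 → L.Bdry W U τ z := by
    intro z hz h1
    obtain ⟨s, hs⟩ := L.face m τ hτm hτ
    have hsm : s < m := lt_of_le_of_ne (L.le_iff.2 (hs ▸ hτm)) fun e => hτm'.ne (by rw [← hs, e])
    have hfU : L.flag s ⊆ below U m := fun x hx =>
      Finset.mem_filter.2 ⟨hlow m hm x ((L.flag_le hx).trans hsm.le), (L.flag_le hx).trans_lt hsm⟩
    have hi := (L.image_flag s).trans hs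
    have hsupp : L.Supp (below U m) τ (Pi.single (L.flag s) 1) := by
      rw [← hi]; exact Supp.single hfU (L.flag_chain s)
    set k := L.aug W τ' (L.part τ' (link m z)) with hk
    -- The boundary over `τ'` multiplies the augmentation by `κ`, and the flag has augmentation
    -- `L.sg (L.flag s)`. Both are signs, so this multiple contributes exactly `k`.
    set y := (κ * k * L.sg (L.flag s)) • (Pi.single (L.flag s) 1 : Finset α → ℤ) with hy
    have hysupp : L.Supp (below U m) τ y := hsupp.smul _
    have hcone := hysupp.cone hm (Finset.insert_eq_of_mem hvτ)
    have h0 : ∀ c : Finset α, c.image L.r = τ → L.bdAt W τ y c = 0 := by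
      intro c hc
      refine L.bdAt_eq_zero fun x _ hxc _ => ?_
      rw [hy, Pi.smul_apply, Pi.single_eq_of_ne, smul_zero]
      intro e
      have e1 := L.card_flag s
      rw [← e, hs, Finset.card_insert_of_notMem hxc, ← hc] at e1
      have := Finset.card_image_le (s := c) (f := L.r)
      omega
    refine Bdry.of_sub hcone (step3 _ (hz.sub hU hcone) ?_ ?_)
    · funext c
      rw [link_sub, part]
      split_ifs with hc
      · have := congrFun h1 c
        rw [part, if_pos hc] at this
        rw [Pi.sub_apply, this, link_bd (.inl rfl) hysupp c (.inl hc), h0 c hc]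
        simp
      · rfl
    · have e : L.part τ' (link m (z - L.bd W τ τ (cone m y))) =
          L.part τ' (link m z) - L.bd W τ τ' y := by
        funext c
        rw [link_sub, Pi.sub_apply, bd_apply, part, part]
        split_ifs with hc
        · rw [Pi.sub_apply, link_bd (.inl rfl) hysupp c (.inr hc)]
        · simp
      rw [e, map_sub, ← hk, hτ', L.aug_bd_erase hysupp hbW hvτ, ← hκ, hy, map_smul,
        L.aug_single (hfU.trans hbW), if_pos (by rw [L.card_flag, hs]), smul_eq_mul]
      have := L.sg_mul_self (L.flag s)
      linear_combination (-k * κ * κ) * this - k * hκκ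
  -- The part of the link over `τ` has to be filled first: coning off its filling may disturb the
  -- part over `τ'`, whereas the later steps keep the part over `τ` zero.
  obtain ⟨y, hy, hy'⟩ := ih _ hbcard hbW hblow
    ⟨h.supp.part hmax τ, bd_part z h, aug_part z h⟩ rfl
  have hcone := hy.cone hm (Finset.insert_eq_of_mem hvτ)
  refine Bdry.of_sub hcone (step2 _ (h.sub hU hcone) ?_)
  funext c
  rw [link_sub, part]
  split_ifs with hc
  · have := congrFun hy' c
    rw [bd_apply, if_pos hc, part, if_pos hc] at this
    rw [Pi.sub_apply, link_bd (.inl rfl) hy c (.inl hc), this, sub_self]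
    rfl
  · rfl

end Labelling

/-! ### A contracting homotopy of the fibres by acyclic carriers. -/

namespace Labelling

open scoped Classical

variable {α β : Type w} [PartialOrder α] [PartialOrder β] (L : Labelling α β)

theorem finite_le (L : Labelling α β) (s : α) : {t | t ≤ s}.Finite :=
  ((L.vs s).powerset.finite_toSet.preimage L.vs_injective.injOn).subset fun _ ht =>
    Finset.mem_coe.2 (Finset.mem_powerset.2 (L.le_iff.1 ht))

/-- The faces of `s`. -/
noncomputable def down (s : α) : Finset α := (L.finite_le s).toFinset

theorem mem_down {s t : α} : t ∈ L.down s ↔ t ≤ s := (L.finite_le s).mem_toFinset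

theorem down_mono {s t : α} (h : s ≤ t) : L.down s ⊆ L.down t := fun _ hx =>
  L.mem_down.2 ((L.mem_down.1 hx).trans h)

/-- The chain `flag s` in terms of the vertex set of `s`. -/
noncomputable def flagOf (τ : Finset β) : Finset α := if h : ∃ s, L.vs s = τ then L.flag h.choose else ∅

theorem flagOf_vs (s : α) : L.flagOf (L.vs s) = L.flag s := by
  have h : ∃ s', L.vs s' = L.vs s := ⟨s, rfl⟩
  rw [flagOf, dif_pos h, L.vs_injective h.choose_spec]

/-- The projection of the simplex `a` to the augmentation, embedded as the distinguished simplex. -/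
noncomputable def proj (a : Finset α) : Finset α → ℤ :=
  (L.sg (L.flagOf (a.image L.r)) * if a.card = (a.image L.r).card then L.sg a else 0) •
    Pi.single (L.flagOf (a.image L.r)) 1

/-- `y` is a possible value at `a` of a contracting homotopy whose values at the faces `a.erase x` are
given by `g`. -/
def Good (a : Finset α) (g : α → Finset α → ℤ) (y : Finset α → ℤ) : Prop :=
  ∀ m ∈ a, (∀ x ∈ a, x ≤ m) → L.Supp (L.down m) (a.image L.r) y ∧ (∀ b, y b ≠ 0 → b.card = a.card + 1) ∧
    L.bd (L.down m) (a.image L.r) (a.image L.r) y = Pi.single a 1 - L.proj a -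
      ∑ x ∈ a with (a.erase x).image L.r = a.image L.r, ps (a.erase x) x • g x

/-- A contracting homotopy of the simplices with a given image, natural with respect to faces. -/
noncomputable def htpy (a : Finset α) : Finset α → ℤ :=
  if ex : ∃ y, L.Good a (fun x => if _h : x ∈ a then htpy (a.erase x) else 0) y then ex.choose else 0
termination_by a.card
decreasing_by all_goals exact Finset.card_erase_lt_of_mem ‹_›

theorem aug_eq_zero {W : Finset α} {τ : Finset β} {z : Finset α → ℤ}
    (h : ∀ b, z b ≠ 0 → τ.card < b.card) : L.aug W τ z = 0 :=
  Finset.sum_eq_zero fun c hc => by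
    by_contra h0
    exact (h c (right_ne_zero_of_mul h0)).ne' (Finset.mem_filter.1 hc).2

/-- The squared boundary again, with an arbitrary function `g` of the double faces as coefficients.
If a double face has the full image, so has each intermediate face. -/
theorem erase_erase_sum {a : Finset α} (hc : Chain a) (g : Finset α → Finset α → ℤ) :
    ∑ x ∈ a with (a.erase x).image L.r = a.image L.r, ps (a.erase x) x •
      ∑ y ∈ a.erase x with ((a.erase x).erase y).image L.r = (a.erase x).image L.r,
        ps ((a.erase x).erase y) y • g ((a.erase x).erase y) = 0 := by
  let f : α → α → Finset α → ℤ := fun x y =>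
    if x ≠ y ∧ ((a.erase x).erase y).image L.r = a.image L.r then
      (ps (a.erase x) x * ps ((a.erase x).erase y) y) • g ((a.erase x).erase y) else 0
  have e : ∀ x ∈ a, (if (a.erase x).image L.r = a.image L.r then ps (a.erase x) x •
      ∑ y ∈ a.erase x with ((a.erase x).erase y).image L.r = (a.erase x).image L.r,
        ps ((a.erase x).erase y) y • g ((a.erase x).erase y) else 0) = ∑ y ∈ a, f x y := by
    intro x hx
    by_cases h : (a.erase x).image L.r = a.image L.r
    · rw [if_pos h, Finset.smul_sum, Finset.sum_filter, h, ← Finset.add_sum_erase a _ hx]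
      have : f x x = 0 := if_neg fun h => h.1 rfl
      rw [this, zero_add]
      refine Finset.sum_congr rfl fun y hy => ?_
      simp only [f, (Finset.ne_of_mem_erase hy).symm, ne_eq, not_false_eq_true, true_and, smul_smul]
    · rw [if_neg h]
      refine (Finset.sum_eq_zero fun y _ => if_neg fun h' => h ?_).symm
      refine (Finset.image_subset_image (Finset.erase_subset _ _)).antisymm ?_
      rw [← h'.2]
      exact Finset.image_subset_image (Finset.erase_subset _ _)
  have anti : ∀ x ∈ a, ∀ y ∈ a, f x y = - f y x := by
    intro x hx y hy
    simp only [f]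
    by_cases h : x ≠ y ∧ ((a.erase x).erase y).image L.r = a.image L.r
    swap
    · rw [if_neg h, if_neg, neg_zero]
      rw [Finset.erase_right_comm]
      exact fun h' => h ⟨h'.1.symm, h'.2⟩
    rw [if_pos h, if_pos ⟨h.1.symm, by rw [Finset.erase_right_comm]; exact h.2⟩, ← neg_smul,
      Finset.erase_right_comm (s := a) (a := y) (b := x)]
    congr 1
    have h1 : x ∉ (a.erase x).erase y := by simp
    have h2 : y ∉ (a.erase x).erase y := by simp
    have e1 : insert y ((a.erase x).erase y) = a.erase x :=
      Finset.insert_erase (Finset.mem_erase.2 ⟨h.1.symm, hy⟩)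
    have e2 : insert x ((a.erase x).erase y) = a.erase y := by
      rw [Finset.erase_right_comm]; exact Finset.insert_erase (Finset.mem_erase.2 ⟨h.1, hx⟩)
    have := ps_swap h1 h2 (hc.lt_or_lt hx hy h.1)
    rw [e1, e2] at this
    linear_combination this
  rw [Finset.sum_filter, Finset.sum_congr rfl e]
  have h1 : ∑ x ∈ a, ∑ y ∈ a, f x y = - ∑ x ∈ a, ∑ y ∈ a, f x y := by
    conv_lhs => rw [Finset.sum_comm]
    rw [← Finset.sum_neg_distrib]
    refine Finset.sum_congr rfl fun x hx => ?_
    rw [← Finset.sum_neg_distrib]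
    exact Finset.sum_congr rfl fun y hy => anti y hy x hx
  funext b
  have := congrFun h1 b
  rw [Pi.neg_apply] at this
  rw [Pi.zero_apply]
  linarith

/-- The prescribed boundary `a - proj a - h (∂ a)` is a cycle by the equations for the faces of `a`.
It has augmentation zero, because `proj a` has the augmentation of `a` and the values on the faces
have too many vertices to be counted. So `Cyc.bdry`, applied to the faces of the top of `a`, gives a
filling inside that simplex. -/
theorem exists_good {a : Finset α} (hc : Chain a) (hne : a.Nonempty) (g : Finset α → Finset α → ℤ)
    (hg : ∀ x ∈ a, (a.erase x).Nonempty →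
      L.Good (a.erase x) (fun y => g ((a.erase x).erase y)) (g (a.erase x))) :
    ∃ y, L.Good a (fun x => g (a.erase x)) y := by
  obtain ⟨m, hm, hmax⟩ := hc.exists_max hne
  set τ := a.image L.r with hτ
  set W := L.down m with hW
  have haW : a ⊆ W := fun x hx => L.mem_down.2 (hmax x hx)
  obtain ⟨s, hs⟩ := L.face m τ (L.image_subset hmax) (hne.image _)
  have hsm : s ≤ m := L.le_iff.2 (hs ▸ L.image_subset hmax)
  have hfl : L.flagOf τ = L.flag s := by rw [← hs, flagOf_vs]
  have hfW : L.flag s ⊆ W := fun x hx => L.mem_down.2 ((L.flag_le hx).trans hsm)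
  have hfi : (L.flag s).image L.r = τ := (L.image_flag s).trans hs
  have hfc : (L.flag s).card = τ.card := (L.card_flag s).trans (by rw [hs])
  have hfs : L.Supp W τ (Pi.single (L.flag s) 1) := by
    rw [← hfi]; exact Supp.single hfW (L.flag_chain s)
  have has : L.Supp W τ (Pi.single a 1) := Supp.single haW hc
  -- The flag has as many vertices as `τ`, so none of its faces lies over `τ`.
  have hbdf : L.bd W τ τ (Pi.single (L.flag s) 1) = 0 := by
    rw [← hfi, L.bd_single hfW]
    refine Finset.sum_eq_zero fun x hx => ?_
    obtain ⟨h1, h2⟩ := Finset.mem_filter.1 hx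
    have h3 := Finset.card_image_le (s := (L.flag s).erase x) (f := L.r)
    have h4 := Finset.card_erase_add_one h1
    rw [h2, hfi] at h3
    omega
  have face : ∀ x ∈ a.filter (fun x => (a.erase x).image L.r = τ),
      L.Supp W τ (g (a.erase x)) ∧ (∀ b, g (a.erase x) b ≠ 0 → b.card = a.card) ∧
      L.bd W τ τ (g (a.erase x)) = Pi.single (a.erase x) 1 - L.proj (a.erase x) -
      ∑ y ∈ a.erase x with ((a.erase x).erase y).image L.r = (a.erase x).image L.r,
        ps ((a.erase x).erase y) y • g ((a.erase x).erase y) := by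
    intro x hx
    obtain ⟨h1, h2⟩ := Finset.mem_filter.1 hx
    have h3 : (a.erase x).Nonempty := by
      rw [← Finset.image_nonempty (f := L.r), h2]; exact hne.image _
    obtain ⟨m', hm', hmax'⟩ := (hc.mono (Finset.erase_subset x a)).exists_max h3
    have hmm : L.down m' ⊆ W := L.down_mono (hmax m' (Finset.mem_of_mem_erase hm'))
    obtain ⟨h4, h5, h6⟩ := hg x h1 h3 m' hm' hmax'
    rw [h2] at h4
    refine ⟨h4.mono hmm, fun b hb => ?_, ?_⟩
    · rw [h5 b hb, Finset.card_erase_add_one h1]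
    · rw [← L.bd_mono hmm τ h4, ← h6, h2]
  -- In this form the projection is linear, so that its sum over the faces of `a` is governed by
  -- `aug_bd`.
  have hproj : ∀ b : Finset α, b ⊆ W → b.image L.r = τ →
      L.proj b = (L.sg (L.flag s) * L.aug W τ (Pi.single b 1)) • Pi.single (L.flag s) 1 := by
    intro b hb h
    rw [proj, h, hfl, L.aug_single hb]
  set z : Finset α → ℤ := Pi.single a 1 - L.proj a -
      ∑ x ∈ a with (a.erase x).image L.r = τ, ps (a.erase x) x • g (a.erase x) with hz
  have hcyc : L.Cyc W W τ z := by
    refine ⟨(has.sub ?_).sub (Supp.sum fun x hx => (face x hx).1.smul _), ?_, ?_⟩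
    · rw [hproj a haW rfl]; exact hfs.smul _
    · have e1 : ∑ x ∈ a with (a.erase x).image L.r = τ, ps (a.erase x) x • L.proj (a.erase x) = 0 := by
        have : ∀ x ∈ a.filter (fun x => (a.erase x).image L.r = τ),
            ps (a.erase x) x • L.proj (a.erase x) =
            (L.sg (L.flag s) * L.aug W τ (ps (a.erase x) x • Pi.single (a.erase x) 1)) •
              Pi.single (L.flag s) 1 := fun x hx => by
          rw [hproj _ ((Finset.erase_subset _ _).trans haW) (Finset.mem_filter.1 hx).2, smul_smul,
            map_smul, smul_eq_mul]
          congr 1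
          ring
        rw [Finset.sum_congr rfl this, ← Finset.sum_smul, ← Finset.mul_sum, ← map_sum, hτ,
          ← L.bd_single haW, L.aug_bd has subset_rfl, mul_zero, zero_smul]
      rw [hz, map_sub, map_sub, hproj a haW rfl, map_smul, hbdf, smul_zero, sub_zero, map_sum]
      have : ∀ x ∈ a.filter (fun x => (a.erase x).image L.r = τ),
          L.bd W τ τ (ps (a.erase x) x • g (a.erase x)) =
          ps (a.erase x) x • (Pi.single (a.erase x) 1 : Finset α → ℤ) -
            ps (a.erase x) x • L.proj (a.erase x) -
            ps (a.erase x) x • ∑ y ∈ a.erase x with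
              ((a.erase x).erase y).image L.r = (a.erase x).image L.r,
              ps ((a.erase x).erase y) y • g ((a.erase x).erase y) := fun x hx => by
        rw [map_smul, (face x hx).2.2, smul_sub, smul_sub]
      rw [Finset.sum_congr rfl this, Finset.sum_sub_distrib, Finset.sum_sub_distrib, e1,
        L.erase_erase_sum hc, hτ, L.bd_single haW]
      simp
    · have h0 : ∀ x ∈ a.filter (fun x => (a.erase x).image L.r = τ),
          L.aug W τ (ps (a.erase x) x • g (a.erase x)) = 0 := fun x hx => by
        rw [map_smul, L.aug_eq_zero, smul_zero]
        intro b hb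
        rw [(face x hx).2.1 b hb]
        obtain ⟨h1, h2⟩ := Finset.mem_filter.1 hx
        have h3 := Finset.card_image_le (s := a.erase x) (f := L.r)
        have h4 := Finset.card_erase_add_one h1
        rw [h2] at h3
        omega
      rw [hz, map_sub, map_sub, map_sum, Finset.sum_eq_zero h0, hproj a haW rfl, map_smul,
        L.aug_single hfW, if_pos hfc]
      have := L.sg_mul_self (L.flag s)
      rw [smul_eq_mul]
      linear_combination (-L.aug W τ (Pi.single a 1)) * this
  obtain ⟨y, hy1, hy2⟩ := Cyc.bdry L subset_rfl
    (fun s hs t hts => L.mem_down.2 (hts.trans (L.mem_down.1 hs))) hcyc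
  -- The filling is truncated to chains with one vertex more than `a`. This does no harm, since `z`
  -- is concentrated on chains with as many vertices as `a`.
  refine ⟨fun b => if b.card = a.card + 1 then y b else 0, fun m' hm' hmax' => ?_⟩
  obtain rfl : m' = m := le_antisymm (hmax m' hm') (hmax' m hm)
  refine ⟨fun b hb => hy1 b fun h => hb (by simp [h]), fun b hb => ?_, ?_⟩
  · by_contra h
    exact hb (if_neg h)
  · funext c
    have hyc := congrFun hy2 c
    rw [bd_apply] at hyc ⊢
    rw [← hτ]
    change _ = z c
    by_cases hcc : c.card = a.card
    · rw [← hyc]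
      congr 1
      exact L.bdAt_congr fun x _ hx _ => if_pos (by rw [Finset.card_insert_of_notMem hx, hcc])
    · rw [L.bdAt_eq_zero fun x _ hx _ => if_neg (by rw [Finset.card_insert_of_notMem hx]; omega), ite_self]
      symm
      by_contra h0
      rw [hz, Pi.sub_apply, Pi.sub_apply, Pi.single_eq_of_ne (by rintro rfl; exact hcc rfl), zero_sub,
        Finset.sum_apply, Finset.sum_eq_zero, sub_zero, proj, ← hτ, hfl] at h0
      · by_cases h1 : a.card = τ.card
        · refine h0 ?_
          rw [Pi.smul_apply, Pi.single_eq_of_ne, smul_zero, neg_zero]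
          rintro rfl
          exact hcc (hfc.trans h1.symm)
        · simp [h1] at h0
      · intro x hx
        rw [Pi.smul_apply]
        by_contra h1
        exact hcc ((face x hx).2.1 c fun h => h1 (by rw [h, smul_zero]))

/-- The recursion can always be continued, by `exists_good`; the default value `0` of `htpy` is
never used on nonempty chains. -/
theorem htpy_good {a : Finset α} (hc : Chain a) (hne : a.Nonempty) :
    L.Good a (fun x => L.htpy (a.erase x)) (L.htpy a) := by
  induction hn : a.card using Nat.strong_induction_on generalizing a with
  | _ n ih =>
  subst hn
  have aux : ∀ y, L.Good a (fun x => if _h : x ∈ a then L.htpy (a.erase x) else 0) y ↔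
      L.Good a (fun x => L.htpy (a.erase x)) y := by
    intro y
    unfold Good
    simp only [dite_eq_ite]
    have : ∑ x ∈ a with (a.erase x).image L.r = a.image L.r,
        ps (a.erase x) x • (if x ∈ a then L.htpy (a.erase x) else 0) =
        ∑ x ∈ a with (a.erase x).image L.r = a.image L.r, ps (a.erase x) x • L.htpy (a.erase x) :=
      Finset.sum_congr rfl fun x hx => by rw [if_pos (Finset.mem_of_mem_filter _ hx)]
    rw [this]
  have ex := L.exists_good hc hne L.htpy fun x hx hx' =>
    ih _ (Finset.card_erase_lt_of_mem hx) (hc.mono (Finset.erase_subset _ _)) hx' rfl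
  obtain ⟨y, hy⟩ := ex
  have ex' : ∃ y, L.Good a (fun x => if _h : x ∈ a then L.htpy (a.erase x) else 0) y := ⟨y, (aux y).2 hy⟩
  have e : L.htpy a = ex'.choose := by
    conv_lhs => rw [htpy]
    rw [dif_pos]
  rw [e]
  exact (aux _).1 ex'.choose_spec

end Labelling

/-! ### Translation to the incidence numbers of the algebraic subdivision. -/

namespace Labelling

open scoped Classical

variable {α β : Type w} [PartialOrder α] [PartialOrder β] (L : Labelling α β)

/-- The sign by which the incidence numbers of the algebraic subdivision differ from those of
simplicial chains. -/
noncomputable def twist (a : Finset α) : ℤ := L.sg a * ∏ y ∈ a, ∏ u ∈ a.image L.r, sgn (u < L.r y)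

theorem twist_mul_self (a : Finset α) : L.twist a * L.twist a = 1 := by
  unfold twist
  have h1 : (∏ y ∈ a, ∏ u ∈ a.image L.r, sgn (u < L.r y)) *
      ∏ y ∈ a, ∏ u ∈ a.image L.r, sgn (u < L.r y) = 1 := by
    rw [← Finset.prod_mul_distrib]; exact Finset.prod_eq_one fun _ _ => prod_sgn_mul_self _ _
  linear_combination (∏ y ∈ a, ∏ u ∈ a.image L.r, sgn (u < L.r y)) ^ 2 * L.sg_mul_self a + h1

theorem sign_eq (a : Finset α) (x : α) :
    Sd.sign L.r a x = L.lx a x * ∏ u ∈ a.image L.r, sgn (u < L.r x) := by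
  unfold Sd.sign Sd.place lx
  rw [prod_sgn, prod_sgn, pow_add]
  congr!

/-- The two sign conventions differ by a change of basis. The factor `sg` exchanges chain position
for lexicographical position, and the product over pairs of vertices and labels accounts for the
position of the label in the image. -/
theorem incidence_erase {a : Finset α} (hc : Chain a) {x : α} (hx : x ∈ a)
    (h : (a.erase x).image L.r = a.image L.r) :
    Sd.incidence L.r a (a.erase x) = L.twist a * L.twist (a.erase x) * ps (a.erase x) x := by
  rw [Sd.incidence_erase L.r hx (h ▸ Finset.mem_image_of_mem _ hx), sign_eq]
  have h1 := L.ps_mul_sg (Finset.notMem_erase x a) (by rwa [Finset.insert_erase hx])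
  rw [Finset.insert_erase hx] at h1
  have h2 : L.twist a = L.sg a * ((∏ u ∈ a.image L.r, sgn (u < L.r x)) *
      ∏ y ∈ a.erase x, ∏ u ∈ a.image L.r, sgn (u < L.r y)) := by
    rw [twist, Finset.mul_prod_erase a (fun y => ∏ u ∈ a.image L.r, sgn (u < L.r y)) hx]
  have h3 : L.twist (a.erase x) = L.sg (a.erase x) *
      ∏ y ∈ a.erase x, ∏ u ∈ a.image L.r, sgn (u < L.r y) := by rw [twist, h]
  have h4 : (∏ y ∈ a.erase x, ∏ u ∈ a.image L.r, sgn (u < L.r y)) *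
      ∏ y ∈ a.erase x, ∏ u ∈ a.image L.r, sgn (u < L.r y) = 1 := by
    rw [← Finset.prod_mul_distrib]; exact Finset.prod_eq_one fun _ _ => prod_sgn_mul_self _ _
  rw [h2, h3]
  set K := ∏ y ∈ a.erase x, ∏ u ∈ a.image L.r, sgn (u < L.r y)
  set J := ∏ u ∈ a.image L.r, sgn (u < L.r x)
  linear_combination (-L.sg a * J * K * K) * h1 - L.lx a x * J * K * K * L.sg_mul_self a
    - L.lx a x * J * h4

/-- On simplices mapped isomorphically to their image, `twist` is `sg` times a sign that depends
only on the image. Hence after twisting the augmentation and the projection have coefficients `1`.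
-/
theorem twist_of_card_eq {a : Finset α} (h : a.card = (a.image L.r).card) :
    L.twist a = L.sg a * ∏ v ∈ a.image L.r, ∏ u ∈ a.image L.r, sgn (u < v) := by
  have inj : Set.InjOn L.r a := by rw [← Finset.card_image_iff, h]
  rw [twist, Finset.prod_image inj]

/-- The contracting homotopy in terms of the incidence numbers of the algebraic subdivision. -/
noncomputable def homotopy (a b : Finset α) : ℤ := L.twist a * L.twist b * L.htpy a b

theorem homotopy_ne_zero {a b : Finset α} (hc : Chain a) (hne : a.Nonempty) (h : L.homotopy a b ≠ 0) :
    Chain b ∧ b.image L.r = a.image L.r ∧ b.card = a.card + 1 ∧ ∀ s, (∀ x ∈ a, x ≤ s) → ∀ x ∈ b, x ≤ s := by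
  obtain ⟨m, hm, hmax⟩ := hc.exists_max hne
  obtain ⟨h1, h2, -⟩ := L.htpy_good hc hne m hm hmax
  have h0 := right_ne_zero_of_mul h
  obtain ⟨h3, h4, h5⟩ := h1 b h0
  exact ⟨h4, h5, h2 b h0, fun s hs x hx => (L.mem_down.1 (h3 hx)).trans (hs m hm)⟩

/-- This is the equation of `htpy` conjugated by `twist`. The set `B` stands for the whole fibre;
chains in it with another image contribute nothing. -/
theorem homotopy_spec {a c : Finset α} (hc : Chain a) (hne : a.Nonempty) (hc' : Chain c)
    (hi : c.image L.r = a.image L.r) (B : Finset (Finset α))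
    (hB : ∀ b : Finset α, Chain b → b.image L.r = a.image L.r → b ∈ B) :
    ∑ b ∈ B, Sd.incidence L.r a b * L.homotopy b c + ∑ b ∈ B, L.homotopy a b * Sd.incidence L.r b c =
      (if a = c then 1 else 0) -
        if a.card = (a.image L.r).card ∧ c = L.flagOf (a.image L.r) then 1 else 0 := by
  set τ := a.image L.r with hτ
  obtain ⟨m, hm, hmax⟩ := hc.exists_max hne
  obtain ⟨g1, -, g3⟩ := L.htpy_good hc hne m hm hmax
  rw [← hτ] at g1 g3
  have e1 : ∑ b ∈ B, Sd.incidence L.r a b * L.homotopy b c =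
      ∑ x ∈ a with (a.erase x).image L.r = τ, L.twist a * L.twist c * (ps (a.erase x) x * L.htpy (a.erase x) c) := by
    symm
    refine Finset.sum_bij_ne_zero (fun x _ _ => a.erase x) ?_ ?_ ?_ ?_
    · intro x hx _
      exact hB _ (hc.mono (Finset.erase_subset _ _)) (Finset.mem_filter.1 hx).2
    · intro x hx _ y hy _ h
      by_contra hxy
      have : x ∈ a.erase y := Finset.mem_erase.2 ⟨hxy, Finset.mem_of_mem_filter _ hx⟩
      rw [← h] at this
      exact Finset.notMem_erase _ _ this
    · intro b _ h
      obtain ⟨x, hx, -, e, -, -, h'⟩ := Sd.exists_of_incidence_ne_zero L.r (left_ne_zero_of_mul h)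
      have hx' : x ∈ a.filter fun x => (a.erase x).image L.r = τ :=
        Finset.mem_filter.2 ⟨hx, by rw [← e, ← h']⟩
      refine ⟨x, hx', fun h0 => h ?_, e.symm⟩
      rw [e, L.incidence_erase hc hx (Finset.mem_filter.1 hx').2, homotopy]
      linear_combination L.twist (a.erase x) ^ 2 * h0
    · intro x hx _
      obtain ⟨hx1, hx2⟩ := Finset.mem_filter.1 hx
      rw [L.incidence_erase hc hx1 hx2, homotopy]
      linear_combination (-L.twist a * L.twist c * (ps (a.erase x) x * L.htpy (a.erase x) c)) *
        L.twist_mul_self (a.erase x)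
  have e2 : ∑ b ∈ B, L.homotopy a b * Sd.incidence L.r b c =
      L.twist a * L.twist c * L.bd (L.down m) τ τ (L.htpy a) c := by
    rw [bd_apply, if_pos hi, bdAt, Finset.mul_sum]
    symm
    have key : ∀ x ∈ (L.down m).filter (fun x => x ∉ c ∧ L.r x ∈ τ),
        L.twist a * L.twist c * (ps c x * L.htpy a (insert x c)) ≠ 0 →
        Chain (insert x c) ∧ (insert x c).image L.r = τ ∧
        L.twist a * L.twist c * (ps c x * L.htpy a (insert x c)) =
          L.homotopy a (insert x c) * Sd.incidence L.r (insert x c) c := by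
      intro x hx h
      obtain ⟨-, hx1, hx2⟩ := Finset.mem_filter.1 hx
      obtain ⟨h1, h2, h3⟩ := g1 _ (right_ne_zero_of_mul (right_ne_zero_of_mul h))
      have h4 := L.incidence_erase h2 (Finset.mem_insert_self x c)
        (by rw [Finset.erase_insert hx1, h3, hi])
      rw [Finset.erase_insert hx1] at h4
      refine ⟨h2, h3, ?_⟩
      rw [h4, homotopy]
      linear_combination (-L.twist a * L.twist c * (ps c x * L.htpy a (insert x c))) *
        L.twist_mul_self (insert x c)
    refine Finset.sum_bij_ne_zero (fun x _ _ => insert x c) ?_ ?_ ?_ ?_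
    · intro x hx h
      obtain ⟨h1, h2, -⟩ := key x hx h
      exact hB _ h1 h2
    · intro x hx _ y hy _ h
      have : x ∈ insert y c := h ▸ Finset.mem_insert_self _ _
      exact (Finset.mem_insert.1 this).resolve_right (Finset.mem_filter.1 hx).2.1
    · intro b _ h
      obtain ⟨x, hx, hxc, -, e, hr, h'⟩ := Sd.exists_of_incidence_ne_zero L.r (right_ne_zero_of_mul h)
      have hsup := g1 b (right_ne_zero_of_mul (left_ne_zero_of_mul h))
      have hx' : x ∈ (L.down m).filter (fun x => x ∉ c ∧ L.r x ∈ τ) :=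
        Finset.mem_filter.2 ⟨hsup.1 hx, hxc, hi ▸ hr⟩
      subst e
      refine ⟨x, hx', ?_, rfl⟩
      refine mul_ne_zero (left_ne_zero_of_mul (left_ne_zero_of_mul h) |> fun h => ?_)
        (mul_ne_zero ?_ (right_ne_zero_of_mul (left_ne_zero_of_mul h)))
      · refine mul_ne_zero (left_ne_zero_of_mul h) fun h0 => ?_
        have := L.twist_mul_self c
        simp [h0] at this
      · intro h0
        have := ps_mul_self c x
        simp [h0] at this
    · intro x hx h
      exact (key x hx h).2.2
  rw [e1, e2, g3, Pi.sub_apply, Pi.sub_apply, Finset.sum_apply, ← Finset.mul_sum]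
  simp only [Pi.smul_apply, smul_eq_mul]
  have e3 : L.twist a * L.twist c * (Pi.single a 1 : Finset α → ℤ) c = if a = c then 1 else 0 := by
    split_ifs with h
    · subst h
      rw [Pi.single_eq_same, mul_one, twist_mul_self]
    · rw [Pi.single_eq_of_ne (Ne.symm h), mul_zero]
  -- Here `a` and the flag are both isomorphic to `τ`, so their twists differ only by `sg a * sg c`,
  -- which is the sign in `proj`.
  have e4 : L.twist a * L.twist c * L.proj a c =
      if a.card = τ.card ∧ c = L.flagOf τ then 1 else 0 := by
    rw [proj, ← hτ, Pi.smul_apply, smul_eq_mul]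
    by_cases h1 : a.card = τ.card
    swap
    · simp [h1]
    by_cases h2 : c = L.flagOf τ
    swap
    · rw [Pi.single_eq_of_ne h2]
      simp [h2]
    rw [if_pos h1, if_pos ⟨h1, h2⟩, ← h2, Pi.single_eq_same]
    obtain ⟨s, hs⟩ := L.face m τ (L.image_subset hmax) (hne.image _)
    have h3 : c.card = (c.image L.r).card := by
      rw [hi, h2, ← hs, flagOf_vs, card_flag]
    rw [L.twist_of_card_eq (hτ ▸ h1), L.twist_of_card_eq h3, hi, ← hτ]
    have h4 : (∏ v ∈ τ, ∏ u ∈ τ, sgn (u < v)) * (∏ v ∈ τ, ∏ u ∈ τ, sgn (u < v)) = 1 := by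
      rw [← Finset.prod_mul_distrib]; exact Finset.prod_eq_one fun _ _ => prod_sgn_mul_self _ _
    linear_combination h4 * L.sg a ^ 2 * L.sg c ^ 2 + L.sg_mul_self a * L.sg c ^ 2 + L.sg_mul_self c
  linear_combination e3 - e4

/-- The twisted form of `aug_bd`: summing the coefficients of the simplices isomorphic to their
image, now without signs, kills boundaries. It makes the projection of the subdivision to `C` a
chain map. -/
theorem sum_incidence_of_card {a : Finset α} (hc : Chain a) (hne : a.Nonempty) (B : Finset (Finset α))
    (hB : ∀ b : Finset α, Chain b → b.image L.r = a.image L.r → b ∈ B) :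
    ∑ b ∈ B, (if b.card = (b.image L.r).card then Sd.incidence L.r a b else 0) = 0 := by
  obtain ⟨m, hm, hmax⟩ := hc.exists_max hne
  have haW : a ⊆ L.down m := fun x hx => L.mem_down.2 (hmax x hx)
  set τ := a.image L.r with hτ
  set K := ∏ v ∈ τ, ∏ u ∈ τ, sgn (u < v) with hK
  have key : ∀ x ∈ a, (a.erase x).image L.r = τ → (a.erase x).card = τ.card →
      Sd.incidence L.r a (a.erase x) = L.twist a * K * (ps (a.erase x) x * L.sg (a.erase x)) := by
    intro x hx h h'
    rw [L.incidence_erase hc hx h, L.twist_of_card_eq (a := a.erase x) (by rw [h, h']), h]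
    ring
  have e : ∑ b ∈ B, (if b.card = (b.image L.r).card then Sd.incidence L.r a b else 0) =
      ∑ x ∈ a with (a.erase x).image L.r = τ,
        if (a.erase x).card = τ.card then L.twist a * K * (ps (a.erase x) x * L.sg (a.erase x)) else 0 := by
    symm
    refine Finset.sum_bij_ne_zero (fun x _ _ => a.erase x) ?_ ?_ ?_ ?_
    · intro x hx _
      exact hB _ (hc.mono (Finset.erase_subset _ _)) (Finset.mem_filter.1 hx).2
    · intro x hx _ y hy _ h
      by_contra hxy
      have : x ∈ a.erase y := Finset.mem_erase.2 ⟨hxy, Finset.mem_of_mem_filter _ hx⟩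
      rw [← h] at this
      exact Finset.notMem_erase _ _ this
    · intro b _ h
      split_ifs at h with h1
      · obtain ⟨x, hx, -, e, -, -, h'⟩ := Sd.exists_of_incidence_ne_zero L.r h
        subst e
        refine ⟨x, Finset.mem_filter.2 ⟨hx, h'.symm⟩, ?_, rfl⟩
        have h2 : (a.erase x).card = τ.card := by rw [h1, hτ, h']
        rwa [if_pos h2, ← key x hx h'.symm h2]
      · exact absurd rfl h
    · intro x hx h
      obtain ⟨h1, h2⟩ := Finset.mem_filter.1 hx
      split_ifs at h with h3
      · rw [if_pos h3, if_pos (by rw [h2, h3]), key x h1 h2 h3]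
      · exact absurd rfl h
  have h0 := L.aug_bd (Supp.single haW hc) subset_rfl
  rw [L.bd_single haW, map_sum] at h0
  refine e.trans (Eq.trans ?_ ((congrArg (fun t => L.twist a * K * t) h0).trans (mul_zero _)))
  simp only [Finset.mul_sum]
  refine Finset.sum_congr rfl fun x _ => ?_
  rw [map_smul, L.aug_single ((Finset.erase_subset _ _).trans haW), smul_eq_mul]
  split_ifs <;> simp

end Labelling

/-! ### Families with varying index sets, a common home for complexes over `X` and over its
subdivisions. -/

/-- Families of objects of `𝒜` with arbitrary index sets. -/
structure Fam (𝒜 : Type u) where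
  Index : Type w
  obj : Index → 𝒜

namespace Fam

variable {𝒜 : Type u} [Category.{v} 𝒜] [Preadditive 𝒜]

/-- Column finite matrices. -/
structure Hom (M N : Fam.{u, w} 𝒜) where
  app : ∀ (σ : M.Index) (τ : N.Index), M.obj σ ⟶ N.obj τ
  finite : ∀ σ, {τ | app σ τ ≠ 0}.Finite

theorem Hom.ext' {M N : Fam.{u, w} 𝒜} {f g : Hom M N} (h : ∀ σ τ, f.app σ τ = g.app σ τ) : f = g := by
  cases f; cases g; congr; funext σ τ; exact h σ τ

open scoped Classical in
/-- The identity matrix. -/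
noncomputable def Hom.id (M : Fam.{u, w} 𝒜) : Hom M M where
  app σ τ := if h : σ = τ then eqToHom (congrArg M.obj h) else 0
  finite σ := (Set.finite_singleton σ).subset fun τ h => by
    by_contra h'
    exact h (dif_neg fun e => h' (by simp [e]))

theorem comp_eq_sum {M N P : Fam.{u, w} 𝒜} (f : Hom M N) (g : Hom N P) (σ : M.Index) (ρ : P.Index)
    (s : Finset N.Index) (hs : ∀ τ, f.app σ τ ≠ 0 → τ ∈ s) :
    ∑ᶠ τ, f.app σ τ ≫ g.app τ ρ = ∑ τ ∈ s, f.app σ τ ≫ g.app τ ρ :=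
  finsum_eq_sum_of_support_subset _ fun τ h => hs τ fun h' => h (by simp [h'])

/-- Multiplication of matrices. -/
noncomputable def Hom.comp {M N P : Fam.{u, w} 𝒜} (f : Hom M N) (g : Hom N P) : Hom M P where
  app σ ρ := ∑ᶠ τ, f.app σ τ ≫ g.app τ ρ
  finite σ := by
    refine ((f.finite σ).biUnion fun τ _ => g.finite τ).subset fun ρ h => ?_
    obtain ⟨τ, hτ⟩ : ∃ τ, f.app σ τ ≫ g.app τ ρ ≠ 0 := by
      by_contra! h'
      exact h (finsum_eq_zero_of_forall_eq_zero h')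
    simp only [Set.mem_iUnion, Set.mem_ofPred_eq]
    exact ⟨τ, fun e => hτ (by simp [e]), fun e => hτ (by simp [e])⟩

noncomputable instance : Category (Fam.{u, w} 𝒜) where
  Hom := Hom
  id := Hom.id
  comp := Hom.comp
  id_comp {M N} f := by
    classical
    refine Hom.ext' fun σ ρ => ?_
    refine (comp_eq_sum (Hom.id M) f σ ρ {σ} fun τ h => ?_).trans ?_
    · by_contra h'
      exact h (dif_neg fun e => h' (by simp [e]))
    · simp [Hom.id]
  comp_id {M N} f := by
    classical
    refine Hom.ext' fun σ ρ => ?_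
    refine (finsum_eq_single _ ρ fun τ h => ?_).trans ?_
    · simp [Hom.id, h]
    · simp [Hom.id]
  assoc {M N P Q} f g h := by
    classical
    refine Hom.ext' fun σ ρ => ?_
    let s := (f.finite σ).toFinset
    let t := s.biUnion fun τ => (g.finite τ).toFinset
    have h1 : ∀ τ', (Hom.comp f g).app σ τ' = ∑ τ ∈ s, f.app σ τ ≫ g.app τ τ' := fun τ' =>
      comp_eq_sum f g σ τ' s fun τ h => by simpa [s] using h
    have h2 : ∀ τ ∈ s, (Hom.comp g h).app τ ρ = ∑ τ' ∈ t, g.app τ τ' ≫ h.app τ' ρ := fun τ hτ =>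
      comp_eq_sum g h τ ρ t fun τ' h' => Finset.mem_biUnion.2 ⟨τ, hτ, by simpa using h'⟩
    have h3 : (Hom.comp (Hom.comp f g) h).app σ ρ = ∑ τ' ∈ t, (Hom.comp f g).app σ τ' ≫ h.app τ' ρ := by
      refine comp_eq_sum (Hom.comp f g) h σ ρ t fun τ' h' => ?_
      rw [h1] at h'
      obtain ⟨τ, hτ, h''⟩ := Finset.exists_ne_zero_of_sum_ne_zero h'
      exact Finset.mem_biUnion.2 ⟨τ, hτ, by simpa using fun e => h'' (by simp [e])⟩
    have h4 : (Hom.comp f (Hom.comp g h)).app σ ρ = ∑ τ ∈ s, f.app σ τ ≫ (Hom.comp g h).app τ ρ :=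
      comp_eq_sum f (Hom.comp g h) σ ρ s fun τ h => by simpa [s] using h
    rw [h3, h4, ← Finset.sum_congr rfl fun τ hτ => (congrArg (f.app σ τ ≫ ·) (h2 τ hτ)).symm]
    simp only [h1, Preadditive.sum_comp, Preadditive.comp_sum, Category.assoc]
    exact Finset.sum_comm

/-- The component of a morphism from `σ` to `τ`. -/
def app {M N : Fam.{u, w} 𝒜} (f : M ⟶ N) (σ : M.Index) (τ : N.Index) : M.obj σ ⟶ N.obj τ := Hom.app f σ τ

theorem hom_ext {M N : Fam.{u, w} 𝒜} {f g : M ⟶ N} (h : ∀ σ τ, app f σ τ = app g σ τ) : f = g :=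
  Hom.ext' h

theorem comp_app {M N P : Fam.{u, w} 𝒜} (f : M ⟶ N) (g : N ⟶ P) (σ : M.Index) (ρ : P.Index) :
    app (f ≫ g) σ ρ = ∑ᶠ τ, app f σ τ ≫ app g τ ρ := rfl

theorem comp_app_eq_sum {M N P : Fam.{u, w} 𝒜} (f : M ⟶ N) (g : N ⟶ P) (σ : M.Index) (ρ : P.Index)
    (s : Finset N.Index) (hs : ∀ τ, app f σ τ ≠ 0 → τ ∈ s) :
    app (f ≫ g) σ ρ = ∑ τ ∈ s, app f σ τ ≫ app g τ ρ := comp_eq_sum f g σ ρ s hs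

theorem exists_of_comp_app_ne_zero {M N P : Fam.{u, w} 𝒜} {f : M ⟶ N} {g : N ⟶ P} {σ : M.Index}
    {ρ : P.Index} (h : app (f ≫ g) σ ρ ≠ 0) : ∃ τ, app f σ τ ≠ 0 ∧ app g τ ρ ≠ 0 := by
  by_contra! h'
  refine h (finsum_eq_zero_of_forall_eq_zero fun τ => ?_)
  by_cases e : app f σ τ = 0
  · exact (congrArg (· ≫ _) e).trans zero_comp
  · exact (congrArg (_ ≫ ·) (h' τ e)).trans comp_zero

instance {M N : Fam.{u, w} 𝒜} : Zero (M ⟶ N) :=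
  ⟨Hom.mk (fun _ _ => 0) (fun σ => by simp)⟩

instance {M N : Fam.{u, w} 𝒜} : Add (M ⟶ N) :=
  ⟨fun f g => Hom.mk (fun σ τ => app f σ τ + app g σ τ)
    (fun σ => ((f.finite σ).union (g.finite σ)).subset fun τ h => by
      by_contra h'
      simp only [Set.mem_union, Set.mem_ofPred_eq, not_or, not_not] at h'
      exact h (by simp [app, h'.1, h'.2]))⟩

instance {M N : Fam.{u, w} 𝒜} : Neg (M ⟶ N) :=
  ⟨fun f => Hom.mk (fun σ τ => - app f σ τ)
    (fun σ => (f.finite σ).subset fun τ h h' => h (by simp [app, h']))⟩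

theorem add_app {M N : Fam.{u, w} 𝒜} (f g : M ⟶ N) (σ : M.Index) (τ : N.Index) :
    app (f + g) σ τ = app f σ τ + app g σ τ := rfl

instance {M N : Fam.{u, w} 𝒜} : AddCommGroup (M ⟶ N) where
  add_assoc f g h := hom_ext fun σ τ => add_assoc _ _ _
  zero_add f := hom_ext fun σ τ => zero_add _
  add_zero f := hom_ext fun σ τ => add_zero _
  add_comm f g := hom_ext fun σ τ => add_comm _ _
  neg_add_cancel f := hom_ext fun σ τ => neg_add_cancel (app f σ τ)
  nsmul := nsmulRec
  zsmul := zsmulRec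

theorem neg_app {M N : Fam.{u, w} 𝒜} (f : M ⟶ N) (σ : M.Index) (τ : N.Index) :
    app (-f) σ τ = - app f σ τ := rfl

theorem sub_app {M N : Fam.{u, w} 𝒜} (f g : M ⟶ N) (σ : M.Index) (τ : N.Index) :
    app (f - g) σ τ = app f σ τ - app g σ τ := by
  rw [sub_eq_add_neg, sub_eq_add_neg, add_app, neg_app]

noncomputable instance : Preadditive (Fam.{u, w} 𝒜) where
  add_comp M N P f f' g := hom_ext fun σ ρ => by
    classical
    let s := (f.finite σ).toFinset ∪ (f'.finite σ).toFinset
    rw [add_app, comp_app_eq_sum _ _ σ ρ s, comp_app_eq_sum _ _ σ ρ s, comp_app_eq_sum _ _ σ ρ s,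
      ← Finset.sum_add_distrib]
    · exact Finset.sum_congr rfl fun τ _ => by rw [add_app, Preadditive.add_comp]
    · intro τ h; simp only [s, Finset.mem_union, Set.Finite.mem_toFinset]; exact .inr h
    · intro τ h; simp only [s, Finset.mem_union, Set.Finite.mem_toFinset]; exact .inl h
    · intro τ h
      simp only [s, Finset.mem_union, Set.Finite.mem_toFinset]
      by_contra h'
      simp only [Set.mem_ofPred_eq, not_or, not_not] at h'
      exact h (by rw [add_app]; simp [app, h'.1, h'.2])
  comp_add M N P f g g' := hom_ext fun σ ρ => by
    let s := (f.finite σ).toFinset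
    have hs : ∀ τ, app f σ τ ≠ 0 → τ ∈ s := fun τ h => by
      simp only [s, Set.Finite.mem_toFinset]; exact h
    rw [add_app, comp_app_eq_sum _ _ σ ρ s hs, comp_app_eq_sum _ _ σ ρ s hs,
      comp_app_eq_sum _ _ σ ρ s hs, ← Finset.sum_add_distrib]
    exact Finset.sum_congr rfl fun τ _ => by rw [add_app, Preadditive.comp_add]

theorem id_app_self (M : Fam.{u, w} 𝒜) (σ : M.Index) : app (𝟙 M) σ σ = 𝟙 _ := dif_pos rfl

theorem id_app_ne (M : Fam.{u, w} 𝒜) {σ τ : M.Index} (h : σ ≠ τ) : app (𝟙 M) σ τ = 0 := dif_neg h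

/-- The components of the matrix `f` vanish outside the relation `Q`. -/
def SuppIn {M N : Fam.{u, w} 𝒜} (f : M ⟶ N) (Q : M.Index → N.Index → Prop) : Prop :=
  ∀ σ τ, app f σ τ ≠ 0 → Q σ τ

theorem SuppIn.comp {M N P : Fam.{u, w} 𝒜} {f : M ⟶ N} {g : N ⟶ P} {Q : M.Index → N.Index → Prop}
    {Q' : N.Index → P.Index → Prop} {Q'' : M.Index → P.Index → Prop} (hf : SuppIn f Q) (hg : SuppIn g Q')
    (h : ∀ a b c, Q a b → Q' b c → Q'' a c) : SuppIn (f ≫ g) Q'' := fun σ ρ hσ => by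
  obtain ⟨τ, h1, h2⟩ := exists_of_comp_app_ne_zero hσ
  exact h σ τ ρ (hf σ τ h1) (hg τ ρ h2)

theorem SuppIn.sub {M N : Fam.{u, w} 𝒜} {f g : M ⟶ N} {Q : M.Index → N.Index → Prop} (hf : SuppIn f Q)
    (hg : SuppIn g Q) : SuppIn (f - g) Q := fun σ τ h => by
  by_cases h0 : app f σ τ = 0
  · exact hg σ τ fun h1 => h (by rw [sub_app, h0, h1, sub_zero])
  · exact hf σ τ h0

theorem SuppIn.add {M N : Fam.{u, w} 𝒜} {f g : M ⟶ N} {Q : M.Index → N.Index → Prop} (hf : SuppIn f Q)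
    (hg : SuppIn g Q) : SuppIn (f + g) Q := fun σ τ h => by
  by_cases h0 : app f σ τ = 0
  · exact hg σ τ fun h1 => h (by rw [add_app, h0, h1, add_zero])
  · exact hf σ τ h0

/-- A matrix that lowers a bounded rank is nilpotent. -/
theorem pow_eq_zero {M : Fam.{u, w} 𝒜} (f : End M) (ρ : M.Index → ℕ) (K : ℕ) (hρ : ∀ σ, ρ σ < K)
    (hf : SuppIn f fun σ τ => ρ τ < ρ σ) : f ^ K = 0 := by
  have h : ∀ k, SuppIn (M := M) (N := M) (f ^ k : End M) fun σ τ => ρ τ + k ≤ ρ σ := by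
    intro k
    induction k with
    | zero =>
      intro σ τ h
      by_cases e : σ = τ
      · exact (congrArg ρ e).ge
      · exact absurd (id_app_ne M e) h
    | succ k ih =>
      rw [pow_succ]
      exact SuppIn.comp (f := f) (g := f ^ k) hf ih fun a b c h1 h2 => by omega
  refine hom_ext fun σ τ => ?_
  by_contra h0
  have := h K σ τ h0
  have := hρ σ
  omega

/-- Matrices over a fixed index set as matrices. -/
abbrev ofGraded {S : Type w} {R : S → S → Prop} (M : Graded S R 𝒜) : Fam.{u, w} 𝒜 := ⟨S, M.obj⟩

section

variable {S : Type w} {R : S → S → Prop} [Std.Refl R] [IsTrans S R]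

/-- The inclusion of `Graded S R 𝒜` on morphisms. -/
def ofHom {M N : Graded S R 𝒜} (f : M ⟶ N) : ofGraded M ⟶ ofGraded N :=
  Hom.mk (fun σ τ => Graded.app f σ τ) (Graded.Hom.finite f)

theorem ofHom_injective {M N : Graded S R 𝒜} {f g : M ⟶ N} (h : ofHom f = ofHom g) : f = g :=
  Graded.hom_ext fun σ τ => congrArg (fun k : ofGraded M ⟶ ofGraded N => app k σ τ) h

theorem ofHom_comp {M N P : Graded S R 𝒜} (f : M ⟶ N) (g : N ⟶ P) : ofHom (f ≫ g) = ofHom f ≫ ofHom g := rfl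

theorem ofHom_zero (M N : Graded S R 𝒜) : ofHom (0 : M ⟶ N) = 0 := rfl

/-- The inclusion of `Graded S R 𝒜` on chain complexes. -/
abbrev ofComplex (C : ChainComplex (Graded S R 𝒜) ℤ) : ChainComplex (Fam.{u, w} 𝒜) ℤ where
  X n := ofGraded (C.X n)
  d n m := ofHom (C.d n m)
  shape n m h := by rw [C.shape n m h, ofHom_zero]
  d_comp_d' n m p _ _ := by rw [← ofHom_comp, C.d_comp_d, ofHom_zero]

end

end Fam

/-! ### Contractions, and a perturbation lemma by nilpotent corrections. -/

section Perturbation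

variable {𝒢 : Type*} [Category 𝒢] [Preadditive 𝒢]

/-- A family of morphisms that satisfies the equation of a contraction gives a null homotopy. -/
def contraction (C : ChainComplex 𝒢 ℤ) (h : ∀ n m, C.X n ⟶ C.X m)
    (hh : ∀ p n m, p + 1 = n → n + 1 = m → 𝟙 (C.X n) = C.d n p ≫ h p n + h n m ≫ C.d m n) :
    Homotopy (𝟙 C) 0 where
  hom n m := if n + 1 = m then h n m else 0
  zero n m hnm := if_neg hnm
  comm n := by
    rw [dNext_eq _ (show (ComplexShape.down ℤ).Rel n (n - 1) from sub_add_cancel n 1),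
      prevD_eq _ (show (ComplexShape.down ℤ).Rel (n + 1) n from rfl)]
    rw [if_pos (sub_add_cancel n 1), if_pos rfl, HomologicalComplex.id_f, HomologicalComplex.zero_f,
      add_zero]
    exact hh _ _ _ (sub_add_cancel n 1) rfl

theorem Homotopy.eq_id {C : ChainComplex 𝒢 ℤ} (h : Homotopy (𝟙 C) 0) {p n m : ℤ} (hp : p + 1 = n)
    (hm : n + 1 = m) : 𝟙 (C.X n) = C.d n p ≫ h.hom p n + h.hom n m ≫ C.d m n := by
  have := h.comm n
  rwa [dNext_eq _ (show (ComplexShape.down ℤ).Rel n p from hp),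
    prevD_eq _ (show (ComplexShape.down ℤ).Rel m n from hm), HomologicalComplex.id_f,
    HomologicalComplex.zero_f, add_zero] at this

/-- The deviation of a family of morphisms from being a chain map. -/
def defect {C D : ChainComplex 𝒢 ℤ} (f : ∀ n, C.X n ⟶ D.X n) (n m : ℤ) : C.X n ⟶ D.X m :=
  f n ≫ D.d n m - C.d n m ≫ f m

theorem defect_comp_d {C D : ChainComplex 𝒢 ℤ} (f : ∀ n, C.X n ⟶ D.X n) (n m p : ℤ) :
    defect f n m ≫ D.d m p = - C.d n m ≫ defect f m p := by
  simp [defect]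

/-- A family of morphisms is corrected by composing its defect with a homotopy. -/
def correct {C D : ChainComplex 𝒢 ℤ} (H : ∀ n m, D.X n ⟶ D.X m) (f : ∀ n, C.X n ⟶ D.X n) (n : ℤ) :
    C.X n ⟶ D.X n := f n - defect f n (n - 1) ≫ H (n - 1) n

/-- The dual correction. -/
def cocorrect {C D : ChainComplex 𝒢 ℤ} (H : ∀ n m, C.X n ⟶ C.X m) (f : ∀ n, C.X n ⟶ D.X n) (n : ℤ) :
    C.X n ⟶ D.X n := f n + H n (n + 1) ≫ defect f (n + 1) n

/-- A perturbation lemma: a chain map `e` with a section `ι` in each degree and a homotopy `H` that is a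
strong deformation up to a nilpotent error `N` has a section, which is obtained by correcting `ι`. -/
theorem iterate_correct {C D : ChainComplex 𝒢 ℤ} (e : D ⟶ C) (ι : ∀ n, C.X n ⟶ D.X n)
    (H : ∀ n m, D.X n ⟶ D.X m) (N : ∀ n, D.X n ⟶ D.X n) (hι : ∀ n, ι n ≫ e.f n = 𝟙 _)
    (hH : ∀ n m, n + 1 = m → H n m ≫ e.f m = 0)
    (hN : ∀ p n m, p + 1 = n → n + 1 = m →
      N n = 𝟙 _ - e.f n ≫ ι n - D.d n p ≫ H p n - H n m ≫ D.d m n)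
    (K : ℕ) (hK : ∀ n, End.of (N n) ^ K = 0) :
    ∀ n, (correct H)^[K] ι n ≫ e.f n = 𝟙 _ ∧
      ∀ m, m + 1 = n → defect ((correct H)^[K] ι) n m = 0 := by
  -- Each correction multiplies the defect by `N`. The term of `N` that contains `e` contributes
  -- nothing, as the defect vanishes after `e`; and `defect_comp_d` turns the term with `d H` into
  -- the change of the corrected map one degree lower. The section property survives because `H`
  -- vanishes after `e`.
  have key : ∀ k, (∀ n, (correct H)^[k] ι n ≫ e.f n = 𝟙 _) ∧
      ∀ n m, m + 1 = n → defect ((correct H)^[k] ι) n m = defect ι n m ≫ End.asHom (End.of (N m) ^ k) := by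
    intro k
    induction k with
    | zero => exact ⟨hι, fun n m _ => (Category.comp_id _).symm⟩
    | succ k ih =>
      rw [Function.iterate_succ_apply']
      set f := (correct H)^[k] ι with hf
      obtain ⟨ih1, ih2⟩ := ih
      have h0 : ∀ n m, defect f n m ≫ e.f m = 0 := fun n m => by
        rw [defect, Preadditive.sub_comp, Category.assoc, Category.assoc, ih1, ← e.comm, ← Category.assoc,
          ih1, Category.id_comp, Category.comp_id, sub_self]
      refine ⟨fun n => ?_, fun n m hm => ?_⟩
      · rw [correct, Preadditive.sub_comp, ih1, Category.assoc, hH _ _ (sub_add_cancel n 1), comp_zero,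
          sub_zero]
      · have hm' : n - 1 = m := by omega
        subst hm'
        have e1 : defect (correct H f) n (n - 1) = defect f n (n - 1) ≫ N (n - 1) := by
          rw [hN (n - 1 - 1) (n - 1) n (sub_add_cancel _ 1) hm]
          have h1 := defect_comp_d f n (n - 1) (n - 1 - 1)
          have h2 := h0 n (n - 1)
          rw [defect]
          simp only [correct]
          simp only [Preadditive.sub_comp, Preadditive.comp_sub, Category.assoc, Category.comp_id]
          rw [← Category.assoc _ (D.d (n - 1) (n - 1 - 1)), h1, ← Category.assoc _ (e.f (n - 1)), h2,
            zero_comp]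
          simp only [Preadditive.neg_comp, Category.assoc]
          rw [show defect f n (n - 1) = f n ≫ D.d n (n - 1) - C.d n (n - 1) ≫ f (n - 1) from rfl]
          abel
        rw [e1, ih2 _ _ hm, Category.assoc, pow_succ']
        rfl
  intro n
  refine ⟨(key K).1 n, fun m hm => ?_⟩
  rw [(key K).2 n m hm, hK]
  exact comp_zero

/-- `iterate_correct` with all arrows reversed: now `ι` is a retraction of `e` in each degree, and
the defect is multiplied by `N` on the other side. -/
theorem iterate_cocorrect {C D : ChainComplex 𝒢 ℤ} (e : C ⟶ D) (ι : ∀ n, D.X n ⟶ C.X n)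
    (H : ∀ n m, D.X n ⟶ D.X m) (N : ∀ n, D.X n ⟶ D.X n) (hι : ∀ n, e.f n ≫ ι n = 𝟙 _)
    (hH : ∀ n m, n + 1 = m → e.f n ≫ H n m = 0)
    (hN : ∀ p n m, p + 1 = n → n + 1 = m →
      N n = 𝟙 _ - ι n ≫ e.f n - D.d n p ≫ H p n - H n m ≫ D.d m n)
    (K : ℕ) (hK : ∀ n, End.of (N n) ^ K = 0) :
    ∀ n, e.f n ≫ (cocorrect H)^[K] ι n = 𝟙 _ ∧
      ∀ m, m + 1 = n → defect ((cocorrect H)^[K] ι) n m = 0 := by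
  have key : ∀ k, (∀ n, e.f n ≫ (cocorrect H)^[k] ι n = 𝟙 _) ∧
      ∀ n m, m + 1 = n → defect ((cocorrect H)^[k] ι) n m = End.asHom (End.of (N n) ^ k) ≫ defect ι n m := by
    intro k
    induction k with
    | zero => exact ⟨hι, fun n m _ => (Category.id_comp _).symm⟩
    | succ k ih =>
      rw [Function.iterate_succ_apply']
      set f := (cocorrect H)^[k] ι with hf
      obtain ⟨ih1, ih2⟩ := ih
      have h0 : ∀ n m, e.f n ≫ defect f n m = 0 := fun n m => by
        rw [defect, Preadditive.comp_sub, ← Category.assoc, ih1, ← Category.assoc, e.comm, Category.assoc,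
          ih1, Category.id_comp, Category.comp_id, sub_self]
      refine ⟨fun n => ?_, fun n m hm => ?_⟩
      · rw [cocorrect, Preadditive.comp_add, ih1, ← Category.assoc, hH _ _ rfl, zero_comp, add_zero]
      · subst hm
        have e1 : defect (cocorrect H f) (m + 1) m = N (m + 1) ≫ defect f (m + 1) m := by
          rw [hN m (m + 1) (m + 1 + 1) rfl rfl]
          have h1 := defect_comp_d f (m + 1 + 1) (m + 1) m
          have h2 := h0 (m + 1) m
          rw [defect]
          simp only [cocorrect]
          simp only [Preadditive.sub_comp, Preadditive.add_comp, Preadditive.comp_add, Category.assoc,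
            Category.id_comp]
          rw [h1, h2, comp_zero]
          simp only [Preadditive.comp_neg]
          rw [show defect f (m + 1) m = f (m + 1) ≫ C.d (m + 1) m - D.d (m + 1) m ≫ f m from rfl]
          abel
        rw [e1, ih2 _ _ rfl, ← Category.assoc, pow_succ]
        rfl
  intro n
  refine ⟨(key K).1 n, fun m hm => ?_⟩
  rw [(key K).2 n m hm, hK]
  exact zero_comp

/-- The chain map given by a family of morphisms without defect. -/
def chainMapOfDefect {C D : ChainComplex 𝒢 ℤ} (f : ∀ n, C.X n ⟶ D.X n)
    (h : ∀ n m, m + 1 = n → defect f n m = 0) : C ⟶ D where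
  f := f
  comm' n m hnm := sub_eq_zero.1 (h n m hnm)

end Perturbation

/-! ### The fibres of `Sd X → X` and their homotopy. -/

namespace Subdivision

open scoped Classical

variable {X : OrderedComplex.{w}} (r : Approx X) (var : Variance)

/-- The simplices of `X` with the vertices chosen by `r`. -/
def labelling : Labelling X.sd.V X.V where
  vs := fun s : X.Simplex => s.1
  le_iff := Iff.rfl
  face := fun s t h hne => ⟨(⟨t, X.mem_of_subset (Subtype.property (show X.Simplex from s)) h hne⟩ : X.Simplex), rfl⟩
  r := r.vert
  mem := r.mem
  total := fun s => X.total _ (Subtype.property (show X.Simplex from s))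

theorem chain (a : X.sd.Simplex) : Labelling.Chain a.1 := fun x hx y hy _ => a.2.2 x hx y hy

theorem nonempty (a : X.sd.Simplex) : a.1.Nonempty := a.2.1

theorem image_map (a : X.sd.Simplex) : a.1.image (labelling r).r = (r.map a).1 := rfl

theorem map_eq_iff {a b : X.sd.Simplex} :
    r.map a = r.map b ↔ a.1.image (labelling r).r = b.1.image (labelling r).r := Subtype.ext_iff

theorem mem_of_chain {c : Finset X.sd.V} (h : Labelling.Chain c) (hne : c.Nonempty) : c ∈ X.sd.K.faces :=
  ⟨hne, fun _ ha _ hb => h.total ha hb⟩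

/-- The vertices of a simplex over `τ` are simplices of `X` that meet `τ`; local finiteness leaves
finitely many of these. -/
theorem fibre_finite (τ : X.Simplex) : {a : X.sd.Simplex | r.map a = τ}.Finite := by
  have h1 : {s : X.Simplex | ∃ v ∈ τ.1, v ∈ s.1}.Finite := by
    have : {s : Finset X.V | ∃ v ∈ τ.1, s ∈ X.K.faces ∧ v ∈ s}.Finite := by
      refine (τ.1.finite_toSet.biUnion fun v _ => X.locallyFinite v).subset ?_
      rintro s ⟨v, hv, hs⟩
      exact Set.mem_biUnion (Finset.mem_coe.2 hv) hs
    refine (this.preimage (f := Subtype.val) Subtype.val_injective.injOn).subset ?_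
    rintro s ⟨v, hv, hs⟩
    exact ⟨v, hv, s.2, hs⟩
  refine (h1.toFinset.powerset.finite_toSet.preimage (f := Subtype.val)
    Subtype.val_injective.injOn).subset fun a ha => ?_
  refine Finset.mem_coe.2 (Finset.mem_powerset.2 fun s hs => (Set.Finite.mem_toFinset _).2 ?_)
  have ha' : r.map a = τ := ha
  exact ⟨r.vert s, ha' ▸ Finset.mem_image_of_mem r.vert hs, r.mem s⟩

/-- The simplices of the subdivision with a given image. -/
noncomputable def fibre (τ : X.Simplex) : Finset X.sd.Simplex := (fibre_finite r τ).toFinset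

theorem mem_fibre {τ : X.Simplex} {a : X.sd.Simplex} : a ∈ fibre r τ ↔ r.map a = τ :=
  (fibre_finite r τ).mem_toFinset

theorem fibre_image {τ : X.Simplex} {b : Finset X.sd.V} (h : Labelling.Chain b)
    (hb : b.image (labelling r).r = τ.1) : b ∈ (fibre r τ).image Subtype.val := by
  have hne : b.Nonempty := by
    rw [← Finset.image_nonempty (f := (labelling r).r), hb]; exact X.nonempty_of_mem τ.2
  exact Finset.mem_image.2 ⟨⟨b, mem_of_chain h hne⟩, (mem_fibre r).2 (Subtype.ext hb), rfl⟩

theorem sum_fibre (τ : X.Simplex) (f : Finset X.sd.V → ℤ) :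
    ∑ b ∈ (fibre r τ).image Subtype.val, f b = ∑ b ∈ fibre r τ, f b.1 :=
  Finset.sum_image fun _ _ _ _ h => Subtype.ext h

/-- The simplex of the subdivision of `τ` that is mapped isomorphically to `τ`. -/
noncomputable def flag (τ : X.Simplex) : X.sd.Simplex :=
  ⟨(labelling r).flag (show X.sd.V from τ), mem_of_chain ((labelling r).flag_chain _) <| by
    rw [← Finset.image_nonempty (f := (labelling r).r), (labelling r).image_flag]
    exact X.nonempty_of_mem τ.2⟩

theorem flag_le {τ : X.Simplex} : ∀ s ∈ (flag r τ).1, (show X.Simplex from s) ≤ τ := fun _ hs =>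
  (labelling r).flag_le hs

theorem map_flag (τ : X.Simplex) : r.map (flag r τ) = τ := Subtype.ext ((labelling r).image_flag _)

theorem exc_flag (τ : X.Simplex) : exc r (flag r τ) = 0 := by
  unfold exc
  rw [map_flag]
  have := (labelling r).card_flag (show X.sd.V from τ)
  exact sub_eq_zero.2 (congrArg Nat.cast this)

theorem flagOf_eq (τ : X.Simplex) : (labelling r).flagOf τ.1 = (flag r τ).1 :=
  (labelling r).flagOf_vs (show X.sd.V from τ)

theorem exc_eq_zero_iff {a : X.sd.Simplex} :
    exc r a = 0 ↔ a.1.card = (a.1.image (labelling r).r).card := by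
  change (_ : ℤ) - _ = 0 ↔ _
  rw [sub_eq_zero, Nat.cast_inj]
  rfl

/-- The contracting homotopy, for chains (`upper`) or for cochains (`lower`). -/
noncomputable def hty (a b : X.sd.Simplex) : ℤ :=
  match var with
  | .upper => (labelling r).homotopy a.1 b.1
  | .lower => (labelling r).homotopy b.1 a.1

/-- The augmentation followed by the inclusion of the distinguished simplex, or its dual. -/
noncomputable def aug (a c : X.sd.Simplex) : ℤ :=
  match var with
  | .upper => if exc r a = 0 ∧ c = flag r (r.map a) then 1 else 0
  | .lower => if exc r c = 0 ∧ a = flag r (r.map c) then 1 else 0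

theorem hty_ne_zero {a b : X.sd.Simplex} (h : hty r var a b ≠ 0) : r.map a = r.map b := by
  cases var
  · exact ((map_eq_iff r).2 ((labelling r).homotopy_ne_zero (chain a) (nonempty a) h).2.1).symm
  · exact (map_eq_iff r).2 ((labelling r).homotopy_ne_zero (chain b) (nonempty b) h).2.1

theorem exc_of_homotopy {a b : X.sd.Simplex} (h : (labelling r).homotopy a.1 b.1 ≠ 0) :
    exc r b ≠ 0 := by
  obtain ⟨-, h1, h2, -⟩ := (labelling r).homotopy_ne_zero (chain a) (nonempty a) h
  have h3 := Finset.card_image_le (s := a.1) (f := (labelling r).r)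
  rw [Ne, exc_eq_zero_iff, h1, h2]
  omega

theorem sum_inc_hty {a c : X.sd.Simplex} (h : r.map a = r.map c) :
    ∑ b ∈ fibre r (r.map a), inc r var a b * hty r var b c +
      ∑ b ∈ fibre r (r.map a), hty r var a b * inc r var b c =
      (if a = c then 1 else 0) - aug r var a c := by
  have hB : ∀ b : Finset X.sd.V, Labelling.Chain b →
      b.image (labelling r).r = (r.map a).1 → b ∈ (fibre r (r.map a)).image Subtype.val :=
    fun b => fibre_image r
  have key := fun (x y : X.sd.Simplex) (hx : r.map x = r.map a) (hy : r.map y = r.map a) =>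
    (labelling r).homotopy_spec (chain x) (nonempty x) (chain y)
      ((map_eq_iff r).1 (hy.trans hx.symm)) ((fibre r (r.map a)).image Subtype.val)
      (by rw [image_map, hx]; exact hB)
  cases var
  · have := key a c rfl h.symm
    rw [sum_fibre r (r.map a) (fun b => Sd.incidence (labelling r).r a.1 b * (labelling r).homotopy b c.1),
      sum_fibre r (r.map a) (fun b => (labelling r).homotopy a.1 b * Sd.incidence (labelling r).r b c.1)]
      at this
    refine this.trans ?_
    simp only [aug, exc_eq_zero_iff, image_map, flagOf_eq, Subtype.ext_iff]
  · have := key c a h.symm rfl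
    rw [sum_fibre r (r.map a) (fun b => Sd.incidence (labelling r).r c.1 b * (labelling r).homotopy b a.1),
      sum_fibre r (r.map a) (fun b => (labelling r).homotopy c.1 b * Sd.incidence (labelling r).r b a.1),
      add_comm] at this
    refine Eq.trans ?_ (this.trans ?_)
    · congr 1
      · exact Finset.sum_congr rfl fun b _ => mul_comm _ _
      · exact Finset.sum_congr rfl fun b _ => mul_comm _ _
    · simp only [aug, exc_eq_zero_iff, image_map, flagOf_eq, Subtype.ext_iff, eq_comm (a := c.1)]

theorem sum_incidence_exc (a : X.sd.Simplex) :
    ∑ b ∈ fibre r (r.map a), (if exc r b = 0 then Sd.incidence r.vert a.1 b.1 else 0) = 0 := by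
  have := (labelling r).sum_incidence_of_card (chain a) (nonempty a) ((fibre r (r.map a)).image Subtype.val)
    fun b h h' => fibre_image r (τ := r.map a) h h'
  rw [sum_fibre r (r.map a) fun b => if b.card = (b.image (labelling r).r).card then
    Sd.incidence (labelling r).r a.1 b else 0] at this
  simp only [exc_eq_zero_iff]
  exact this

/-- A simplex of excess zero is isomorphic to its image, so it has exactly one face over each face
of the image. This matches the components of `d_C` in the projection of the subdivision to `C`. -/
theorem sum_faces {a : X.sd.Simplex} (ha : exc r a = 0) {τ : X.Simplex} (h : τ ≤ r.map a) :
    ∑ b ∈ fibre r τ, (if exc r b = 0 ∧ b ≤ a then (1 : ℤ) else 0) = 1 := by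
  have inj : Set.InjOn r.vert a.1 := by
    rw [← Finset.card_image_iff]; exact ((exc_eq_zero_iff r).1 ha).symm
  have him : (a.1.filter fun s => r.vert s ∈ τ.1).image r.vert = τ.1 := by
    ext u
    simp only [Finset.mem_image, Finset.mem_filter]
    refine ⟨?_, fun hu => ?_⟩
    · rintro ⟨x, ⟨_, hx⟩, rfl⟩; exact hx
    · obtain ⟨x, hx, rfl⟩ := Finset.mem_image.1 (h hu)
      exact ⟨x, ⟨hx, hu⟩, rfl⟩
  have hne : (a.1.filter fun s => r.vert s ∈ τ.1).Nonempty := by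
    rw [← Finset.image_nonempty (f := r.vert), him]; exact X.nonempty_of_mem τ.2
  let b₀ : X.sd.Simplex := ⟨_, X.sd.mem_of_subset a.2 (Finset.filter_subset _ _) hne⟩
  have hm : r.map b₀ = τ := Subtype.ext him
  rw [Finset.sum_eq_single b₀]
  · refine if_pos ⟨(exc_eq_zero_iff r).2 ?_, Finset.filter_subset _ _⟩
    exact (Finset.card_image_iff.2 (inj.mono (Finset.filter_subset _ _))).symm
  · intro b hb hb₀
    refine if_neg fun h' => hb₀ (Subtype.ext ?_)
    have hb' : b.1.image r.vert = τ.1 := congrArg Subtype.val ((mem_fibre r).1 hb)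
    ext s
    constructor
    · intro hs
      exact Finset.mem_filter.2 ⟨h'.2 hs, hb' ▸ Finset.mem_image_of_mem _ hs⟩
    · intro hs
      obtain ⟨h1, h2⟩ := Finset.mem_filter.1 hs
      rw [← hb'] at h2
      obtain ⟨t, ht, e⟩ := Finset.mem_image.1 h2
      rwa [← inj (h'.2 ht) h1 e]
  · exact fun h' => absurd ((mem_fibre r).2 hm) h'

/-- Equal images and excesses force equal dimensions. So inside a fibre the differential of the
subdivision contains `d_C` only through its diagonal components. -/
theorem eq_of_rel_of_exc {a b : X.sd.Simplex} (h : var.rel a b) (he : exc r a = exc r b)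
    (hm : r.map a = r.map b) : a = b := by
  unfold exc at he
  rw [hm] at he
  have hc : a.1.card = b.1.card := by omega
  cases var
  · exact (Subtype.ext (Finset.eq_of_subset_of_card_le h hc.le)).symm
  · exact Subtype.ext (Finset.eq_of_subset_of_card_le h hc.ge)

end Subdivision

/-! ### The homotopy as a matrix over the algebraic subdivision. -/

namespace Subdivision

open scoped Classical

open Graded (idEntry app_comp_idEntry idEntry_comp_app idEntry_comp_idEntry idEntry_ne_zero)

variable {X : OrderedComplex.{w}} {𝒜 : Type u} [Category.{v} 𝒜] [Preadditive 𝒜]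

section Matrices

variable {var : Variance} (C : ChainComplex (SimplicialCat X var 𝒜) ℤ)

/-- A family whose objects occur in `C`. -/
abbrev fam {T : Type w} (p : T → ℤ) (f : T → X.Simplex) : Fam.{u, w} 𝒜 where
  Index := T
  obj t := (C.X (p t)).obj (f t)

variable {T T' T'' : Type w} (p : T → ℤ) (f : T → X.Simplex) (p' : T' → ℤ) (f' : T' → X.Simplex)
  (p'' : T'' → ℤ) (f'' : T'' → X.Simplex)

/-- A matrix of integral multiples of identities. -/
noncomputable def intMat (k : T → T' → ℤ) (hk : ∀ t, {t' | k t t' ≠ 0 ∧ f t = f' t'}.Finite) :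
    fam C p f ⟶ fam C p' f' :=
  Fam.Hom.mk (fun t t' => k t t' • idEntry C.X (p t) (p' t') (f t) (f' t')) fun t =>
    (hk t).subset fun t' h =>
      ⟨fun h' => h (by dsimp only; rw [h', zero_smul]),
        (idEntry_ne_zero fun h' => h (by dsimp only; rw [h', smul_zero])).2⟩

variable {p f p' f' p'' f''} {k : T → T' → ℤ} {k' : T' → T'' → ℤ}
  {hk : ∀ t, {t' | k t t' ≠ 0 ∧ f t = f' t'}.Finite} {hk' : ∀ t, {t' | k' t t' ≠ 0 ∧ f' t = f'' t'}.Finite}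

theorem intMat_app (t : T) (t' : T') : Fam.app (intMat C p f p' f' k hk) t t' =
    k t t' • idEntry C.X (p t) (p' t') (f t) (f' t') := rfl

theorem intMat_ne_zero {t : T} {t' : T'} (h : Fam.app (intMat C p f p' f' k hk) t t' ≠ 0) :
    k t t' ≠ 0 ∧ p t = p' t' ∧ f t = f' t' :=
  ⟨fun h' => h (by rw [intMat_app, h', zero_smul]),
    idEntry_ne_zero fun h' => h (by rw [intMat_app, h', smul_zero])⟩

theorem intMat_comp_app (t : T) (t'' : T'') (s : Finset T')
    (hs : ∀ t', k t t' * k' t' t'' ≠ 0 → t' ∈ s) (h : ∀ t', k t t' * k' t' t'' ≠ 0 →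
      p t = p' t' ∧ f t = f' t') :
    Fam.app (intMat C p f p' f' k hk ≫ intMat C p' f' p'' f'' k' hk') t t'' =
      (∑ t' ∈ s, k t t' * k' t' t'') • idEntry C.X (p t) (p'' t'') (f t) (f'' t'') := by
  rw [Fam.comp_app, Finset.sum_smul]
  have key : ∀ t', (k t t' • idEntry C.X (p t) (p' t') (f t) (f' t')) ≫
      (k' t' t'' • idEntry C.X (p' t') (p'' t'') (f' t') (f'' t'')) =
      (k t t' * k' t' t'') • idEntry C.X (p t) (p'' t'') (f t) (f'' t'') := fun t' => by
    rw [Preadditive.zsmul_comp, Preadditive.comp_zsmul, smul_smul]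
    by_cases h0 : k t t' * k' t' t'' = 0
    · rw [h0, zero_smul, zero_smul]
    · rw [idEntry_comp_idEntry C.X (h t' h0).1 (h t' h0).2]
  refine (finsum_congr key).trans (finsum_eq_sum_of_support_subset _ fun t' ht => ?_)
  exact hs t' fun h0 => ht (by dsimp only; rw [h0, zero_smul])

end Matrices

variable (r : Approx X) (var : Variance) (C : ChainComplex (SimplicialCat X var 𝒜) ℤ)

/-- The subdivision as a complex of families. -/
noncomputable abbrev cpx : ChainComplex (Fam.{u, w} 𝒜) ℤ where
  X n := fam C (deg r var n) r.map
  d n m := (Fam.ofComplex (complex r var C)).d n m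
  shape n m := (Fam.ofComplex (complex r var C)).shape n m
  d_comp_d' n m p := (Fam.ofComplex (complex r var C)).d_comp_d' n m p

local notation "𝐂" => Fam.ofComplex C
local notation "𝐃" => cpx r var C

theorem d_app {n m : ℤ} (h : m + 1 = n) (a b : X.sd.Simplex) :
    Fam.app ((𝐃).d n m) a b = entry r var C n m a b := by
  change Graded.app (if m + 1 = n then diff r var C n m else 0) a b = _
  rw [if_pos h]
  rfl

theorem d_supp (n m : ℤ) : Fam.SuppIn ((𝐃).d n m) fun a b : X.sd.Simplex => var.rel a b := fun a b h => by
  by_cases e : m + 1 = n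
  · exact entry_support r var C (by rw [← d_app r var C e]; exact h)
  · exact absurd (by rw [(𝐃).shape n m e]; rfl) h

theorem ofComplex_d_supp (n m : ℤ) : Fam.SuppIn ((𝐂).d n m) fun a b : X.Simplex => var.rel a b := fun a b h => by
  by_contra h'
  exact h (Graded.Hom.support _ _ _ h')

theorem finite_hty (a : X.sd.Simplex) (P : X.sd.Simplex → Prop) :
    {b | P b ∧ r.map a = r.map b}.Finite :=
  (fibre_finite r (r.map a)).subset fun _ h => h.2.symm

/-- The homotopy of `Sd_r C`. -/
noncomputable def H (n m : ℤ) : (𝐃).X n ⟶ (𝐃).X m :=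
  intMat C (deg r var n) r.map (deg r var m) r.map (fun a b => (m.negOnePow : ℤ) * hty r var a b)
    fun a => finite_hty r a _

theorem H_app (n m : ℤ) (a b : X.sd.Simplex) : Fam.app (H r var C n m) a b =
    ((m.negOnePow : ℤ) * hty r var a b) • idEntry C.X (deg r var n a) (deg r var m b) (r.map a) (r.map b) := rfl

theorem deg_of_hty {a b : X.sd.Simplex} (h : hty r var a b ≠ 0) {n m : ℤ} (hnm : n + 1 = m) :
    deg r var n a = deg r var m b := by
  have hr := congrArg Subtype.val (hty_ne_zero r var h)
  cases var
  · obtain ⟨-, -, h2, -⟩ := (labelling r).homotopy_ne_zero (chain a) (nonempty a) h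
    simp only [deg, exc, hr]
    omega
  · obtain ⟨-, -, h2, -⟩ := (labelling r).homotopy_ne_zero (chain b) (nonempty b) h
    simp only [deg, exc, hr]
    omega

theorem entry_fibre {n m : ℤ} {a b : X.sd.Simplex} (h : r.map a = r.map b) : entry r var C n m a b =
    (if a = b then Graded.app (C.d (deg r var n a) (deg r var m b)) (r.map a) (r.map b) else 0) +
      ((n.negOnePow : ℤ) * inc r var a b) • idEntry C.X _ _ _ _ := by
  have : (var.rel a b ∧ exc r a = exc r b) ↔ a = b :=
    ⟨fun h' => eq_of_rel_of_exc r var h'.1 h'.2 h, fun e => by subst e; exact ⟨Std.Refl.refl _, rfl⟩⟩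
  simp only [entry, this]

theorem negOnePow_mul_self (n : ℤ) : (n.negOnePow : ℤ) * n.negOnePow = 1 := by
  rw [← Units.val_mul, Int.units_mul_self, Units.val_one]

/-- `H` preserves images, so between simplices with the same image everything happens inside one
fibre. There `entry_fibre` applies, and the signs of the differential and of `H` cancel in the
incidence terms. The same holds for `H_comp_d`. -/
theorem d_comp_H {p n : ℤ} (hp : p + 1 = n) {a c : X.sd.Simplex} (h : r.map a = r.map c) :
    Fam.app ((𝐃).d n p ≫ H r var C p n) a c =
      ((n.negOnePow : ℤ) * hty r var a c) •
        Graded.app (C.d (deg r var n a) (deg r var n c)) (r.map a) (r.map c) +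
      (∑ b ∈ fibre r (r.map a), inc r var a b * hty r var b c) •
        idEntry C.X (deg r var n a) (deg r var n c) (r.map a) (r.map c) := by
  rw [Fam.comp_app, finsum_eq_sum_of_support_subset (s := fibre r (r.map a))]
  swap
  · intro b hb
    refine Finset.mem_coe.2 ((mem_fibre r).2 ?_)
    have : Fam.app (H r var C p n) b c ≠ 0 := fun h' => hb (by
      dsimp only
      rw [h']
      exact comp_zero)
    rw [h, (intMat_ne_zero C this).2.2]
  rw [Finset.sum_smul]
  have key : ∀ b ∈ fibre r (r.map a), Fam.app ((𝐃).d n p) a b ≫ Fam.app (H r var C p n) b c =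
      (if a = b then ((n.negOnePow : ℤ) * hty r var a c) •
        Graded.app (C.d (deg r var n a) (deg r var n c)) (r.map a) (r.map c) else 0) +
      (inc r var a b * hty r var b c) •
        idEntry C.X (deg r var n a) (deg r var n c) (r.map a) (r.map c) := by
    intro b hb
    have hb' := (mem_fibre r).1 hb
    rw [d_app r var C hp, H_app, entry_fibre r var C hb'.symm]
    refine (Preadditive.add_comp _ _ _ _ _ _).trans ?_
    congr 1
    · by_cases e : a = b
      · subst e
        rw [if_pos rfl, if_pos rfl, Preadditive.comp_zsmul]
        by_cases h0 : hty r var a c = 0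
        · rw [h0, mul_zero, zero_smul, zero_smul]
        · rw [app_comp_idEntry C (deg_of_hty r var h0 hp) h]
      · rw [if_neg e, if_neg e, zero_comp]
    · rw [Preadditive.zsmul_comp, Preadditive.comp_zsmul, smul_smul]
      by_cases h0 : inc r var a b = 0
      · rw [h0, mul_zero, zero_mul, zero_mul, zero_smul, zero_smul]
      · rw [idEntry_comp_idEntry C.X ((exc_of_inc r var h0 n).trans (by rw [← hp, add_sub_cancel_right]))
          hb'.symm]
        congr 1
        rw [mul_mul_mul_comm, negOnePow_mul_self, one_mul]
  rw [Finset.sum_congr rfl key, Finset.sum_add_distrib, Finset.sum_ite_eq,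
    if_pos ((mem_fibre r).2 rfl)]

theorem H_comp_d {n m : ℤ} (hm : n + 1 = m) {a c : X.sd.Simplex} (h : r.map a = r.map c) :
    Fam.app (H r var C n m ≫ (𝐃).d m n) a c =
      -((n.negOnePow : ℤ) * hty r var a c) •
        Graded.app (C.d (deg r var n a) (deg r var n c)) (r.map a) (r.map c) +
      (∑ b ∈ fibre r (r.map a), hty r var a b * inc r var b c) •
        idEntry C.X (deg r var n a) (deg r var n c) (r.map a) (r.map c) := by
  rw [Fam.comp_app, finsum_eq_sum_of_support_subset (s := fibre r (r.map a))]
  swap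
  · intro b hb
    refine Finset.mem_coe.2 ((mem_fibre r).2 ?_)
    have : Fam.app (H r var C n m) a b ≠ 0 := fun h' => hb (by
      dsimp only
      rw [h']
      exact zero_comp)
    rw [(intMat_ne_zero C this).2.2]
  rw [Finset.sum_smul]
  have key : ∀ b ∈ fibre r (r.map a), Fam.app (H r var C n m) a b ≫ Fam.app ((𝐃).d m n) b c =
      (if b = c then -((n.negOnePow : ℤ) * hty r var a c) •
        Graded.app (C.d (deg r var n a) (deg r var n c)) (r.map a) (r.map c) else 0) +
      (hty r var a b * inc r var b c) •
        idEntry C.X (deg r var n a) (deg r var n c) (r.map a) (r.map c) := by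
    intro b hb
    have hb' := (mem_fibre r).1 hb
    rw [d_app r var C hm, H_app, entry_fibre r var C (hb'.trans h)]
    refine (Preadditive.comp_add _ _ _ _ _ _).trans ?_
    congr 1
    · by_cases e : b = c
      · subst e
        rw [if_pos rfl, if_pos rfl, Preadditive.zsmul_comp]
        by_cases h0 : hty r var a b = 0
        · rw [h0, mul_zero, mul_zero, neg_zero, zero_smul, zero_smul]
        · rw [idEntry_comp_app C (deg_of_hty r var h0 hm) h, ← hm, Int.negOnePow_succ, Units.val_neg,
            neg_mul]
      · rw [if_neg e, if_neg e, comp_zero]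
    · rw [Preadditive.zsmul_comp, Preadditive.comp_zsmul, smul_smul]
      by_cases h0 : hty r var a b = 0
      · rw [h0, mul_zero, zero_mul, zero_mul, zero_smul, zero_smul]
      · rw [idEntry_comp_idEntry C.X (deg_of_hty r var h0 hm) hb'.symm]
        congr 1
        rw [mul_mul_mul_comm, negOnePow_mul_self, one_mul]
  rw [Finset.sum_congr rfl key, Finset.sum_add_distrib, Finset.sum_ite_eq',
    if_pos ((mem_fibre r).2 h.symm)]

/-- The sign of `H` is that of its target degree, so the diagonal terms of `d_C` in `dH` and `Hd`
are opposite. What remains is the integral homotopy equation of the fibre. -/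
theorem d_H_add_H_d {p n m : ℤ} (hp : p + 1 = n) (hm : n + 1 = m) {a c : X.sd.Simplex}
    (h : r.map a = r.map c) :
    Fam.app ((𝐃).d n p ≫ H r var C p n) a c + Fam.app (H r var C n m ≫ (𝐃).d m n) a c =
      Fam.app (𝟙 ((𝐃).X n)) a c - aug r var a c •
        idEntry C.X (deg r var n a) (deg r var n c) (r.map a) (r.map c) := by
  have h1 : Fam.app (𝟙 ((𝐃).X n)) a c = (if a = c then (1 : ℤ) else 0) •
      idEntry C.X (deg r var n a) (deg r var n c) (r.map a) (r.map c) := by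
    by_cases e : a = c
    · subst e
      rw [if_pos rfl, one_smul, Graded.idEntry_self]
      exact Fam.id_app_self _ _
    · rw [if_neg e, zero_smul]
      exact Fam.id_app_ne _ e
  rw [d_comp_H r var C hp h, H_comp_d r var C hm h, h1]
  refine Eq.trans ?_ (sub_smul _ _ _)
  rw [← sum_inc_hty r var h, add_smul, neg_smul]
  abel

theorem H_supp (n m : ℤ) : Fam.SuppIn (H r var C n m)
    fun a b : X.sd.Simplex => hty r var a b ≠ 0 := fun a b h h' =>
  (intMat_ne_zero C h).1 (by rw [h', mul_zero])

end Subdivision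

/-! ### Comparison of `C` with its subdivision in each degree. -/

namespace Subdivision

open scoped Classical

open Graded (idEntry app_comp_idEntry idEntry_comp_app idEntry_comp_idEntry idEntry_ne_zero)

variable {X : OrderedComplex.{w}} {𝒜 : Type u} [Category.{v} 𝒜] [Preadditive 𝒜]

theorem deg_eq_self (r : Approx X) (var : Variance) {a : X.sd.Simplex} (h : exc r a = 0) (n : ℤ) :
    deg r var n a = n := by
  cases var <;> simp [deg, h]

theorem finite_comp_ne_zero {M N P : Fam.{u, w} 𝒜} (f : M ⟶ N) (g : N ⟶ P) (σ : M.Index) (ρ : P.Index)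
    (s : Finset N.Index) (hs : ∀ τ, Fam.app f σ τ ≠ 0 → Fam.app g τ ρ ≠ 0 → τ ∈ s) :
    Fam.app (f ≫ g) σ ρ = ∑ τ ∈ s, Fam.app f σ τ ≫ Fam.app g τ ρ := by
  rw [Fam.comp_app]
  refine finsum_eq_sum_of_support_subset _ fun τ hτ => hs τ (fun h => hτ ?_) fun h => hτ ?_
  · dsimp only; rw [h]; exact zero_comp
  · dsimp only; rw [h]; exact comp_zero

theorem comp_app_single {M N P : Fam.{u, w} 𝒜} (f : M ⟶ N) (g : N ⟶ P) (σ : M.Index) (ρ : P.Index)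
    (τ : N.Index) (hs : ∀ τ', Fam.app f σ τ' ≠ 0 → Fam.app g τ' ρ ≠ 0 → τ' = τ) :
    Fam.app (f ≫ g) σ ρ = Fam.app f σ τ ≫ Fam.app g τ ρ := by
  rw [finite_comp_ne_zero f g σ ρ {τ} fun τ' h1 h2 => Finset.mem_singleton.2 (hs τ' h1 h2),
    Finset.sum_singleton]

section Upper

variable (r : Approx X) (C : ChainComplex (SimplicialCat X .upper 𝒜) ℤ)

/-- The projection of `Sd_r C` to `C` in each degree. -/
noncomputable def projMat (n : ℤ) : (cpx r .upper C).X n ⟶ (Fam.ofComplex C).X n :=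
  intMat C (deg r .upper n) r.map (fun _ => n) id (fun a _ => if exc r a = 0 then 1 else 0)
    fun a => (Set.finite_singleton (r.map a)).subset fun _ h => h.2.symm

/-- The inclusion of `C` in `Sd_r C` as the distinguished simplices. -/
noncomputable def inclMat (n : ℤ) : (Fam.ofComplex C).X n ⟶ (cpx r .upper C).X n :=
  intMat C (fun _ => n) id (deg r .upper n) r.map (fun τ a => if a = flag r τ then 1 else 0)
    fun τ => (Set.finite_singleton (flag r τ)).subset fun a h => by
      by_contra h'; exact h.1 (if_neg h')

theorem projMat_app (n : ℤ) (a : X.sd.Simplex) (τ : X.Simplex) : Fam.app (projMat r C n) a τ =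
    (if exc r a = 0 then (1 : ℤ) else 0) • idEntry C.X (deg r .upper n a) n (r.map a) τ := rfl

theorem sum_faces_smul_upper {a : X.sd.Simplex} {τ : X.Simplex} {p q : ℤ} (h : exc r a = 0) :
    (∑ b ∈ fibre r τ, (if exc r b = 0 ∧ b ≤ a then (1 : ℤ) else 0)) •
      Graded.app (C.d p q) (r.map a) τ = Graded.app (C.d p q) (r.map a) τ := by
  by_cases e : τ ≤ r.map a
  · rw [sum_faces r h e, one_smul]
  · have : Graded.app (C.d p q) (r.map a) τ = 0 := Graded.Hom.support _ _ _ e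
    rw [this, smul_zero]

/-- The terms with `d_C` agree by `sum_faces`. The incidence terms add up to zero, because
augmentation kills boundaries in a fibre (`sum_incidence_exc`). -/
theorem projMat_comm {n m : ℤ} (h : m + 1 = n) :
    projMat r C n ≫ (Fam.ofComplex C).d n m = (cpx r .upper C).d n m ≫ projMat r C m := by
  refine Fam.hom_ext fun (a : X.sd.Simplex) (τ : X.Simplex) => ?_
  refine (comp_app_single (projMat r C n) ((Fam.ofComplex C).d n m) a τ (r.map a) fun σ h _ =>
    (intMat_ne_zero C h).2.2.symm).trans ?_
  refine Eq.trans ?_ (finite_comp_ne_zero ((cpx r .upper C).d n m) (projMat r C m) a τ (fibre r τ)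
    fun b _ h => (mem_fibre r).2 (intMat_ne_zero C h).2.2).symm
  have key : ∀ b ∈ fibre r τ, Fam.app ((cpx r .upper C).d n m) a b ≫ Fam.app (projMat r C m) b τ =
      (if exc r a = 0 then (if exc r b = 0 ∧ b ≤ a then (1 : ℤ) else 0) •
        Graded.app (C.d (deg r .upper n a) m) (r.map a) τ else 0) +
      ((n.negOnePow : ℤ) * (if exc r b = 0 then inc r .upper a b else 0)) •
        idEntry C.X (deg r .upper n a) m (r.map a) τ := by
    intro b hb
    have hb' := (mem_fibre r).1 hb
    rw [d_app r .upper C h, projMat_app, entry]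
    refine (Preadditive.add_comp _ _ _ _ _ _).trans ?_
    by_cases e : exc r b = 0
    · have e2 := deg_eq_self r .upper e m
      simp only [e, if_true, true_and, one_smul]
      congr 1
      · by_cases e1 : exc r a = 0
        · by_cases e3 : b ≤ a
          · rw [if_pos ⟨e3, e1⟩, if_pos e1, if_pos e3, one_smul, app_comp_idEntry C e2 hb']
          · rw [if_neg fun h => e3 h.1, if_pos e1, if_neg e3, zero_smul, zero_comp]
        · rw [if_neg fun h => e1 h.2, if_neg e1, zero_comp]
      · rw [Preadditive.zsmul_comp]
        by_cases h0 : inc r .upper a b = 0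
        · rw [h0, mul_zero, zero_smul, zero_smul]
        · rw [idEntry_comp_idEntry C.X ((exc_of_inc r .upper h0 n).trans
            (by rw [← h, add_sub_cancel_right])) (map_of_inc r .upper h0)]
    · simp only [e, if_false, false_and, zero_smul, comp_zero, mul_zero, add_zero, ite_self]
  rw [Finset.sum_congr rfl key, Finset.sum_add_distrib, ← Finset.sum_smul, ← Finset.mul_sum]
  have h2 : ((n.negOnePow : ℤ) * ∑ b ∈ fibre r τ, (if exc r b = 0 then inc r .upper a b else 0)) •
        idEntry C.X (deg r .upper n a) m (r.map a) τ = 0 := by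
    by_cases e : r.map a = τ
    · subst e
      have := sum_incidence_exc r a
      rw [show ∑ b ∈ fibre r (r.map a), (if exc r b = 0 then inc r .upper a b else 0) = 0 from this,
        mul_zero, zero_smul]
    · by_contra h'
      exact e (idEntry_ne_zero (fun h'' => h' (by rw [h'', smul_zero]))).2
  rw [h2, add_zero, projMat_app]
  by_cases e : exc r a = 0
  · simp only [if_pos e, one_smul]
    rw [← Finset.sum_smul, sum_faces_smul_upper r C e]
    exact idEntry_comp_app C (deg_eq_self r .upper e n) rfl
  · simp only [if_neg e, zero_smul, Finset.sum_const_zero]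
    exact zero_comp

/-- The projection of `Sd_r C` to `C`. -/
noncomputable def projMap : cpx r .upper C ⟶ Fam.ofComplex C where
  f := projMat r C
  comm' _ _ h := projMat_comm r C h

theorem inclMat_projMat (n : ℤ) : inclMat r C n ≫ projMat r C n = 𝟙 _ := by
  refine Fam.hom_ext fun (σ : X.Simplex) (τ : X.Simplex) => ?_
  refine (intMat_comp_app C σ τ {flag r σ} (fun a h => ?_) fun a h => ?_).trans ?_
  · by_contra h'
    exact left_ne_zero_of_mul h (if_neg fun e => h' (Finset.mem_singleton.2 e))
  · have e : a = flag r σ := by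
      by_contra h'
      exact left_ne_zero_of_mul h (if_neg h')
    subst e
    exact ⟨(deg_eq_self r .upper (exc_flag r σ) n).symm, (map_flag r σ).symm⟩
  · rw [Finset.sum_singleton, if_pos rfl, if_pos (exc_flag r σ), one_mul, one_smul]
    by_cases e : σ = τ
    · subst e
      rw [Fam.id_app_self]
      exact Graded.idEntry_self _ _ _
    · rw [Fam.id_app_ne _ e]
      by_contra h
      exact e (idEntry_ne_zero h).2

/-- `H` adds a vertex without changing the image, so its targets have positive excess, and the
projection ignores these. -/
theorem H_projMat (n m : ℤ) : H r .upper C n m ≫ projMat r C m = 0 := by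
  refine Fam.hom_ext fun (a : X.sd.Simplex) (τ : X.Simplex) => ?_
  by_contra h
  obtain ⟨b, h1, h2⟩ := Fam.exists_of_comp_app_ne_zero h
  refine exc_of_homotopy r (H_supp r .upper C n m a b h1) ?_
  by_contra h'
  exact (intMat_ne_zero C h2).1 (if_neg h')

theorem projMat_inclMat_app (n : ℤ) (a c : X.sd.Simplex) :
    Fam.app (projMat r C n ≫ inclMat r C n) a c =
      aug r .upper a c • idEntry C.X (deg r .upper n a) (deg r .upper n c) (r.map a) (r.map c) := by
  refine (comp_app_single (projMat r C n) (inclMat r C n) a c (r.map a) fun σ h _ =>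
    (intMat_ne_zero C h).2.2.symm).trans ?_
  rw [projMat_app]
  have : Fam.app (inclMat r C n) (r.map a) c = (if c = flag r (r.map a) then (1 : ℤ) else 0) •
    idEntry C.X n (deg r .upper n c) (r.map a) (r.map c) := rfl
  rw [this]
  change (_ • idEntry C.X (deg r .upper n a) n (r.map a) (r.map a)) ≫ (_ • idEntry C.X n (deg r .upper n c) (r.map a) (r.map c)) = _
  rw [Preadditive.zsmul_comp, Preadditive.comp_zsmul, smul_smul]
  by_cases e : exc r a = 0
  · rw [idEntry_comp_idEntry C.X (deg_eq_self r .upper e n) rfl]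
    congr 1
    simp [aug, e]
  · simp [aug, e]

end Upper

section Lower

variable (r : Approx X) (C : ChainComplex (SimplicialCat X .lower 𝒜) ℤ)

/-- The inclusion of `C` in `Sd_r C` in each degree. -/
noncomputable def sumMat (n : ℤ) : (Fam.ofComplex C).X n ⟶ (cpx r .lower C).X n :=
  intMat C (fun _ => n) id (deg r .lower n) r.map (fun _ a => if exc r a = 0 then 1 else 0)
    fun τ => (fibre_finite r τ).subset fun _ h => h.2.symm

/-- The projection of `Sd_r C` to the distinguished simplices. -/
noncomputable def flagMat (n : ℤ) : (cpx r .lower C).X n ⟶ (Fam.ofComplex C).X n :=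
  intMat C (deg r .lower n) r.map (fun _ => n) id (fun a τ => if a = flag r τ then 1 else 0)
    fun a => (Set.finite_singleton (r.map a)).subset fun _ h => h.2.symm

theorem sumMat_app (n : ℤ) (τ : X.Simplex) (a : X.sd.Simplex) : Fam.app (sumMat r C n) τ a =
    (if exc r a = 0 then (1 : ℤ) else 0) • idEntry C.X n (deg r .lower n a) τ (r.map a) := rfl

theorem sum_faces_smul_lower {a : X.sd.Simplex} {τ : X.Simplex} {p q : ℤ} (h : exc r a = 0) :
    (∑ b ∈ fibre r τ, (if exc r b = 0 ∧ b ≤ a then (1 : ℤ) else 0)) •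
      Graded.app (C.d p q) τ (r.map a) = Graded.app (C.d p q) τ (r.map a) := by
  by_cases e : τ ≤ r.map a
  · rw [sum_faces r h e, one_smul]
  · have : Graded.app (C.d p q) τ (r.map a) = 0 := Graded.Hom.support _ _ _ e
    rw [this, smul_zero]

/-- The transpose of `projMat_comm`: for cochains the chain map goes from `C` to the subdivision,
diagonally into all simplices of excess zero, and it is justified by the same two sums. -/
theorem sumMat_comm {n m : ℤ} (h : m + 1 = n) :
    sumMat r C n ≫ (cpx r .lower C).d n m = (Fam.ofComplex C).d n m ≫ sumMat r C m := by
  refine Fam.hom_ext fun (τ : X.Simplex) (c : X.sd.Simplex) => ?_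
  refine Eq.trans ?_ (comp_app_single ((Fam.ofComplex C).d n m) (sumMat r C m) τ c (r.map c)
    fun σ _ h => (intMat_ne_zero C h).2.2).symm
  refine (finite_comp_ne_zero (sumMat r C n) ((cpx r .lower C).d n m) τ c (fibre r τ) fun b h _ =>
    (mem_fibre r).2 (intMat_ne_zero C h).2.2.symm).trans ?_
  have key : ∀ b ∈ fibre r τ, Fam.app (sumMat r C n) τ b ≫ Fam.app ((cpx r .lower C).d n m) b c =
      (if exc r c = 0 then (if exc r b = 0 ∧ b ≤ c then (1 : ℤ) else 0) •
        Graded.app (C.d n (deg r .lower m c)) τ (r.map c) else 0) +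
      ((n.negOnePow : ℤ) * (if exc r b = 0 then inc r .lower b c else 0)) •
        idEntry C.X n (deg r .lower m c) τ (r.map c) := by
    intro b hb
    have hb' := (mem_fibre r).1 hb
    rw [d_app r .lower C h, sumMat_app, entry]
    refine (Preadditive.comp_add _ _ _ _ _ _).trans ?_
    by_cases e : exc r b = 0
    · have e2 := deg_eq_self r .lower e n
      simp only [e, if_true, true_and, one_smul]
      congr 1
      · by_cases e1 : exc r c = 0
        · by_cases e3 : b ≤ c
          · rw [if_pos ⟨e3, e1.symm⟩, if_pos e1, if_pos e3, one_smul, idEntry_comp_app C e2.symm hb'.symm]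
          · rw [if_neg fun h => e3 h.1, if_pos e1, if_neg e3, zero_smul, comp_zero]
        · rw [if_neg fun h => e1 h.2.symm, if_neg e1, comp_zero]
      · rw [Preadditive.comp_zsmul, idEntry_comp_idEntry C.X e2.symm hb'.symm]
    · simp only [e, if_false, false_and, zero_smul, zero_comp, mul_zero, add_zero, ite_self]
  rw [Finset.sum_congr rfl key, Finset.sum_add_distrib, ← Finset.sum_smul, ← Finset.mul_sum]
  have h2 : ((n.negOnePow : ℤ) * ∑ b ∈ fibre r τ, (if exc r b = 0 then inc r .lower b c else 0)) •
        idEntry C.X n (deg r .lower m c) τ (r.map c) = 0 := by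
    by_cases e : r.map c = τ
    · subst e
      have := sum_incidence_exc r c
      rw [show ∑ b ∈ fibre r (r.map c), (if exc r b = 0 then inc r .lower b c else 0) = 0 from this,
        mul_zero, zero_smul]
    · by_contra h'
      exact e (idEntry_ne_zero (fun h'' => h' (by rw [h'', smul_zero]))).2.symm
  rw [h2, add_zero, sumMat_app]
  by_cases e : exc r c = 0
  · simp only [if_pos e, one_smul]
    rw [← Finset.sum_smul, sum_faces_smul_lower r C e]
    exact (app_comp_idEntry C (deg_eq_self r .lower e m).symm rfl).symm
  · simp only [if_neg e, zero_smul, Finset.sum_const_zero]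
    exact comp_zero.symm

/-- The inclusion of `C` in `Sd_r C`. -/
noncomputable def sumMap : Fam.ofComplex C ⟶ cpx r .lower C where
  f := sumMat r C
  comm' _ _ h := sumMat_comm r C h

theorem sumMat_flagMat (n : ℤ) : sumMat r C n ≫ flagMat r C n = 𝟙 _ := by
  refine Fam.hom_ext fun (σ : X.Simplex) (τ : X.Simplex) => ?_
  have key : ∀ a, (if exc r a = 0 then (1 : ℤ) else 0) * (if a = flag r τ then 1 else 0) =
      if a = flag r τ then 1 else 0 := fun a => by
    by_cases e : a = flag r τ
    · subst e
      rw [if_pos (exc_flag r τ), one_mul]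
    · rw [if_neg e, mul_zero]
  by_cases e : σ = τ
  · subst e
    refine (intMat_comp_app C σ σ {flag r σ} (fun a h => ?_) fun a h => ?_).trans ?_
    · by_contra h'
      exact right_ne_zero_of_mul h (if_neg fun e => h' (Finset.mem_singleton.2 e))
    · have e : a = flag r σ := by
        by_contra h'
        exact right_ne_zero_of_mul h (if_neg h')
      subst e
      exact ⟨(deg_eq_self r .lower (exc_flag r σ) n).symm, (map_flag r σ).symm⟩
    · rw [Finset.sum_singleton, key, if_pos rfl, one_smul, Fam.id_app_self]
      exact Graded.idEntry_self _ _ _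
  · rw [Fam.id_app_ne _ e]
    by_contra h
    obtain ⟨a, h1, h2⟩ := Fam.exists_of_comp_app_ne_zero h
    exact e ((intMat_ne_zero C h1).2.2.trans (intMat_ne_zero C h2).2.2)

theorem sumMat_H (n m : ℤ) : sumMat r C n ≫ H r .lower C n m = 0 := by
  refine Fam.hom_ext fun (τ : X.Simplex) (b : X.sd.Simplex) => ?_
  by_contra h
  obtain ⟨a, h1, h2⟩ := Fam.exists_of_comp_app_ne_zero h
  refine exc_of_homotopy r (H_supp r .lower C n m a b h2) ?_
  by_contra h'
  exact (intMat_ne_zero C h1).1 (if_neg h')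

theorem flagMat_sumMat_app (n : ℤ) (a c : X.sd.Simplex) :
    Fam.app (flagMat r C n ≫ sumMat r C n) a c =
      aug r .lower a c • idEntry C.X (deg r .lower n a) (deg r .lower n c) (r.map a) (r.map c) := by
  refine (comp_app_single (flagMat r C n) (sumMat r C n) a c (r.map c) fun σ _ h =>
    (intMat_ne_zero C h).2.2).trans ?_
  rw [sumMat_app]
  change ((if a = flag r (r.map c) then (1 : ℤ) else 0) • idEntry C.X (deg r .lower n a) n (r.map a) (r.map c)) ≫
    (_ • idEntry C.X n (deg r .lower n c) (r.map c) (r.map c)) = _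
  rw [Preadditive.zsmul_comp, Preadditive.comp_zsmul, smul_smul]
  by_cases e : a = flag r (r.map c)
  · rw [idEntry_comp_idEntry C.X (by rw [e, deg_eq_self r .lower (exc_flag r _)])
      (by rw [e, map_flag])]
    congr 1
    simp [aug, ← e]
  · simp [aug, e]

end Lower

end Subdivision

/-! ### The error of the homotopy is nilpotent, and `C` is a retract of its subdivision. -/

namespace Subdivision

open scoped Classical

variable {X : OrderedComplex.{w}} {𝒜 : Type u} [Category.{v} 𝒜] [Preadditive 𝒜]

section Error

variable (r : Approx X) (var : Variance) (C : ChainComplex (SimplicialCat X var 𝒜) ℤ)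

/-- The failure of the homotopy of `Sd_r C` to connect the identity and `Q`. -/
noncomputable def err (Q : ∀ n, (cpx r var C).X n ⟶ (cpx r var C).X n) (n : ℤ) :
    (cpx r var C).X n ⟶ (cpx r var C).X n :=
  𝟙 _ - Q n - (cpx r var C).d n (n - 1) ≫ H r var C (n - 1) n - H r var C n (n + 1) ≫ (cpx r var C).d (n + 1) n

variable {Q : ∀ n, (cpx r var C).X n ⟶ (cpx r var C).X n}
    (hQ : ∀ n (a c : X.sd.Simplex), Fam.app (Q n) a c =
      aug r var a c • Graded.idEntry C.X (deg r var n a) (deg r var n c) (r.map a) (r.map c))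

include hQ in
-- All matrices involved are triangular for the images in `X`, and inside a fibre the homotopy
-- equation is exact. So the error always moves to a strictly smaller, respectively larger, simplex
-- of `X`.
theorem err_supp (n : ℤ) : Fam.SuppIn (err r var C Q n)
    fun a c : X.sd.Simplex => var.rel (r.map a) (r.map c) ∧ r.map a ≠ r.map c := by
  intro (a : X.sd.Simplex) (c : X.sd.Simplex) h
  refine ⟨?_, fun e => h ?_⟩
  · have hd : ∀ n m, Fam.SuppIn ((cpx r var C).d n m)
        fun a c : X.sd.Simplex => var.rel (r.map a) (r.map c) :=
      fun n m a c h => map_rel r var (d_supp r var C n m a c h)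
    have hH : ∀ n m, Fam.SuppIn (H r var C n m) fun a c : X.sd.Simplex => var.rel (r.map a) (r.map c) :=
      fun n m a c h => by
        dsimp only
        rw [hty_ne_zero r var (H_supp r var C n m a c h)]
        exact Std.Refl.refl _
    have h1 : Fam.SuppIn (𝟙 ((cpx r var C).X n)) fun a c : X.sd.Simplex => var.rel (r.map a) (r.map c) :=
      fun a c h => by
        by_cases e : a = c
        · subst e; exact Std.Refl.refl _
        · exact absurd (Fam.id_app_ne _ e) h
    have h2 : Fam.SuppIn (Q n) fun a c : X.sd.Simplex => var.rel (r.map a) (r.map c) := fun a c h => by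
      rw [hQ n a c] at h
      have e : r.map a = r.map c := (Graded.idEntry_ne_zero (M := C.X) (p := deg r var n a)
        (q := deg r var n c) fun h' => h (by rw [h', smul_zero])).2
      exact e ▸ Std.Refl.refl _
    have tr : ∀ a b c : X.sd.Simplex, var.rel (r.map a) (r.map b) → var.rel (r.map b) (r.map c) →
      var.rel (r.map a) (r.map c) := fun a b c => IsTrans.trans (r := var.rel) _ _ _
    exact ((h1.sub h2).sub ((hd _ _).comp (hH _ _) tr)).sub ((hH _ _).comp (hd _ _) tr) a c h
  · have := d_H_add_H_d r var C (sub_add_cancel n 1) rfl e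
    rw [err, Fam.sub_app, Fam.sub_app, Fam.sub_app, hQ n a c, sub_sub, this]
    exact sub_self _

include hQ in
-- The number of vertices of the image, for `lower` counted down from `d + 1`, is a rank with values
-- below `d + 2` that the error strictly lowers.
theorem err_pow {d : ℕ} (hd : ∀ s ∈ X.K.faces, s.card ≤ d + 1) (n : ℤ) :
    End.of (err r var C Q n) ^ (d + 2) = 0 := by
  have hs := err_supp r var C hQ n
  have hlt : ∀ {a b : X.Simplex}, a ≤ b → a ≠ b → a.1.card < b.1.card := fun h h' =>
    Finset.card_lt_card (lt_of_le_of_ne h fun e => h' (Subtype.ext e))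
  cases var
  · refine Fam.pow_eq_zero _ (fun a : X.sd.Simplex => (r.map a).1.card) _
      (fun a => by have := hd _ (r.map a).2; omega) fun a c h => ?_
    exact hlt (hs a c h).1 (hs a c h).2.symm
  · refine Fam.pow_eq_zero _ (fun a : X.sd.Simplex => d + 1 - (r.map a).1.card) _
      (fun a => by omega) fun a c h => ?_
    have h1 := hlt (hs a c h).1 (hs a c h).2
    have h2 := hd _ (r.map c).2
    dsimp only
    omega

theorem err_eq (Q : ∀ n, (cpx r var C).X n ⟶ (cpx r var C).X n) (p n m : ℤ) (hp : p + 1 = n)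
    (hm : n + 1 = m) : err r var C Q n =
      𝟙 _ - Q n - (cpx r var C).d n p ≫ H r var C p n - H r var C n m ≫ (cpx r var C).d m n := by
  obtain rfl : p = n - 1 := by omega
  subst hm
  rfl

end Error

/-- The projection of the subdivision to the complex has a section which, geometrically, does not
leave the simplices. -/
theorem exists_section_upper (r : Approx X) (C : ChainComplex (SimplicialCat X .upper 𝒜) ℤ) {d : ℕ}
    (hd : ∀ s ∈ X.K.faces, s.card ≤ d + 1) :
    ∃ (e : Fam.ofComplex (complex r .upper C) ⟶ Fam.ofComplex C)
      (f : Fam.ofComplex C ⟶ Fam.ofComplex (complex r .upper C)), f ≫ e = 𝟙 _ ∧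
      (∀ n, Fam.SuppIn (e.f n) fun (a : X.sd.Simplex) (τ : X.Simplex) => r.map a = τ) ∧
      ∀ n, Fam.SuppIn (f.f n) fun (τ : X.Simplex) (a : X.sd.Simplex) =>
        ∀ s ∈ a.1, (show X.Simplex from s) ≤ τ := by
  have key := iterate_correct (projMap r C) (inclMat r C) (H r .upper C)
    (err r .upper C fun n => projMat r C n ≫ inclMat r C n) (inclMat_projMat r C)
    (fun n m _ => H_projMat r C n m) (err_eq r .upper C _) (d + 2)
    (err_pow r .upper C (projMat_inclMat_app r C) hd)
  refine ⟨projMap r C, chainMapOfDefect _ fun n => (key n).2, ?_, fun n a τ h =>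
    (intMat_ne_zero C (show Fam.app (projMat r C n) a τ ≠ 0 from h)).2.2, fun n => ?_⟩
  · exact HomologicalComplex.Hom.ext (funext fun n => (key n).1)
  · change Fam.SuppIn ((correct (H r .upper C))^[d + 2] (inclMat r C) n) _
    -- The support condition survives any number of corrections: flags of `τ` lie in `τ`, and
    -- passing to faces or applying `H` does not leave `τ`.
    generalize d + 2 = k
    induction k generalizing n with
    | zero =>
      intro τ a h
      have : a = flag r τ := by
        by_contra h'
        exact (intMat_ne_zero C (show Fam.app (inclMat r C n) τ a ≠ 0 from h)).1 (if_neg h')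
      subst this
      exact flag_le r
    | succ k ih =>
      rw [Function.iterate_succ_apply']
      refine (ih n).sub (Fam.SuppIn.comp (Q := fun (τ : X.Simplex) (a : X.sd.Simplex) =>
        ∀ s ∈ a.1, (show X.Simplex from s) ≤ τ) (Fam.SuppIn.sub ?_ ?_) (H_supp r .upper C _ _) ?_)
      · exact (ih n).comp (d_supp r .upper C _ _) fun τ a b h1 h2 s hs => h1 s (h2 hs)
      · exact (ofComplex_d_supp .upper C _ _).comp (ih _) fun τ σ b h1 h2 s hs => (h2 s hs).trans h1
      · exact fun τ a b h1 h2 s hs => ((labelling r).homotopy_ne_zero (chain a) (nonempty a) h2).2.2.2 τ h1 s hs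

/-- The inclusion of the complex in its subdivision has a retraction which, geometrically, does not
leave the simplices. -/
theorem exists_retraction_lower (r : Approx X) (C : ChainComplex (SimplicialCat X .lower 𝒜) ℤ) {d : ℕ}
    (hd : ∀ s ∈ X.K.faces, s.card ≤ d + 1) :
    ∃ (e : Fam.ofComplex C ⟶ Fam.ofComplex (complex r .lower C))
      (f : Fam.ofComplex (complex r .lower C) ⟶ Fam.ofComplex C), e ≫ f = 𝟙 _ ∧
      (∀ n, Fam.SuppIn (e.f n) fun (τ : X.Simplex) (a : X.sd.Simplex) => r.map a = τ) ∧
      ∀ n, Fam.SuppIn (f.f n) fun (a : X.sd.Simplex) (τ : X.Simplex) =>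
        ∀ s ∈ a.1, (show X.Simplex from s) ≤ τ := by
  have key := iterate_cocorrect (sumMap r C) (flagMat r C) (H r .lower C)
    (err r .lower C fun n => flagMat r C n ≫ sumMat r C n) (sumMat_flagMat r C)
    (fun n m _ => sumMat_H r C n m) (err_eq r .lower C _) (d + 2)
    (err_pow r .lower C (flagMat_sumMat_app r C) hd)
  refine ⟨sumMap r C, chainMapOfDefect _ fun n => (key n).2, ?_, fun n τ a h =>
    (intMat_ne_zero C (show Fam.app (sumMat r C n) τ a ≠ 0 from h)).2.2.symm, fun n => ?_⟩
  · exact HomologicalComplex.Hom.ext (funext fun n => (key n).1)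
  · change Fam.SuppIn ((cocorrect (H r .lower C))^[d + 2] (flagMat r C) n) _
    generalize d + 2 = k
    induction k generalizing n with
    | zero =>
      intro a τ h
      have : a = flag r τ := by
        by_contra h'
        exact (intMat_ne_zero C (show Fam.app (flagMat r C n) a τ ≠ 0 from h)).1 (if_neg h')
      subst this
      exact flag_le r
    | succ k ih =>
      rw [Function.iterate_succ_apply']
      refine (ih n).add (Fam.SuppIn.comp (Q' := fun (a : X.sd.Simplex) (τ : X.Simplex) =>
        ∀ s ∈ a.1, (show X.Simplex from s) ≤ τ) (H_supp r .lower C _ _) (Fam.SuppIn.sub ?_ ?_) ?_)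
      · exact (ih _).comp (ofComplex_d_supp .lower C _ _) fun a τ σ h1 h2 s hs => (h1 s hs).trans h2
      · exact (d_supp r .lower C _ _).comp (ih _) fun a b τ h1 h2 s hs => h2 s (h1 hs)
      · exact fun a b τ h1 h2 s hs =>
          ((labelling r).homotopy_ne_zero (chain b) (nonempty b) h1).2.2.2 τ h2 s hs

end Subdivision

/-! ### Iterated subdivisions. -/

namespace OrderedComplex

variable {X : OrderedComplex.{w}}

/-- The members of a chain of simplices have different numbers of vertices, all between `1` and `d +
1`. -/
theorem card_le_sdIter {d : ℕ} (hd : ∀ s ∈ X.K.faces, s.card ≤ d + 1) (j : ℕ) :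
    ∀ s ∈ (X.sdIter j).K.faces, s.card ≤ d + 1 := by
  induction j with
  | zero => exact hd
  | succ j ih =>
    intro c hc
    have h : c.card ≤ (Finset.Icc 1 (d + 1)).card := by
      refine Finset.card_le_card_of_injOn (fun s => (Subtype.val (show (X.sdIter j).Simplex from s)).card)
        (fun s _ => ?_) fun s hs t ht h => ?_
      · have h := Subtype.property (show (X.sdIter j).Simplex from s)
        exact Finset.mem_coe.2 (Finset.mem_Icc.2 ⟨((X.sdIter j).nonempty_of_mem h).card_pos, ih _ h⟩)
      · rcases hc.2 s hs t ht with h' | h'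
        · exact Subtype.ext (Finset.eq_of_subset_of_card_le h' h.ge)
        · exact (Subtype.ext (Finset.eq_of_subset_of_card_le h' h.le)).symm
    simpa using h

theorem average_mem_cell {T : Type*} {s : Finset T} (hs : s.Nonempty) {p : T → X.V → ℝ} {σ : Finset X.V}
    (h : ∀ v ∈ s, p v ∈ X.cell σ) : (s.card : ℝ)⁻¹ • ∑ v ∈ s, p v ∈ X.cell σ := by
  have hc : (s.card : ℝ) ≠ 0 := by exact_mod_cast hs.card_pos.ne'
  refine ⟨fun u => ?_, fun u hu => ?_, ?_⟩
  · rw [Pi.smul_apply, Finset.sum_apply, smul_eq_mul]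
    exact mul_nonneg (by positivity) (Finset.sum_nonneg fun v hv => (h v hv).1 u)
  · rw [Pi.smul_apply, Finset.sum_apply, Finset.sum_eq_zero fun v hv => (h v hv).2.1 u hu, smul_zero]
  · simp only [Pi.smul_apply, Finset.sum_apply, smul_eq_mul]
    rw [← Finset.mul_sum, Finset.sum_comm, Finset.sum_congr rfl fun v hv => (h v hv).2.2,
      Finset.sum_const, nsmul_eq_mul, mul_one, inv_mul_cancel₀ hc]

theorem pos_zero_mem_cell {σ : Finset X.V} {v : X.V} (hv : v ∈ σ) : X.pos 0 v ∈ X.cell σ := by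
  classical
  have h : ∀ u, X.pos 0 v u = if u = v then 1 else 0 := fun u => by
    unfold pos
    rw [Pi.single_apply]
  refine ⟨fun u => ?_, fun u hu => ?_, ?_⟩
  · rw [h]; split_ifs <;> norm_num
  · rw [h, if_neg fun e : u = v => hu (e ▸ hv)]
  · simp only [h]
    rw [Finset.sum_ite_eq', if_pos hv]

/-- The map of `Sd^j X` to `X` on simplices. -/
noncomputable def mapIter (r : ∀ j, Approx (X.sdIter j)) : (j : ℕ) → (X.sdIter j).Simplex → X.Simplex
  | 0 => id
  | j + 1 => fun a => mapIter r j ((r j).map a)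

theorem exists_of_mem_mapIter (r : ∀ j, Approx (X.sdIter j)) {j : ℕ} {a : (X.sdIter j).Simplex} {u : X.V}
    (hu : u ∈ (mapIter r j a).1) : ∃ v ∈ a.1, rIter r j v = u := by
  classical
  induction j with
  | zero => exact ⟨u, hu, rfl⟩
  | succ j ih =>
    obtain ⟨v, hv, rfl⟩ := ih hu
    obtain ⟨w, hw, rfl⟩ := Finset.mem_image.1 hv
    exact ⟨w, hw, rfl⟩

end OrderedComplex

theorem section_comp {𝒢 : Type*} [Category 𝒢] {A B D : 𝒢} {F : A ⟶ B} {f : B ⟶ D} {e : D ⟶ B} {G : B ⟶ A}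
    (h : f ≫ e = 𝟙 B) (h' : F ≫ G = 𝟙 A) : (F ≫ f) ≫ e ≫ G = 𝟙 A := by
  rw [Category.assoc, ← Category.assoc f, h, Category.id_comp, h']

section

variable {X : OrderedComplex.{w}} {𝒜 : Type u} [Category.{v} 𝒜] [Preadditive 𝒜]
  (r : ∀ j, Approx (X.sdIter j)) {d : ℕ} (hd : ∀ s ∈ X.K.faces, s.card ≤ d + 1)

include hd

/-- The sections of the single steps are composed. A barycentre of vertices in a cell is in that
cell, so `F` stays inside `τ` geometrically. In contrast `G` only follows the simplicial map, which
is what later pulls nearby simplices into `τ`. -/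
theorem exists_sdIter_upper (C : ChainComplex (SimplicialCat X .upper 𝒜) ℤ) (j : ℕ) :
    ∃ (F : Fam.ofComplex C ⟶ Fam.ofComplex (sdComplex r C j))
      (G : Fam.ofComplex (sdComplex r C j) ⟶ Fam.ofComplex C), F ≫ G = 𝟙 _ ∧
      (∀ n, Fam.SuppIn (F.f n) fun (τ : X.Simplex) (a : (X.sdIter j).Simplex) =>
        ∀ v ∈ a.1, X.pos j v ∈ X.cell τ.1) ∧
      ∀ n, Fam.SuppIn (G.f n) fun (a : (X.sdIter j).Simplex) (τ : X.Simplex) => mapIter r j a = τ := by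
  induction j with
  | zero =>
    have h : ∀ n (σ τ : X.Simplex), Fam.app (𝟙 ((Fam.ofComplex C).X n)) σ τ ≠ 0 → σ = τ :=
      fun n σ τ h => by
        by_contra e
        exact h (Fam.id_app_ne ((Fam.ofComplex C).X n) e)
    refine ⟨𝟙 _, 𝟙 _, Category.comp_id _, fun n (σ : X.Simplex) (τ : X.Simplex) h' => ?_, h⟩
    cases h n σ τ h'
    exact fun v hv => pos_zero_mem_cell hv
  | succ j ih =>
    obtain ⟨F, G, hFG, hF, hG⟩ := ih
    obtain ⟨e, f, hfe, he, hf⟩ := Subdivision.exists_section_upper (r j) (sdComplex r C j)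
      (card_le_sdIter hd j)
    refine ⟨F ≫ f, e ≫ G, ?_, fun n => ?_, fun n => ?_⟩
    · exact section_comp hfe hFG
    · refine (hF n).comp (hf n) fun τ b a h1 h2 s hs => ?_
      exact average_mem_cell ((X.sdIter j).nonempty_of_mem s.2) fun v hv => h1 v (h2 s hs hv)
    · exact (he n).comp (hG n) fun a b τ h1 h2 => (congrArg (mapIter r j) h1).trans h2

/-- As for `upper`, with the roles exchanged: `F` follows the simplicial map backwards, and `G`
leads from a simplex to simplices of `X` that contain it geometrically. -/
theorem exists_sdIter_lower (C : ChainComplex (SimplicialCat X .lower 𝒜) ℤ) (j : ℕ) :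
    ∃ (F : Fam.ofComplex C ⟶ Fam.ofComplex (sdComplex r C j))
      (G : Fam.ofComplex (sdComplex r C j) ⟶ Fam.ofComplex C), F ≫ G = 𝟙 _ ∧
      (∀ n, Fam.SuppIn (F.f n) fun (τ : X.Simplex) (a : (X.sdIter j).Simplex) => mapIter r j a = τ) ∧
      ∀ n, Fam.SuppIn (G.f n) fun (a : (X.sdIter j).Simplex) (τ : X.Simplex) =>
        ∀ v ∈ a.1, X.pos j v ∈ X.cell τ.1 := by
  induction j with
  | zero =>
    have h : ∀ n (σ τ : X.Simplex), Fam.app (𝟙 ((Fam.ofComplex C).X n)) σ τ ≠ 0 → σ = τ :=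
      fun n σ τ h => by
        by_contra e
        exact h (Fam.id_app_ne ((Fam.ofComplex C).X n) e)
    refine ⟨𝟙 _, 𝟙 _, Category.comp_id _, fun n σ τ h' => (h n σ τ h').symm,
      fun n (σ : X.Simplex) (τ : X.Simplex) h' => ?_⟩
    cases h n σ τ h'
    exact fun v hv => pos_zero_mem_cell hv
  | succ j ih =>
    obtain ⟨F, G, hFG, hF, hG⟩ := ih
    obtain ⟨e, f, hef, he, hf⟩ := Subdivision.exists_retraction_lower (r j) (sdComplex r C j)
      (card_le_sdIter hd j)
    refine ⟨F ≫ e, f ≫ G, ?_, fun n => ?_, fun n => ?_⟩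
    · exact section_comp hef hFG
    · exact (hF n).comp (he n) fun τ b a h1 h2 => (congrArg (mapIter r j) h2).trans h1
    · refine (hf n).comp (hG n) fun a b τ h1 h2 s hs => ?_
      exact average_mem_cell ((X.sdIter j).nonempty_of_mem s.2) fun v hv => h2 v (h1 s hs hv)

end

/-! ### Triangular matrices: local and global contractibility. -/

section

variable {Y : OrderedComplex.{w}} {var : Variance} {𝒜 : Type u} [Category.{v} 𝒜] [Preadditive 𝒜]
  (C : ChainComplex (SimplicialCat Y var 𝒜) ℤ)

/-- By antisymmetry, a path of two steps from `σ` back to `σ` stays at `σ`. -/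
theorem Fam.comp_app_diag {S : Type w} {R : S → S → Prop} [Std.Antisymm R] {M N P : Graded S R 𝒜}
    {f : Fam.ofGraded M ⟶ Fam.ofGraded N} {g : Fam.ofGraded N ⟶ Fam.ofGraded P} (hf : Fam.SuppIn f R)
    (hg : Fam.SuppIn g R) (σ : S) :
    Fam.app (f ≫ g) σ σ = Fam.app f σ σ ≫ Fam.app g σ σ :=
  Subdivision.comp_app_single f g σ σ σ fun τ h1 h2 => Std.Antisymm.antisymm (r := R) _ _ (hg τ σ h2) (hf σ τ h1)

theorem Fam.ofHom_supp {S : Type w} {R : S → S → Prop} [Std.Refl R] [IsTrans S R] {M N : Graded S R 𝒜}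
    (f : M ⟶ N) : Fam.SuppIn (Fam.ofHom f) R := fun σ τ h => by
  by_contra h'
  exact h (Graded.Hom.support f σ τ h')

theorem Graded.comp_app_diag {S : Type w} {R : S → S → Prop} [Std.Refl R] [IsTrans S R] [Std.Antisymm R]
    {M N P : Graded S R 𝒜} (f : M ⟶ N) (g : N ⟶ P) (σ : S) :
    app (f ≫ g) σ σ = app f σ σ ≫ app g σ σ :=
  Fam.comp_app_diag (Fam.ofHom_supp f) (Fam.ofHom_supp g) σ

theorem Graded.id_app_self {S : Type w} {R : S → S → Prop} [Std.Refl R] [IsTrans S R]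
    (M : Graded S R 𝒜) (σ : S) : app (𝟙 M) σ σ = 𝟙 _ := dif_pos rfl

/-- The diagonal components of a triangular contraction are contractions. -/
theorem nonempty_homotopy_localComplex
    (Q : ∀ n m, (Fam.ofComplex C).X n ⟶ (Fam.ofComplex C).X m)
    (hQ : ∀ n m, Fam.SuppIn (Q n m) fun σ τ : Y.Simplex => var.rel σ τ)
    (h : ∀ p n m, p + 1 = n → n + 1 = m →
      𝟙 ((Fam.ofComplex C).X n) = (Fam.ofComplex C).d n p ≫ Q p n + Q n m ≫ (Fam.ofComplex C).d m n)
    (σ : Y.Simplex) : Nonempty (Homotopy (𝟙 (Graded.localComplex C σ)) 0) := by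
  refine ⟨contraction (Graded.localComplex C σ) (fun n m => Fam.app (Q n m) σ σ) fun p n m hp hm => ?_⟩
  have := congrArg (fun f : (Fam.ofComplex C).X n ⟶ (Fam.ofComplex C).X n => Fam.app f σ σ) (h p n m hp hm)
  dsimp only at this
  rw [Fam.id_app_self, Fam.add_app] at this
  refine this.trans (congrArg₂ (· + ·) ?_ ?_)
  · exact Fam.comp_app_diag (Fam.ofHom_supp _) (hQ p n) σ
  · exact Fam.comp_app_diag (hQ n m) (Fam.ofHom_supp _) σ

theorem nonempty_homotopy_localComplex_of_homotopy (h : Homotopy (𝟙 C) 0) (σ : Y.Simplex) :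
    Nonempty (Homotopy (𝟙 (Graded.localComplex C σ)) 0) :=
  nonempty_homotopy_localComplex C (fun n m => Fam.ofHom (h.hom n m)) (fun _ _ => Fam.ofHom_supp _)
    (fun _ _ _ hp hm => congrArg Fam.ofHom (h.eq_id hp hm)) σ

variable (Y var 𝒜) in
/-- The inclusion of the simplicial category into families. -/
noncomputable def Fam.ofGradedFunctor : SimplicialCat Y var 𝒜 ⥤ Fam.{u, w} 𝒜 where
  obj := Fam.ofGraded
  map := Fam.ofHom

/-- Without diagonal, a triangular matrix strictly changes the dimension, which takes only finitely
many values. -/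
theorem Graded.isNilpotent {M : SimplicialCat Y var 𝒜} {d : ℕ} (hd : ∀ s ∈ Y.K.faces, s.card ≤ d + 1)
    (f : End M) (h : ∀ σ, app (M := M) (N := M) f σ σ = 0) : IsNilpotent f := by
  refine ⟨d + 2, ?_⟩
  have hlt : ∀ {a b : Y.Simplex}, a ≤ b → a ≠ b → a.1.card < b.1.card := fun h h' =>
    Finset.card_lt_card (lt_of_le_of_ne h fun e => h' (Subtype.ext e))
  have hf : Fam.SuppIn (Fam.ofHom (M := M) (N := M) f) fun a b : Y.Simplex => var.rel a b ∧ a ≠ b :=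
    fun a b h' => ⟨Fam.ofHom_supp _ a b h', fun e => by subst e; exact h' (h a)⟩
  refine Fam.ofHom_injective (((map_pow ((Fam.ofGradedFunctor Y var 𝒜).mapEnd M) f (d + 2)).trans ?_ :
    (Fam.ofGradedFunctor Y var 𝒜).mapEnd M (f ^ (d + 2)) = 0))
  cases var
  · refine Fam.pow_eq_zero (M := Fam.ofGraded M) _ (fun a : Y.Simplex => a.1.card) _
      (fun a => by have := hd _ a.2; omega) fun a c h => ?_
    exact hlt (hf a c h).1 (hf a c h).2.symm
  · refine Fam.pow_eq_zero (M := Fam.ofGraded M) _ (fun a : Y.Simplex => d + 1 - a.1.card) _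
      (fun a => by omega) fun (a : Y.Simplex) (c : Y.Simplex) h => ?_
    have h1 := hlt (hf a c h).1 (hf a c h).2
    have h2 := hd _ c.2
    dsimp only
    omega

/-- The diagonal matrix of given morphisms. -/
noncomputable def Graded.diagonal {S : Type w} {R : S → S → Prop} [Std.Refl R] [IsTrans S R]
    {M N : Graded S R 𝒜} (f : ∀ σ, M.obj σ ⟶ N.obj σ) : M ⟶ N :=
  open scoped Classical in
  Hom.mk (fun σ τ => if h : σ = τ then f σ ≫ eqToHom (congrArg N.obj h) else 0)
    (fun σ => (Set.finite_singleton σ).subset fun τ h => by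
      by_contra h'
      exact h (dif_neg fun e => h' (by simp [e])))
    (fun σ τ h => dif_neg fun e => h (by subst e; exact Std.Refl.refl σ))

theorem Graded.diagonal_app {S : Type w} {R : S → S → Prop} [Std.Refl R] [IsTrans S R]
    {M N : Graded S R 𝒜} (f : ∀ σ, M.obj σ ⟶ N.obj σ) (σ : S) : app (diagonal f : M ⟶ N) σ σ = f σ := by
  refine (dif_pos rfl).trans ?_
  simp

/-- A complex that is contractible over each simplex is contractible. -/
theorem nonempty_homotopy_of_localComplex {d : ℕ} (hd : ∀ s ∈ Y.K.faces, s.card ≤ d + 1)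
    (h : ∀ σ, Nonempty (Homotopy (𝟙 (Graded.localComplex C σ)) 0)) : Nonempty (Homotopy (𝟙 C) 0) := by
  let γ σ := (h σ).some
  let Γ : ∀ n m, (ComplexShape.down ℤ).Rel m n → (C.X n ⟶ C.X m) := fun n m _ =>
    Graded.diagonal fun σ => (γ σ).hom n m
  -- Written out, `φ` is `dΓ + Γd`: null homotopic by construction, with identity diagonal because
  -- the `γ σ` are contractions, hence invertible. The identity is then `inv φ ≫ φ`.
  let φ : C ⟶ C := Homotopy.nullHomotopicMap' Γ
  have hu : ∀ n, IsIso (φ.f n) := fun n => by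
    have e : φ.f n = C.d n (n - 1) ≫ Γ (n - 1) n (sub_add_cancel n 1) + Γ n (n + 1) rfl ≫ C.d (n + 1) n :=
      Homotopy.nullHomotopicMap'_f (show (ComplexShape.down ℤ).Rel (n + 1) n from rfl)
        (show (ComplexShape.down ℤ).Rel n (n - 1) from sub_add_cancel n 1) _
    have hn : IsNilpotent (1 - End.of (φ.f n)) := by
      refine Graded.isNilpotent hd _ fun σ => ?_
      change Graded.app (𝟙 (C.X n) - φ.f n) σ σ = 0
      have h1 : Graded.app (φ.f n) σ σ = 𝟙 _ := by
        have hΓ : ∀ n m hnm, Graded.app (Γ n m hnm) σ σ = (γ σ).hom n m := fun n m _ =>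
          Graded.diagonal_app _ σ
        rw [e, Graded.add_app, Graded.comp_app_diag, Graded.comp_app_diag,
          hΓ _ _ (show (ComplexShape.down ℤ).Rel n (n - 1) from sub_add_cancel n 1),
          hΓ _ _ (show (ComplexShape.down ℤ).Rel (n + 1) n from rfl)]
        exact ((γ σ).eq_id (sub_add_cancel n 1) rfl).symm
      rw [sub_eq_add_neg, Graded.add_app, Graded.id_app_self]
      change _ + - Graded.app (φ.f n) σ σ = 0
      rw [h1, add_neg_cancel]
    have := hn.isUnit_one_sub
    rw [sub_sub_cancel] at this
    exact (isUnit_iff_isIso _).1 this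
  have : IsIso φ := HomologicalComplex.Hom.isIso_of_components φ
  exact ⟨((Homotopy.ofEq (IsIso.inv_hom_id φ).symm).trans
    ((Homotopy.nullHomotopy' Γ).compLeft (inv φ))).trans (Homotopy.ofEq comp_zero)⟩

/-- Subdivision preserves local contractibility. -/
theorem Subdivision.nonempty_homotopy_localComplex (r : Approx Y)
    (h : ∀ σ, Nonempty (Homotopy (𝟙 (Graded.localComplex C σ)) 0)) (a : Y.sd.Simplex) :
    Nonempty (Homotopy (𝟙 (Graded.localComplex (Subdivision.complex r var C) a)) 0) := by
  let γ := (h (r.map a)).some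
  -- A nonzero incidence number would change the excess. So the diagonal part of the subdivision at
  -- `a` is that of `C` at `r.map a`, with shifted degrees and no sign.
  have hinc : inc r var a a = 0 := by
    by_contra h0
    have := exc_of_inc r var h0 0
    cases var <;> simp only [deg] at this <;> omega
  have hd : ∀ n m : ℤ, m + 1 = n → (Graded.localComplex (Subdivision.complex r var C) a).d n m =
      (Graded.localComplex C (r.map a)).d (deg r var n a) (deg r var m a) := fun n m hnm => by
    refine (d_app r var C hnm a a).trans ?_
    rw [entry_fibre r var C rfl, if_pos rfl, hinc, mul_zero, zero_smul, add_zero]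
    rfl
  have hdeg : ∀ n m : ℤ, m + 1 = n → deg r var m a + 1 = deg r var n a := fun n m hnm => by
    cases var <;> simp only [deg] <;> omega
  refine ⟨contraction _ (fun n m => γ.hom (deg r var n a) (deg r var m a)) fun p n m hp hm => ?_⟩
  rw [hd n p hp, hd m n hm]
  exact γ.eq_id (hdeg n p hp) (hdeg m n hm)

end

/-- Local contractibility is carried through all subdivisions and made global only at the end. The
resulting contraction is a morphism of the simplicial category, so it connects only comparable
simplices. -/
theorem sdComplex_homotopy {X : OrderedComplex.{w}} {var : Variance} {𝒜 : Type u} [Category.{v} 𝒜]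
    [Preadditive 𝒜] (r : ∀ j, Approx (X.sdIter j)) {d : ℕ} (hd : ∀ s ∈ X.K.faces, s.card ≤ d + 1)
    (C : ChainComplex (SimplicialCat X var 𝒜) ℤ)
    (h : ∀ σ, Nonempty (Homotopy (𝟙 (Graded.localComplex C σ)) 0)) (j : ℕ) :
    Nonempty (Homotopy (𝟙 (sdComplex r C j)) 0) := by
  refine nonempty_homotopy_of_localComplex _ (card_le_sdIter hd j) ?_
  induction j with
  | zero => exact h
  | succ j ih => exact Subdivision.nonempty_homotopy_localComplex _ (r j) ih

/-! ### The mesh of iterated subdivisions, and distances in the cone. -/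

/-- Contributions of pairs inside `s` cancel, so the difference is a sum of `f x - f y` over `x ∈ s`
and `y ∈ t \ s`, each with weight `1 / (|s| |t|)`. The total weight is `1 - |s| / |t|`. -/
theorem norm_average_sub_average_le {ι E : Type*} [NormedAddCommGroup E] [NormedSpace ℝ E] {s t : Finset ι}
    (hs : s.Nonempty) (hst : s ⊆ t) {f : ι → E} {L : ℝ} (h : ∀ x ∈ t, ∀ y ∈ t, ‖f x - f y‖ ≤ L) :
    ‖(s.card : ℝ)⁻¹ • ∑ x ∈ s, f x - (t.card : ℝ)⁻¹ • ∑ x ∈ t, f x‖ ≤ (1 - s.card / t.card) * L := by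
  classical
  have cs : (0 : ℝ) < s.card := by exact_mod_cast hs.card_pos
  have ct : (0 : ℝ) < t.card := by exact_mod_cast (hs.mono hst).card_pos
  have hc : ((t \ s).card : ℝ) = t.card - s.card := by
    rw [Finset.card_sdiff_of_subset hst, Nat.cast_sub (Finset.card_le_card hst)]
  have e : (s.card : ℝ)⁻¹ • ∑ x ∈ s, f x - (t.card : ℝ)⁻¹ • ∑ x ∈ t, f x =
      ((s.card : ℝ)⁻¹ * (t.card : ℝ)⁻¹) • ∑ x ∈ s, ∑ y ∈ t \ s, (f x - f y) := by
    simp only [Finset.sum_sub_distrib, Finset.sum_const, ← Nat.cast_smul_eq_nsmul ℝ]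
    rw [hc, ← Finset.smul_sum, ← Finset.sum_sdiff hst]
    match_scalars
    · field_simp
    · field_simp
  rw [e, norm_smul, Real.norm_of_nonneg (by positivity)]
  have h1 : ‖∑ x ∈ s, ∑ y ∈ t \ s, (f x - f y)‖ ≤ s.card * ((t.card - s.card) * L) := by
    rw [← hc, ← nsmul_eq_mul, ← nsmul_eq_mul]
    refine (norm_sum_le_of_le (n := fun _ => ∑ _y ∈ t \ s, L) _ fun x hx =>
      norm_sum_le_of_le (n := fun _ => L) _ fun y hy =>
        h x (hst hx) y (Finset.sdiff_subset hy)).trans_eq ?_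
    rw [Finset.sum_const, Finset.sum_const]
  refine (mul_le_mul_of_nonneg_left h1 (by positivity)).trans_eq ?_
  field_simp

namespace OrderedComplex

variable {X : OrderedComplex.{w}}

/-- Restriction of barycentric coordinates to a simplex. -/
noncomputable def coords (s : Finset X.V) : (X.V → ℝ) →ₗ[ℝ] EuclideanSpace ℝ s :=
  (WithLp.linearEquiv 2 ℝ (s → ℝ)).symm.toLinearMap ∘ₗ LinearMap.funLeft ℝ ℝ Subtype.val

theorem norm_coords_sub (s : Finset X.V) (x y : X.V → ℝ) :
    ‖coords s x - coords s y‖ = √(∑ v ∈ s, (x v - y v) ^ 2) := by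
  rw [← map_sub, EuclideanSpace.norm_eq, ← Finset.sum_coe_sort s]
  congr 1
  refine Finset.sum_congr rfl fun v _ => ?_
  rw [Real.norm_eq_abs, sq_abs]
  rfl

theorem le_one_of_mem_cell {s : Finset X.V} {x : X.V → ℝ} (hx : x ∈ X.cell s) (v : X.V) : x v ≤ 1 := by
  by_cases hv : v ∈ s
  · rw [← hx.2.2]
    exact Finset.single_le_sum (fun u _ => hx.1 u) hv
  · rw [hx.2.1 v hv]
    exact zero_le_one

theorem norm_coords_sub_le {s : Finset X.V} {x y : X.V → ℝ} (hx : x ∈ X.cell s) (hy : y ∈ X.cell s) :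
    ‖coords s x - coords s y‖ ≤ √2 := by
  rw [norm_coords_sub]
  refine Real.sqrt_le_sqrt ?_
  -- For numbers in the unit interval `(x - y) ^ 2 ≤ x + y`, and each point has coordinate sum `1`.
  calc ∑ v ∈ s, (x v - y v) ^ 2 ≤ ∑ v ∈ s, (x v + y v) := Finset.sum_le_sum fun v _ => by
        have := hx.1 v
        have := hy.1 v
        have := le_one_of_mem_cell hx v
        have := le_one_of_mem_cell hy v
        nlinarith
    _ = 2 := by rw [Finset.sum_add_distrib, hx.2.2, hy.2.2]; norm_num

/-- The simplices of the iterated subdivision are small. -/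
theorem exists_mesh {d : ℕ} (hd : ∀ s ∈ X.K.faces, s.card ≤ d + 1) (j : ℕ) (T : (X.sdIter j).Simplex) :
    ∃ s ∈ X.K.faces, (∀ v ∈ T.1, X.pos j v ∈ X.cell s) ∧
      ∀ v ∈ T.1, ∀ w ∈ T.1, ‖coords s (X.pos j v) - coords s (X.pos j w)‖ ≤
        (d / (d + 1) : ℝ) ^ j * √2 := by
  induction j with
  | zero =>
    refine ⟨T.1, T.2, fun v hv => pos_zero_mem_cell hv, fun v hv w hw => ?_⟩
    rw [pow_zero, one_mul]
    exact norm_coords_sub_le (pos_zero_mem_cell hv) (pos_zero_mem_cell hw)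
  | succ j ih =>
    obtain ⟨m, hm, hmax⟩ := T.1.exists_maximal T.2.1
    have hle : ∀ t ∈ T.1, t ≤ m := fun t ht => by
      rcases T.2.2 t ht m hm with h | h
      · exact h
      · exact hmax ht h
    obtain ⟨s, hs, h1, h2⟩ := ih m
    have hne : ∀ t : (X.sdIter j).Simplex, t.1.Nonempty := fun t => (X.sdIter j).nonempty_of_mem t.2
    have key : ∀ t t' : (X.sdIter j).Simplex, t ≤ t' → t' ≤ (show (X.sdIter j).Simplex from m) →
        ‖coords s (X.pos (j + 1) t) - coords s (X.pos (j + 1) t')‖ ≤ (d / (d + 1) : ℝ) ^ (j + 1) * √2 := by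
      intro t t' h h'
      have := norm_average_sub_average_le (hne t) h (f := fun v => coords s (X.pos j v))
        fun x hx y hy => h2 x (h' hx) y (h' hy)
      rw [← map_sum, ← map_sum, ← map_smul, ← map_smul] at this
      refine this.trans ?_
      rw [pow_succ', mul_assoc]
      refine mul_le_mul_of_nonneg_right ?_ (by positivity)
      have c1 : (1 : ℝ) ≤ t.1.card := by exact_mod_cast (hne t).card_pos
      have c2 : (0 : ℝ) < t'.1.card := by exact_mod_cast (hne t').card_pos
      have c3 : (t'.1.card : ℝ) ≤ d + 1 := by exact_mod_cast card_le_sdIter hd j _ t'.2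
      -- The ratio of the numbers of vertices is at least `1 / (d + 1)`, so each subdivision shrinks
      -- diameters at least by the factor `1 - 1 / (d + 1)`.
      have : (1 : ℝ) / (d + 1) ≤ t.1.card / t'.1.card := div_le_div₀ (by linarith) c1 c2 c3
      have e : (d / (d + 1) : ℝ) = 1 - 1 / (d + 1) := by field_simp; ring
      rw [e]
      linarith
    refine ⟨s, hs, fun t ht => ?_, fun t ht t' ht' => ?_⟩
    · exact average_mem_cell (hne t) fun v hv => h1 v (hle t ht hv)
    · rcases T.2.2 t ht t' ht' with h | h
      · exact key t t' h (hle t' ht')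
      · rw [norm_sub_rev]
        exact key t' t h (hle t ht)

theorem stdDist_le {s : Finset X.V} (hs : s ∈ X.K.faces) {x y : X.V → ℝ} (hx : x ∈ X.cell s)
    (hy : y ∈ X.cell s) : X.stdDist x y ≤ ENNReal.ofReal ‖coords s x - coords s y‖ := by
  refine iInf₂_le_of_le _ (PolygonalPath.cons s hs hx hy (PolygonalPath.nil y)) ?_
  rw [add_zero, norm_coords_sub]

/-- The distance of the barycentres of a simplex and of a face. -/
theorem stdDist_average_le {d : ℕ} (hd : ∀ s ∈ X.K.faces, s.card ≤ d + 1) (j : ℕ)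
    {a b : (X.sdIter j).Simplex} (h : a ≤ b ∨ b ≤ a) :
    X.stdDist ((a.1.card : ℝ)⁻¹ • ∑ v ∈ a.1, X.pos j v) ((b.1.card : ℝ)⁻¹ • ∑ v ∈ b.1, X.pos j v) ≤
      ENNReal.ofReal ((d / (d + 1) : ℝ) ^ j * √2) := by
  have hne : ∀ t : (X.sdIter j).Simplex, t.1.Nonempty := fun t => (X.sdIter j).nonempty_of_mem t.2
  have key : ∀ a b : (X.sdIter j).Simplex, a ≤ b → ∃ s ∈ X.K.faces,
      (a.1.card : ℝ)⁻¹ • ∑ v ∈ a.1, X.pos j v ∈ X.cell s ∧ (b.1.card : ℝ)⁻¹ • ∑ v ∈ b.1, X.pos j v ∈ X.cell s ∧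
      ‖coords s ((a.1.card : ℝ)⁻¹ • ∑ v ∈ a.1, X.pos j v) -
        coords s ((b.1.card : ℝ)⁻¹ • ∑ v ∈ b.1, X.pos j v)‖ ≤ (d / (d + 1) : ℝ) ^ j * √2 := by
    intro a b h
    obtain ⟨s, hs, h1, h2⟩ := exists_mesh hd j b
    refine ⟨s, hs, average_mem_cell (hne a) fun v hv => h1 v (h hv), average_mem_cell (hne b) h1, ?_⟩
    rw [map_smul, map_smul, map_sum, map_sum]
    refine (norm_average_sub_average_le (hne a) h h2).trans ?_
    refine mul_le_of_le_one_left (by positivity) ?_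
    have : (0 : ℝ) ≤ a.1.card / b.1.card := by positivity
    linarith
  rcases h with h | h
  · obtain ⟨s, hs, h1, h2, h3⟩ := key a b h
    exact (stdDist_le hs h1 h2).trans (ENNReal.ofReal_le_ofReal h3)
  · obtain ⟨s, hs, h1, h2, h3⟩ := key b a h
    rw [norm_sub_rev] at h3
    exact (stdDist_le hs h2 h1).trans (ENNReal.ofReal_le_ofReal h3)

/-- Summing the geometric series, `v_i` is at most `(d + 1) * ((d + 2) / (d + 1)) ^ i`. Multiplied
by the mesh this has ratio `d (d + 2) / (d + 1) ^ 2 < 1`: the slices rise more slowly than the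
simplices shrink. -/
theorem height_le (d : ℕ) (i : ℤ) :
    max (height d i) 0 * ((d / (d + 1) : ℝ) ^ i.toNat * √2) ≤ (d + 1) * √2 := by
  have h : max (height d i) 0 ≤ (d + 1) * (((d : ℝ) + 2) / (d + 1)) ^ i.toNat := by
    refine max_le ?_ (by positivity)
    unfold height
    split_ifs with hi
    · exact (Int.cast_nonpos.2 hi).trans (by positivity)
    · have hne : (((d : ℝ) + 2) / (d + 1)) ≠ 1 := by
        rw [Ne, div_eq_one_iff_eq (by positivity)]
        intro h
        linarith
      rw [geom_sum_eq hne]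
      have e : (((d : ℝ) + 2) / (d + 1)) - 1 = 1 / (d + 1) := by field_simp; ring
      rw [e, div_div_eq_mul_div, div_one]
      nlinarith
  calc _ ≤ (d + 1) * (((d : ℝ) + 2) / (d + 1)) ^ i.toNat * ((d / (d + 1) : ℝ) ^ i.toNat * √2) :=
        mul_le_mul_of_nonneg_right h (by positivity)
    _ = (d + 1) * ((((d : ℝ) + 2) / (d + 1)) * (d / (d + 1))) ^ i.toNat * √2 := by rw [mul_pow]; ring
    _ ≤ (d + 1) * 1 * √2 := by
        gcongr
        refine pow_le_one₀ (by positivity) ?_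
        rw [div_mul_div_comm, div_le_one (by positivity)]
        nlinarith
    _ = _ := by rw [mul_one]

theorem barycentre_slice_fst (d : ℕ) (i : ℤ) (s : (X.sdIter i.toNat).Simplex) :
    ((T0Simplex.slice i s).barycentre d).1 = (s.1.card : ℝ)⁻¹ • ∑ v ∈ s.1, X.pos i.toNat v := by
  simp only [T0Simplex.barycentre, Prod.smul_fst, Prod.fst_sum]

theorem barycentre_slice_snd (d : ℕ) (i : ℤ) (s : (X.sdIter i.toNat).Simplex) :
    ((T0Simplex.slice i s).barycentre d).2 = height d i := by
  simp only [T0Simplex.barycentre, Prod.smul_snd, Prod.snd_sum]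
  have : (s.1.card : ℝ) ≠ 0 := by
    exact_mod_cast ((X.sdIter i.toNat).nonempty_of_mem s.2).card_pos.ne'
  rw [Finset.sum_const, nsmul_eq_mul, smul_eq_mul, inv_mul_cancel_left₀ this]

theorem coneDist_slice (d : ℕ) (i : ℤ) (s t : (X.sdIter i.toNat).Simplex) :
    X.coneDist ((T0Simplex.slice i s).barycentre d) ((T0Simplex.slice i t).barycentre d) =
      ENNReal.ofReal (max (height d i) 0) * X.stdDist ((s.1.card : ℝ)⁻¹ • ∑ v ∈ s.1, X.pos i.toNat v)
        ((t.1.card : ℝ)⁻¹ • ∑ v ∈ t.1, X.pos i.toNat v) := by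
  unfold coneDist
  rw [barycentre_slice_snd, barycentre_slice_snd, barycentre_slice_fst, barycentre_slice_fst, min_self,
    sub_self, abs_zero, ENNReal.ofReal_zero, add_zero]

theorem coneDist_slice_le {d : ℕ} (hd : ∀ s ∈ X.K.faces, s.card ≤ d + 1) (i : ℤ)
    {a b : (X.sdIter i.toNat).Simplex} (h : a ≤ b ∨ b ≤ a) :
    X.coneDist ((T0Simplex.slice i a).barycentre d) ((T0Simplex.slice i b).barycentre d) ≤
      ENNReal.ofReal ((d + 1) * √2) := by
  rw [coneDist_slice]
  refine (mul_le_mul_right (stdDist_average_le hd _ h) _).trans ?_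
  rw [← ENNReal.ofReal_mul (le_max_right _ _)]
  exact ENNReal.ofReal_le_ofReal (height_le d i)

end OrderedComplex

/-! ### Restriction to the slices of `C ⊗ ℤ`, and assembly from them. -/

theorem Graded.exists_of_comp_ne_zero {𝒜 : Type u} [Category.{v} 𝒜] [Preadditive 𝒜] {S : Type w} {R : S → S → Prop} [Std.Refl R] [IsTrans S R]
    {L M N : Graded S R 𝒜} {f : L ⟶ M} {g : M ⟶ N} {F G : S}
    (h : app (f ≫ g) F G ≠ 0) : ∃ K, app f F K ≠ 0 ∧ app g K G ≠ 0 :=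
  Fam.exists_of_comp_app_ne_zero (f := Fam.ofHom f) (g := Fam.ofHom g) h

section

variable {X : OrderedComplex.{w}} (r : ∀ j, Approx (X.sdIter j)) {var : Variance}
    {𝒜 : Type u} [Category.{v} 𝒜] [Preadditive 𝒜] [HasFiniteBiproducts 𝒜]
    (C : ChainComplex (SimplicialCat X var 𝒜) ℤ)

namespace TensorZ

/-- The part over a slice of a morphism over all slices. -/
noncomputable def restrict (i : ℤ) {n m : ℤ} (f : (tensorZ r C).X n ⟶ (tensorZ r C).X m) :
    (Fam.ofComplex (sdComplex r C i.toNat)).X n ⟶ (Fam.ofComplex (sdComplex r C i.toNat)).X m :=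
  Fam.Hom.mk (fun s t => Graded.app f (.slice i s) (.slice i t))
    fun s => (f.finite (.slice i s)).preimage (slice_injective i).injOn

theorem d_ne_zero {n m : ℤ} {F G : T0Simplex X} (h : Graded.app ((tensorZ r C).d n m) F G ≠ 0) :
    ∃ i s t, F = .slice i s ∧ G = .slice i t := exists_of_tensorEntry_ne_zero r C h

theorem restrict_d (i n m : ℤ) :
    restrict r C i ((tensorZ r C).d n m) = (Fam.ofComplex (sdComplex r C i.toNat)).d n m :=
  Fam.hom_ext fun s t => tensorEntry_self r C n m i s t

theorem restrict_id (i n : ℤ) : restrict r C i (𝟙 ((tensorZ r C).X n)) = 𝟙 _ := by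
  refine Fam.hom_ext fun (s : (X.sdIter i.toNat).Simplex) (t : (X.sdIter i.toNat).Simplex) => ?_
  by_cases e : s = t
  · subst e
    rw [Fam.id_app_self]
    exact Fam.id_app_self (Fam.ofGraded ((tensorZ r C).X n)) _
  · rw [Fam.id_app_ne _ e]
    exact Fam.id_app_ne (Fam.ofGraded ((tensorZ r C).X n)) fun h => e (slice_injective i h)

theorem restrict_add (i : ℤ) {n m : ℤ} (f g : (tensorZ r C).X n ⟶ (tensorZ r C).X m) :
    restrict r C i (f + g) = restrict r C i f + restrict r C i g := rfl

theorem restrict_comp (i : ℤ) {n m p : ℤ} (f : (tensorZ r C).X n ⟶ (tensorZ r C).X m)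
    (g : (tensorZ r C).X m ⟶ (tensorZ r C).X p)
    (h : ∀ s t G, Graded.app f (.slice i s) G ≠ 0 → Graded.app g G (.slice i t) ≠ 0 →
      ∃ t', G = .slice i t') :
    restrict r C i (f ≫ g) = restrict r C i f ≫ restrict r C i g := by
  classical
  refine Fam.hom_ext fun (s : (X.sdIter i.toNat).Simplex) (t : (X.sdIter i.toNat).Simplex) => ?_
  have hs : {t' | Fam.app (restrict r C i f) s t' ≠ 0}.Finite := (restrict r C i f).finite s
  have h1 := Fam.comp_app_eq_sum (restrict r C i f) (restrict r C i g) s t hs.toFinset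
    fun τ hτ => hs.mem_toFinset.2 hτ
  refine Eq.trans ?_ h1.symm
  have h2 := Subdivision.finite_comp_ne_zero (Fam.ofHom f) (Fam.ofHom g) (.slice i s) (.slice i t)
    (hs.toFinset.image (T0Simplex.slice i)) fun G h1 h2 => by
      obtain ⟨t', rfl⟩ := h s t G h1 h2
      exact Finset.mem_image_of_mem _ (hs.mem_toFinset.2 h1)
  refine h2.trans ?_
  exact Finset.sum_image fun _ _ _ _ h => slice_injective i h

theorem restrict_d_comp (i : ℤ) {n m p : ℤ} (g : (tensorZ r C).X m ⟶ (tensorZ r C).X p) :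
    restrict r C i ((tensorZ r C).d n m ≫ g) =
      (Fam.ofComplex (sdComplex r C i.toNat)).d n m ≫ restrict r C i g := by
  rw [restrict_comp, restrict_d]
  intro s t G h _
  obtain ⟨i', s', t', e, rfl⟩ := d_ne_zero r C h
  injection e with e1 _
  subst e1
  exact ⟨t', rfl⟩

theorem restrict_comp_d (i : ℤ) {n m p : ℤ} (f : (tensorZ r C).X n ⟶ (tensorZ r C).X m) :
    restrict r C i (f ≫ (tensorZ r C).d m p) =
      restrict r C i f ≫ (Fam.ofComplex (sdComplex r C i.toNat)).d m p := by
  rw [restrict_comp, restrict_d]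
  intro s t G _ h
  obtain ⟨i', s', t', rfl, e⟩ := d_ne_zero r C h
  injection e with e1 _
  subst e1
  exact ⟨s', rfl⟩

/-- `P` itself may connect different slices, but in `dP + Pd` the differential does not, so
components of `P` between slices never enter the equation on one slice. -/
theorem restrict_homotopy (P : Homotopy (𝟙 (tensorZ r C)) 0) (i : ℤ) {p n m : ℤ} (hp : p + 1 = n)
    (hm : n + 1 = m) :
    𝟙 ((Fam.ofComplex (sdComplex r C i.toNat)).X n) =
      (Fam.ofComplex (sdComplex r C i.toNat)).d n p ≫ restrict r C i (P.hom p n) +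
        restrict r C i (P.hom n m) ≫ (Fam.ofComplex (sdComplex r C i.toNat)).d m n := by
  rw [← restrict_id, P.eq_id hp hm, restrict_add, restrict_d_comp, restrict_comp_d]

variable {r C}

/-- The component between two slices of a family of morphisms on the slices. -/
noncomputable def assembleSlice {n m : ℤ} (f : ∀ i : ℤ, (sdComplex r C i.toNat).X n ⟶ (sdComplex r C i.toNat).X m) :
    {i i' : ℤ} → i = i' → (s : (X.sdIter i.toNat).Simplex) → (s' : (X.sdIter i'.toNat).Simplex) →
    (tensorObj r C n (.slice i s) ⟶ tensorObj r C m (.slice i' s'))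
  | i, _, rfl, s, s' => Graded.app (f i) s s'

open scoped Classical in
/-- The components of a family of morphisms on the slices. -/
noncomputable def assembleEntry {n m : ℤ}
    (f : ∀ i : ℤ, (sdComplex r C i.toNat).X n ⟶ (sdComplex r C i.toNat).X m) (F G : T0Simplex X) :
    tensorObj r C n F ⟶ tensorObj r C m G :=
  match F, G with
  | .slice i s, .slice i' s' => if h : i = i' then assembleSlice f h s s' else 0
  | _, _ => 0

variable {n m : ℤ} (f : ∀ i : ℤ, (sdComplex r C i.toNat).X n ⟶ (sdComplex r C i.toNat).X m)

theorem assembleEntry_self (i : ℤ) (s s' : (X.sdIter i.toNat).Simplex) :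
    assembleEntry f (.slice i s) (.slice i s') = Graded.app (f i) s s' := dif_pos rfl

theorem exists_of_assembleEntry_ne_zero {F G : T0Simplex X} (h : assembleEntry f F G ≠ 0) :
    ∃ i s s', F = .slice i s ∧ G = .slice i s' ∧ Graded.app (f i) s s' ≠ 0 := by
  cases F <;> cases G <;> try exact absurd rfl h
  rename_i i s i' s'
  by_cases e : i = i'
  · subst e
    exact ⟨i, s, s', rfl, rfl, fun h' => h ((assembleEntry_self f i s s').trans h')⟩
  · exact absurd (dif_neg e) h

/-- The morphism given by morphisms on the slices. -/
noncomputable def assemble : (tensorZ r C).X n ⟶ (tensorZ r C).X m :=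
  Graded.Hom.mk (assembleEntry f)
    (fun F => by
      by_cases hF : ∃ i s, F = .slice i s
      · obtain ⟨i, s, rfl⟩ := hF
        refine (((f i).finite s).image (T0Simplex.slice i)).subset fun G hG => ?_
        obtain ⟨i', s', t, e, rfl, h⟩ := exists_of_assembleEntry_ne_zero f hG
        injection e with e1 e2
        subst e1
        cases eq_of_heq e2
        exact ⟨t, h, rfl⟩
      · refine Set.finite_empty.subset fun G hG => hF ?_
        obtain ⟨i, s, t, e, -⟩ := exists_of_assembleEntry_ne_zero f hG
        exact ⟨i, s, e⟩)
    fun _ _ h => absurd trivial h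

theorem restrict_assemble (i : ℤ) : restrict r C i (assemble f) = Fam.ofHom (f i) :=
  Fam.hom_ext fun s t => assembleEntry_self f i s t

theorem assemble_ne_zero {F G : T0Simplex X} (h : Graded.app (assemble f) F G ≠ 0) :
    ∃ i s s', F = .slice i s ∧ G = .slice i s' ∧ Graded.app (f i) s s' ≠ 0 :=
  exists_of_assembleEntry_ne_zero f h

/-- The objects over the prisms are zero, so only components between simplices of slices matter. -/
theorem eq_of_restrict {f g : (tensorZ r C).X n ⟶ (tensorZ r C).X m}
    (h : ∀ i, restrict r C i f = restrict r C i g)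
    (hf : ∀ i s i' s', i ≠ i' → Graded.app f (.slice i s) (.slice i' s') = 0)
    (hg : ∀ i s i' s', i ≠ i' → Graded.app g (.slice i s) (.slice i' s') = 0) : f = g := by
  refine Graded.hom_ext fun F G => ?_
  cases F with
  | prismUp => exact (isZero_zero 𝒜).eq_of_src _ _
  | prismDown => exact (isZero_zero 𝒜).eq_of_src _ _
  | slice i s =>
    cases G with
    | prismUp => exact (isZero_zero 𝒜).eq_of_tgt _ _
    | prismDown => exact (isZero_zero 𝒜).eq_of_tgt _ _
    | slice i' s' =>
      by_cases e : i = i'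
      · subst e
        exact congrArg (fun k : (Fam.ofComplex (sdComplex r C i.toNat)).X n ⟶
          (Fam.ofComplex (sdComplex r C i.toNat)).X m => Fam.app k s s') (h i)
      · rw [hf _ _ _ _ e, hg _ _ _ _ e]

end TensorZ

/-- Contractions of the slices give a contraction of `C ⊗ ℤ`. -/
theorem exists_homotopy_tensorZ (h : ∀ j, Homotopy (𝟙 (sdComplex r C j)) 0) :
    ∃ P : Homotopy (𝟙 (tensorZ r C)) 0, ∀ m n F G, Graded.app (P.hom m n) F G ≠ 0 →
      ∃ i s t, F = .slice i s ∧ G = .slice i t ∧ var.rel s t := by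
  let Q n m : (tensorZ r C).X n ⟶ (tensorZ r C).X m := TensorZ.assemble fun i => (h i.toNat).hom n m
  have hQ : ∀ n m F G, Graded.app (Q n m) F G ≠ 0 →
      ∃ i s t, F = .slice i s ∧ G = .slice i t ∧ var.rel s t := fun n m F G h0 => by
    obtain ⟨i, s, t, h1, h2, h3⟩ := TensorZ.assemble_ne_zero _ h0
    refine ⟨i, s, t, h1, h2, ?_⟩
    by_contra h'
    exact h3 (Graded.Hom.support _ _ _ h')
  refine ⟨contraction _ Q fun p n m hp hm => ?_, fun m n F G h0 => ?_⟩
  · refine TensorZ.eq_of_restrict (fun i => ?_) (fun i s i' s' hne => ?_) fun i s i' s' hne => ?_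
    · rw [TensorZ.restrict_id, TensorZ.restrict_add, TensorZ.restrict_d_comp, TensorZ.restrict_comp_d,
        TensorZ.restrict_assemble, TensorZ.restrict_assemble]
      exact congrArg Fam.ofHom ((h i.toNat).eq_id hp hm)
    · exact Fam.id_app_ne (Fam.ofGraded ((tensorZ r C).X n)) fun e => hne (by injection e)
    · rw [Graded.add_app]
      refine (congrArg₂ (· + ·) ?_ ?_).trans (add_zero 0)
      · by_contra h0
        obtain ⟨K, h1, h2⟩ := Graded.exists_of_comp_ne_zero h0
        obtain ⟨i1, s1, t1, e1, rfl⟩ := TensorZ.d_ne_zero r C h1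
        obtain ⟨i2, s2, t2, e2, e3, -⟩ := hQ _ _ _ _ h2
        injection e1; injection e2; injection e3; omega
      · by_contra h0
        obtain ⟨K, h1, h2⟩ := Graded.exists_of_comp_ne_zero h0
        obtain ⟨i1, s1, t1, rfl, e1⟩ := TensorZ.d_ne_zero r C h2
        obtain ⟨i2, s2, t2, e2, e3, -⟩ := hQ _ _ _ _ h1
        injection e1; injection e2; injection e3; omega
  · by_cases e : m + 1 = n
    · refine hQ m n F G ?_
      rwa [show (contraction (tensorZ r C) Q _).hom m n = Q m n from if_pos e] at h0
    · rw [show (contraction (tensorZ r C) Q _).hom m n = 0 from if_neg e] at h0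
      exact absurd rfl h0

end

/-! ### Squeezing: what comes close to `σ` is mapped into `σ`. -/

namespace OrderedComplex

variable {X : OrderedComplex.{w}}

/-- The sum of the barycentric coordinates at the vertices of a simplex. -/
noncomputable def mass (σ : Finset X.V) : (X.V → ℝ) →ₗ[ℝ] ℝ := ∑ v ∈ σ, LinearMap.proj v

theorem mass_apply (σ : Finset X.V) (x : X.V → ℝ) : mass σ x = ∑ v ∈ σ, x v := by
  simp [mass]

theorem sum_inter_of_cell [DecidableEq X.V] {s : Finset X.V} {x : X.V → ℝ} (hx : x ∈ X.cell s)
    (σ : Finset X.V) : ∑ v ∈ σ ∩ s, x v = mass σ x := by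
  rw [mass_apply]
  refine Finset.sum_subset Finset.inter_subset_left fun v hv hv' => ?_
  exact hx.2.1 v fun h => hv' (Finset.mem_inter.2 ⟨hv, h⟩)

theorem mass_le_one {s : Finset X.V} {x : X.V → ℝ} (hx : x ∈ X.cell s) (σ : Finset X.V) : mass σ x ≤ 1 := by
  classical
  rw [← sum_inter_of_cell hx σ, ← hx.2.2]
  exact Finset.sum_le_sum_of_subset_of_nonneg Finset.inter_subset_right fun v _ _ => hx.1 v

theorem mem_cell_of_mass {s σ : Finset X.V} {x : X.V → ℝ} (hx : x ∈ X.cell s) (h : mass σ x = 1) :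
    x ∈ X.cell σ := by
  classical
  refine ⟨hx.1, fun v hv => ?_, by rwa [← mass_apply]⟩
  by_cases hs : v ∈ s
  · have h1 := sum_inter_of_cell hx σ
    have h2 := Finset.sum_sdiff (f := x) (Finset.inter_subset_right : σ ∩ s ⊆ s)
    rw [h1, h, hx.2.2, add_eq_right] at h2
    exact (Finset.sum_eq_zero_iff_of_nonneg fun v _ => hx.1 v).1 h2 v
      (Finset.mem_sdiff.2 ⟨hs, fun h => hv (Finset.mem_inter.1 h).1⟩)
  · exact hx.2.1 v hs

/-- On a segment in a simplex `s` the mass changes by a sum of at most `d + 1` coordinate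
differences; Cauchy-Schwarz gives the Lipschitz constant `√(d + 1)`. -/
theorem mass_polygonalPath {d : ℕ} (hd : ∀ s ∈ X.K.faces, s.card ≤ d + 1) (σ : Finset X.V) {x y : X.V → ℝ}
    {ℓ : ℝ} (h : X.PolygonalPath x y ℓ) : |mass σ x - mass σ y| ≤ √(d + 1) * ℓ := by
  classical
  induction h with
  | nil x => simp
  | @cons x y z ℓ s hs hx hy _ ih =>
    have h1 : |mass σ x - mass σ y| ≤ √(d + 1) * √(∑ v ∈ s, (x v - y v) ^ 2) := by
      rw [← sum_inter_of_cell hx, ← sum_inter_of_cell hy, ← Finset.sum_sub_distrib,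
        ← Real.sqrt_mul (by positivity)]
      refine Real.abs_le_sqrt (sq_sum_le_card_mul_sum_sq.trans (mul_le_mul ?_ ?_ ?_ (by positivity)))
      · exact_mod_cast (Finset.card_le_card Finset.inter_subset_right).trans (hd s hs)
      · exact Finset.sum_le_sum_of_subset_of_nonneg Finset.inter_subset_right fun v _ _ => sq_nonneg _
      · exact Finset.sum_nonneg fun v _ => sq_nonneg _
    rw [mul_add]
    exact (abs_sub_le _ (mass σ y) _).trans (add_le_add h1 ih)

theorem mass_sub_lt_of_stdDist {d : ℕ} (hd : ∀ s ∈ X.K.faces, s.card ≤ d + 1) (σ : Finset X.V)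
    {x y : X.V → ℝ} {ε : ℝ} (h : X.stdDist x y < ENNReal.ofReal ε) :
    |mass σ x - mass σ y| < √(d + 1) * ε := by
  obtain ⟨ℓ, h⟩ := iInf_lt_iff.1 h
  obtain ⟨hp, h⟩ := iInf_lt_iff.1 h
  refine (mass_polygonalPath hd σ hp).trans_lt ?_
  have : 0 < √((d : ℝ) + 1) := Real.sqrt_pos.2 (by positivity)
  exact mul_lt_mul_of_pos_left (lt_of_not_ge fun h' => h.not_ge (ENNReal.ofReal_le_ofReal h')) this

theorem exists_pos_mem_cell {d : ℕ} (hd : ∀ s ∈ X.K.faces, s.card ≤ d + 1) (i : ℕ) (v : (X.sdIter i).V) :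
    ∃ s, X.pos i v ∈ X.cell s := by
  obtain ⟨s, -, h, -⟩ := exists_mesh hd i ⟨{v}, (X.sdIter i).K.singleton_mem v⟩
  exact ⟨s, h v (Finset.mem_singleton_self v)⟩

/-- The masses of the vertices of iterated subdivisions are rational with bounded denominators. -/
theorem exists_mass_eq {d : ℕ} (hd : ∀ s ∈ X.K.faces, s.card ≤ d + 1) (σ : Finset X.V) (i : ℕ)
    (v : (X.sdIter i).V) : ∃ k : ℕ, mass σ (X.pos i v) * (((d + 1).factorial : ℕ) : ℝ) ^ i = k := by
  classical
  induction i with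
  | zero =>
    have h : mass σ (X.pos 0 v) = if v ∈ σ then 1 else 0 := by
      rw [mass_apply, pos]
      exact Finset.sum_pi_single' v (1 : ℝ) σ |>.trans (by congr)
    rw [h, pow_zero, mul_one]
    split_ifs
    · exact ⟨1, Nat.cast_one.symm⟩
    · exact ⟨0, Nat.cast_zero.symm⟩
  | succ i ih =>
    choose k hk using ih
    have hv := Subtype.property (show (X.sdIter i).Simplex from v)
    set s : Finset (X.sdIter i).V := Subtype.val (show (X.sdIter i).Simplex from v) with hs
    -- Passing to a barycentre divides by a number of vertices that is at most `d + 1`, hence a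
    -- divisor of `(d + 1)!`.
    obtain ⟨q, hq⟩ := Nat.dvd_factorial ((X.sdIter i).nonempty_of_mem hv).card_pos
      (card_le_sdIter hd i _ hv)
    have hc : (s.card : ℝ) ≠ 0 := by
      exact_mod_cast ((X.sdIter i).nonempty_of_mem hv).card_pos.ne'
    refine ⟨q * ∑ u ∈ s, k u, ?_⟩
    have e : X.pos (i + 1) v = (s.card : ℝ)⁻¹ • ∑ u ∈ s, X.pos i u := rfl
    rw [e, map_smul, map_sum, smul_eq_mul, pow_succ', Nat.cast_mul, Nat.cast_sum,
      ← Finset.sum_congr rfl fun u _ => hk u, ← Finset.sum_mul]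
    have hq' : (((d + 1).factorial : ℕ) : ℝ) = s.card * q := by exact_mod_cast hq
    rw [hq']
    field_simp

/-- Outside `σ` the mass is smaller than `1`, and by `exists_mass_eq` it is a multiple of `1 / ((d +
1)!) ^ i`. This gap is uniform in `σ` and in the vertex, although `X` may be infinite. -/
theorem mass_le_of_notMem_cell {d : ℕ} (hd : ∀ s ∈ X.K.faces, s.card ≤ d + 1) {σ : Finset X.V} {i : ℕ}
    {v : (X.sdIter i).V} (h : X.pos i v ∉ X.cell σ) :
    mass σ (X.pos i v) ≤ 1 - 1 / (((d + 1).factorial : ℕ) : ℝ) ^ i := by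
  obtain ⟨s, hs⟩ := exists_pos_mem_cell hd i v
  obtain ⟨k, hk⟩ := exists_mass_eq hd σ i v
  have hN : 0 < (((d + 1).factorial : ℕ) : ℝ) ^ i := by
    have : (0 : ℝ) < ((d + 1).factorial : ℕ) := by exact_mod_cast Nat.factorial_pos _
    positivity
  have h1 := mass_le_one hs σ
  have h2 : mass σ (X.pos i v) < 1 := lt_of_le_of_ne h1 fun e => h (mem_cell_of_mass hs e)
  have h3 : (k : ℝ) < (((d + 1).factorial ^ i : ℕ) : ℝ) := by
    rw [← hk, Nat.cast_pow]
    exact mul_lt_of_lt_one_left hN h2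
  have h4 : (k : ℝ) + 1 ≤ (((d + 1).factorial ^ i : ℕ) : ℝ) := by exact_mod_cast h3
  rw [Nat.cast_pow, ← hk] at h4
  rw [le_sub_iff_add_le, ← mul_le_mul_iff_left₀ hN, add_mul, div_mul_cancel₀ _ hN.ne', one_mul]
  exact h4

theorem average_mass_le {T : Type*} {s : Finset T} (hs : s.Nonempty) {p : T → X.V → ℝ} {σ : Finset X.V}
    {M : ℝ} (h : ∀ v ∈ s, mass σ (p v) ≤ M) : mass σ ((s.card : ℝ)⁻¹ • ∑ v ∈ s, p v) ≤ M := by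
  have hc : (0 : ℝ) < s.card := by exact_mod_cast hs.card_pos
  rw [map_smul, map_sum, smul_eq_mul, inv_mul_le_iff₀ hc, ← nsmul_eq_mul]
  exact Finset.sum_le_card_nsmul _ _ _ h

/-- `T'` is the simplex of `Sd^i X` of whose subdivision `T` is a part, found by repeatedly taking
the top of a chain. Masses of vertices of `T` are iterated averages of masses of vertices of `T'`,
and the approximations send vertices of `T` to vertices of `T'`. -/
theorem exists_ancestor (r : ∀ j, Approx (X.sdIter j)) (σ : Finset X.V) (i k : ℕ)
    (T : (X.sdIter (i + k)).Simplex) : ∃ T' : (X.sdIter i).Simplex,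
      (∀ w ∈ T.1, ∃ v ∈ T'.1, rIter r (i + k) w = rIter r i v) ∧
      ∀ M : ℝ, (∀ v ∈ T'.1, mass σ (X.pos i v) ≤ M) → ∀ w ∈ T.1, mass σ (X.pos (i + k) w) ≤ M := by
  induction k with
  | zero => exact ⟨T, fun w hw => ⟨w, hw, rfl⟩, fun M h => h⟩
  | succ k ih =>
    obtain ⟨m, hm, hmax⟩ := T.1.exists_maximal T.2.1
    have hle : ∀ t ∈ T.1, t ≤ m := fun t ht => by
      rcases T.2.2 t ht m hm with h | h
      · exact h
      · exact hmax ht h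
    obtain ⟨T', h1, h2⟩ := ih m
    refine ⟨T', fun w hw => h1 _ (hle w hw ((r (i + k)).mem w)), fun M h w hw => ?_⟩
    exact average_mass_le ((X.sdIter (i + k)).nonempty_of_mem (Subtype.property
      (show (X.sdIter (i + k)).Simplex from w))) fun u hu => h2 M h u (hle w hw hu)

/-- A simplex of a fine subdivision that comes close to `σ` is mapped to `σ`. -/
theorem rIter_mem_of_mass {d : ℕ} (hd : ∀ s ∈ X.K.faces, s.card ≤ d + 1) (r : ∀ j, Approx (X.sdIter j))
    {i : ℕ} {σ : X.Simplex}
    (hr : ∀ T : (X.sdIter i).Simplex, (∃ v ∈ T.1, X.pos i v ∈ X.cell σ.1) → ∀ v ∈ T.1, rIter r i v ∈ σ.1)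
    {j : ℕ} (hij : i ≤ j) {a : (X.sdIter j).Simplex}
    (ha : 1 - 1 / (((d + 1).factorial : ℕ) : ℝ) ^ i < mass σ.1 ((a.1.card : ℝ)⁻¹ • ∑ v ∈ a.1, X.pos j v)) :
    mapIter r j a ≤ σ := by
  obtain ⟨k, rfl⟩ := Nat.exists_eq_add_of_le hij
  obtain ⟨T', h1, h2⟩ := exists_ancestor r σ.1 i k a
  -- If no vertex of `T'` were in `σ`, all their masses, and so the mass of the barycentre of `a`,
  -- would stay below the gap.
  have key : ∃ v ∈ T'.1, X.pos i v ∈ X.cell σ.1 := by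
    by_contra! h
    refine ha.not_ge (average_mass_le ((X.sdIter (i + k)).nonempty_of_mem a.2) (h2 _ fun v hv => ?_))
    exact mass_le_of_notMem_cell hd (h v hv)
  intro u hu
  obtain ⟨w, hw, rfl⟩ := exists_of_mem_mapIter r hu
  obtain ⟨v, hv, e⟩ := h1 w hw
  rw [e]
  exact hr T' key v hv

theorem le_height (d n : ℕ) : (n : ℝ) ≤ height d n := by
  unfold height
  split_ifs with h
  · exact le_of_eq (by push_cast; rfl)
  · rw [Int.toNat_natCast]
    have : ∀ k ∈ Finset.range n, (1 : ℝ) ≤ (((d : ℝ) + 2) / (d + 1)) ^ k := fun k _ =>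
      one_le_pow₀ ((one_le_div (by positivity)).2 (by linarith))
    simpa using Finset.card_nsmul_le_sum _ _ _ this

/-- At height `h`, distance at most `B` in the cone means distance at most `B / h` in `X`. For large
`h` the masses of the two barycentres then differ by less than the gap of `mass_le_of_notMem_cell`.
So if one simplex lies in `σ`, the other is mapped into `σ`, and a single slice serves for all `σ`.
-/
theorem mapIter_le_of_coneDist {d : ℕ} (hd : ∀ s ∈ X.K.faces, s.card ≤ d + 1)
    (r : ∀ j, Approx (X.sdIter j)) {i : ℕ}
    (hr : ∀ σ : X.Simplex, ∀ T : (X.sdIter i).Simplex, (∃ v ∈ T.1, X.pos i v ∈ X.cell σ.1) →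
      ∀ v ∈ T.1, rIter r i v ∈ σ.1) (B : ℝ) :
    ∃ l : ℤ, ∀ (σ : X.Simplex) (a b : (X.sdIter l.toNat).Simplex),
      X.coneDist ((T0Simplex.slice l a).barycentre d) ((T0Simplex.slice l b).barycentre d) ≤
        ENNReal.ofReal B →
      ((∀ v ∈ a.1, X.pos l.toNat v ∈ X.cell σ.1) → mapIter r l.toNat b ≤ σ) ∧
      ((∀ v ∈ b.1, X.pos l.toNat v ∈ X.cell σ.1) → mapIter r l.toNat a ≤ σ) := by
  set N : ℝ := (((d + 1).factorial : ℕ) : ℝ) ^ i with hN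
  have hN0 : 0 < N := by
    have : (0 : ℝ) < ((d + 1).factorial : ℕ) := by exact_mod_cast Nat.factorial_pos _
    positivity
  have hs : 0 < √((d : ℝ) + 1) := Real.sqrt_pos.2 (by positivity)
  -- Points closer than `ε` have masses that differ by less than `√(d + 1) * ε = 1 / N`.
  set ε : ℝ := 1 / N / √(d + 1) with hε
  have hε0 : 0 < ε := by positivity
  obtain ⟨n, hn⟩ := exists_nat_gt (B / ε)
  have hh : B < height d ((i + n + 1 : ℕ) : ℤ) * ε := by
    rw [← div_lt_iff₀ hε0]
    refine hn.trans_le (le_trans ?_ (le_height d (i + n + 1)))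
    push_cast
    linarith [Nat.cast_nonneg (α := ℝ) i]
  have hh0 : 0 < height d ((i + n + 1 : ℕ) : ℤ) :=
    (Nat.cast_pos.2 (Nat.succ_pos _)).trans_le (le_height d (i + n + 1))
  -- The summand `i` ensures that the slice refines `Sd^i X`, the summand `n` that its height
  -- exceeds `B / ε`, and the summand `1` that its height is positive.
  refine ⟨((i + n + 1 : ℕ) : ℤ), fun σ a b hab => ?_⟩
  have hj : i ≤ (((i + n + 1 : ℕ) : ℤ)).toNat := by rw [Int.toNat_natCast]; omega
  generalize ((i + n + 1 : ℕ) : ℤ) = l at *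
  rw [coneDist_slice, max_eq_left hh0.le] at hab
  have hdist : X.stdDist ((a.1.card : ℝ)⁻¹ • ∑ v ∈ a.1, X.pos l.toNat v)
      ((b.1.card : ℝ)⁻¹ • ∑ v ∈ b.1, X.pos l.toNat v) < ENNReal.ofReal ε := by
    by_contra h
    have h1 := (mul_le_mul_right (not_lt.1 h) (ENNReal.ofReal (height d l))).trans hab
    rw [← ENNReal.ofReal_mul hh0.le, ENNReal.ofReal_le_ofReal_iff'] at h1
    have : 0 < height d l * ε := mul_pos hh0 hε0
    rcases h1 with h1 | h1 <;> linarith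
  have hm := mass_sub_lt_of_stdDist hd σ.1 hdist
  rw [show √((d : ℝ) + 1) * ε = 1 / N by rw [hε]; field_simp, abs_sub_lt_iff] at hm
  have hone : ∀ a : (X.sdIter l.toNat).Simplex, (∀ v ∈ a.1, X.pos l.toNat v ∈ X.cell σ.1) →
      mass σ.1 ((a.1.card : ℝ)⁻¹ • ∑ v ∈ a.1, X.pos l.toNat v) = 1 := fun a ha => by
    rw [mass_apply]
    exact (average_mem_cell ((X.sdIter _).nonempty_of_mem a.2) ha).2.2
  refine ⟨fun h => rIter_mem_of_mass hd r (hr σ) hj ?_, fun h => rIter_mem_of_mass hd r (hr σ) hj ?_⟩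
  · have := hone a h
    rw [← hN]
    linarith
  · have := hone b h
    rw [← hN]
    linarith

end OrderedComplex

/-! ### Contractions of retracts, and the equivalences. -/

section

variable {𝒢 : Type*} [Category 𝒢] [Preadditive 𝒢]

/-- A contraction of a complex induces one of a retract. -/
theorem contraction_of_retract {C D : ChainComplex 𝒢 ℤ} {F : C ⟶ D} {G : D ⟶ C} (h : F ≫ G = 𝟙 C)
    (P : ∀ n m, D.X n ⟶ D.X m) {p n m : ℤ} (hP : 𝟙 (D.X n) = D.d n p ≫ P p n + P n m ≫ D.d m n) :
    𝟙 (C.X n) = C.d n p ≫ (F.f p ≫ P p n ≫ G.f n) + (F.f n ≫ P n m ≫ G.f m) ≫ C.d m n := by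
  have h1 : F.f n ≫ 𝟙 (D.X n) ≫ G.f n = 𝟙 (C.X n) := by
    rw [Category.id_comp]
    exact congrArg (fun f : C ⟶ C => f.f n) h
  rw [← h1, hP]
  simp only [Preadditive.add_comp, Preadditive.comp_add, Category.assoc, G.comm, F.comm_assoc]

end

section

variable {𝒜 : Type u} [Category.{v} 𝒜] [Preadditive 𝒜] [HasFiniteBiproducts 𝒜]
    {X : OrderedComplex.{w}} {d : ℕ} (hd : ∀ s ∈ X.K.faces, s.card ≤ d + 1)
    (r : ∀ j, Approx (X.sdIter j)) {var : Variance}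
    (C : ChainComplex (SimplicialCat X var 𝒜) ℤ)

include hd

theorem exists_bounded_contraction
    (h : ∀ σ : X.Simplex, Nonempty (Homotopy (𝟙 (Graded.localComplex C σ)) 0)) :
    ∃ (P : Homotopy (𝟙 (tensorZ r C)) 0) (B : ℝ), ∀ (m n : ℤ) (F G : T0Simplex X),
      Graded.app (P.hom m n) F G ≠ 0 →
        X.coneDist (F.barycentre d) (G.barycentre d) ≤ ENNReal.ofReal B := by
  obtain ⟨P, hP⟩ := exists_homotopy_tensorZ r C fun j => (sdComplex_homotopy r hd C h j).some
  refine ⟨P, (d + 1) * √2, fun m n F G h0 => ?_⟩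
  obtain ⟨i, s, t, rfl, rfl, hst⟩ := hP m n F G h0
  refine coneDist_slice_le hd i ?_
  cases var
  · exact .inr hst
  · exact .inl hst

/-- The contraction of one high slice is transported to `C` along the retraction. The result is a
priori only a column finite matrix, but squeezing makes it triangular, and its diagonal components
contract the `C(σ)`. -/
theorem nonempty_homotopy_of_bounded_contraction (hr : Retracts r) (P : Homotopy (𝟙 (tensorZ r C)) 0)
    (B : ℝ) (hP : ∀ (m n : ℤ) (F G : T0Simplex X), Graded.app (P.hom m n) F G ≠ 0 →
      X.coneDist (F.barycentre d) (G.barycentre d) ≤ ENNReal.ofReal B) (σ : X.Simplex) :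
    Nonempty (Homotopy (𝟙 (Graded.localComplex C σ)) 0) := by
  obtain ⟨i, hi⟩ := hr
  obtain ⟨l, hl⟩ := mapIter_le_of_coneDist hd r hi B
  have hPl : ∀ n m, Fam.SuppIn (TensorZ.restrict r C l (P.hom n m))
      fun a b : (X.sdIter l.toNat).Simplex => X.coneDist ((T0Simplex.slice l a).barycentre d)
        ((T0Simplex.slice l b).barycentre d) ≤ ENNReal.ofReal B := fun n m a b h => hP n m _ _ h
  cases var
  · obtain ⟨F, G, hFG, hF, hG⟩ := exists_sdIter_upper r hd C l.toNat
    refine nonempty_homotopy_localComplex C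
      (fun n m => F.f n ≫ TensorZ.restrict r C l (P.hom n m) ≫ G.f m) (fun n m => ?_)
      (fun p n m hp hm => contraction_of_retract hFG (fun n m => TensorZ.restrict r C l (P.hom n m))
        (TensorZ.restrict_homotopy r C P l hp hm)) σ
    -- From a simplex `a` of the slice, `P` followed by `G` ends in every `σ` that contains `a`.
    -- Since `F` leads from `σ` only to simplices inside `σ`, the composite goes from `σ` to its
    -- faces.
    refine (hF n).comp ((hPl n m).comp (Q'' := fun (a : (X.sdIter l.toNat).Simplex) (τ : X.Simplex) => ∀ σ : X.Simplex,
      (∀ v ∈ a.1, X.pos l.toNat v ∈ X.cell σ.1) → τ ≤ σ) (hG m) ?_) ?_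
    · rintro a b _ h1 rfl σ h2
      exact (hl σ a b h1).1 h2
    · exact fun σ a τ h1 h2 => h2 σ h1
  · obtain ⟨F, G, hFG, hF, hG⟩ := exists_sdIter_lower r hd C l.toNat
    refine nonempty_homotopy_localComplex C
      (fun n m => F.f n ≫ TensorZ.restrict r C l (P.hom n m) ≫ G.f m) (fun n m => ?_)
      (fun p n m hp hm => contraction_of_retract hFG (fun n m => TensorZ.restrict r C l (P.hom n m))
        (TensorZ.restrict_homotopy r C P l hp hm)) σ
    -- Now the end point `τ` of `G` contains the target `b` of `P`, so the source `a`, close to `b`,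
    -- is mapped into `τ`; and the image of `a` is the simplex where `F` started.
    refine (hF n).comp ((hPl n m).comp (Q'' := fun (a : (X.sdIter l.toNat).Simplex) (τ : X.Simplex) => mapIter r l.toNat a ≤ τ) (hG m) ?_) ?_
    · exact fun a b τ h1 h2 => (hl τ a b h1).2 h2
    · rintro _ a τ rfl h2
      exact h2

end

theorem theorem10p1 {𝒜 : Type u} [Category.{v} 𝒜] [Preadditive 𝒜] [HasFiniteBiproducts 𝒜]
    (X : OrderedComplex.{w}) (d : ℕ) (hd : ∀ s ∈ X.K.faces, s.card ≤ d + 1)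
    (r : ∀ j, Approx (X.sdIter j)) (hr : Retracts r) (var : Variance)
    (C : ChainComplex (SimplicialCat X var 𝒜) ℤ) (hC : {n : ℤ | ¬ IsZero (C.X n)}.Finite) :
    List.TFAE [
      ∀ σ : X.Simplex, Nonempty (Homotopy (𝟙 (Graded.localComplex C σ)) 0),
      Nonempty (Homotopy (𝟙 C) 0),
      ∃ (P : Homotopy (𝟙 (tensorZ r C)) 0) (B : ℝ), ∀ (m n : ℤ) (F G : T0Simplex X),
        Graded.app (P.hom m n) F G ≠ 0 → X.coneDist (F.barycentre d) (G.barycentre d) ≤ ENNReal.ofReal B] := by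
  tfae_have 1 → 2 := nonempty_homotopy_of_localComplex C hd
  tfae_have 2 → 1 := fun ⟨h⟩ => nonempty_homotopy_localComplex_of_homotopy C h
  tfae_have 1 → 3 := exists_bounded_contraction hd r C
  tfae_have 3 → 1 := fun ⟨P, B, h⟩ => nonempty_homotopy_of_bounded_contraction hd r C hr P B h
  tfae_finish
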